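/- **Setting.** Let $d\ge 1$, $0<\underline\beta\le 1$, $\underline\beta\le\bar\beta$, $b,L>0$, $0<\underline\rho\le\bar\rho$. For $\beta>0$ let $\lfloor\beta\rfloor$ be the largest integer strictly less than $\beta$. Write $K(u)=\mathbf 1\{\|u\|_\infty\le 1\}$. For an integer $q\ge 2$ and an integer $l\ge 0$ let $\mathcal B^q_l$ be the set of the $q^{ld}$ closed hypercubes $\prod_i[\frac{m_i-1}{q^l},\frac{m_i}{q^l}]$, $m_i\in\{1,\dots,q^l\}$. *Model.* Contexts $X_1,X_2,\dots\in[0,1]^d$ have a density $p_X$ with $\underline\rho\le p_X\le\bar\rho$ on $[0,1]^d$. There are two arms; the reward of arm $k\in\{1,2\}$ at time $t$ is $Y_{k,t}\in\{0,1\}$ with $\mathbb E[Y_{k,t}\mid X_t]=f_k(X_t)$. The vectors $(X_t,Y_{1,t},Y_{2,t})$ are independent over $t$, and only the reward of the chosen arm is observed. *Hölder payoffs.* $f\in\mathcal H(\beta,L)$ if $f:[0,1]^d\to\mathbb R$ is $\lfloor\beta\rfloor$ times continuously differentiable and $|f(x')-\sum_{|s|\le\lfloor\beta\rfloor}\frac{(x'-x)^s}{s!}D^sf(x)|\le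 L\|x-x'\|_\infty^\beta$ for all $x,x'\in[0,1]^d$; $\mathcal H(\beta)=\bigcup_{L\ge 0}\mathcal H(\beta,L)$. *Self-similar payoffs.* For a hypercube $U$, let $\Gamma^p_hf(x;U)$ be the value at $x$ of the polynomial $g$ of degree at most $p$ that minimizes $\int_U|f(u)-g(u)|^2K(\frac{x-u}h)p_X(u\mid U)\,du$, where $p_X(\cdot\mid U)$ is the density conditional on $U$. The pair $(f_1,f_2)$ is self-similar, $(f_1,f_2)\in\mathcal F^{ss}(\beta,b,l_0)$, if $f_1,f_2\in\mathcal H(\beta)$ and for all integers $l\ge l_0$, $l\ge 0$, $q>1$ and $\lfloor\beta\rfloor\le p\le\lfloor\bar\beta\rfloor$ $$\max_{B\in\mathcal B^q_l}\max_{k}\sup_{x\in B}|\Gamma^p_{q^{-l}}f_k(x;B)-f_k(x)|\ge b\,q^{-l\beta}.$$ *Local polynomial estimator.* For data $\mathcal D=\{(X_i,Y_i)\}_{i\le n}$, a point $x$, a bandwidth $h>0$ and a degree $p\ge 0$, let $\hat\theta$ be a polynomial of degree at most $p$ that minimizes $\sum_i(Y_i-\hat\theta(X_i-x))^2K(\frac{X_i-x}h)$.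 The estimator $\hat\eta(x;\mathcal D,h,p)\in[0,1]$ is $\hat\theta(0)$ truncated to $[0,1]$ if the minimizer is unique, and $0$ otherwise. *Smoothness estimation phase of SACB*, with horizon $T$, base $q$, tuning parameter $\gamma>0$ and $\upsilon=\frac d{\underline\beta}+4$. Put $l=\lceil\frac{(\underline\beta+d-1)\log_qT}{(2\bar\beta+d)^2}\rceil$, $\bar r=\lceil 2l\bar\beta+\upsilon\log_q\log T\rceil$, $j_1=l$, $j_2=l+\lceil\frac1{\underline\beta}\log_q\log T\rceil$ and $\tilde l=\lceil\frac{\bar\beta l}{\underline\beta}+\frac{\log_q\log T}{\underline\beta}\rceil\vee\lceil(1+\bar\beta)l+\log_q\log T\rceil$. In each $B\in\mathcal B^q_l$ the two arms are pulled alternately whenever the context falls in $B$, in rounds $r=1,2,\dots,\bar r$ of $q^r$ samples for each arm (after round $\bar r$ the alternation goes on). At the end of round $r$, with $\mathcal D_k$ the samples of arm $k$ from that round, the flag of $B$ is raised and $r_{\rm last}^{(B)}:=r$ is recorded if the flag was not raised before and $$\sup_{k,\;x}|\hat\eta(x;\mathcal D_k,q^{-j_1},\lfloor\bar\beta\rfloor)-\hat\eta(x;\mathcal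 D_k,q^{-j_2},\lfloor\bar\beta\rfloor)|>\gamma(\log T)^{\frac d{2\underline\beta}+\frac12}q^{-r/2},$$ where $x$ ranges over the points of $B$ of the form $(m_1q^{-\tilde l},\dots,m_dq^{-\tilde l})$, $m_i\in\{1,\dots,q^{\tilde l}\}$; if this never happens, $r^{(B)}_{\rm last}=\bar r$. The phase ends at the first time $T_{\rm SACB}$ at which every $B\in\mathcal B^q_l$ has been flagged or has completed round $\bar r$, and the estimate is then $\hat\beta_{\rm SACB}=\frac1{2l}[\min_Br^{(B)}_{\rm last}-\upsilon\log_q\log T]$. **Theorem.** There are positive constants $c_1,c_2,c_3,c_4,c_6$ that depend only on $\underline\beta,\bar\beta,b,L,\underline\rho,\bar\rho,d$, and for every integer $q\ge2$ a constant $c_5>0$ that depends only on these parameters and $q$, such that the following holds. For every $\gamma>0$ and $l_0\ge0$ there is $T_0>0$ (depending only on the parameters listed and on $q,\gamma,l_0$) such that, for every $T\ge T_0$, every $\beta\in[\underline\beta,\bar\beta]$ and every model as above with $f_1,f_2\in\mathcal H(\beta,L)$ and $(f_1,f_2)\in\mathcal F^{ss}(\beta,b,l_0)$: 1. the estimate is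 computed by time $\lceil\frac4{\underline\rho}(\log T)^{\frac{2d}{\underline\beta}+4}T^{\frac{\underline\beta+d-1}{2\bar\beta+d}}\rceil$ (that is, $T_{\rm SACB}$ is at most this number) with probability at least $1-2T^{c_1}\exp(-c_2T^{c_3})$; 2. $$\mathbb P\Big(\hat\beta_{\rm SACB}\in\Big[\beta-\frac{3(2\bar\beta+d)^2\log_q\log T}{(\underline\beta+d-1)\log_qT},\;\beta\Big]\Big)\ge 1-c_4(\log T)^{\frac d{\underline\beta}}T^{-\gamma^2c_5+c_6}.$$ -/

import Mathlib

open MeasureTheory ProbabilityTheory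

noncomputable section

namespace SACB

/-! ### Hypercubes, Hölder classes -/

/-- The covariate space `[0,1]^d`. The norm of `Fin d → ℝ` is the sup norm. -/
def cube (d : ℕ) : Set (Fin d → ℝ) := Set.Icc 0 1

/-- Indices `m ∈ {0, …, q^l - 1}^d` of the hypercubes of side `q^{-l}` that partition `[0,1]^d`. -/
def bins (d q l : ℕ) : Finset (Fin d → ℕ) := Fintype.piFinset fun _ => Finset.range (q ^ l)

/-- The closed hypercube `∏ i, [m i / q^l, (m i + 1) / q^l]`. -/
def bin {d : ℕ} (q l : ℕ) (m : Fin d → ℕ) : Set (Fin d → ℝ) :=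
  {x | ∀ i, (m i : ℝ) / (q : ℝ) ^ l ≤ x i ∧ x i ≤ ((m i : ℝ) + 1) / (q : ℝ) ^ l}

/-- The index of a hypercube that contains the covariate `x` (ties, which have probability zero,
go to the larger index where there is one). -/
def binOf {d : ℕ} (q l : ℕ) (x : Fin d → ℝ) : Fin d → ℕ :=
  fun i => min ⌊x i * (q : ℝ) ^ l⌋₊ (q ^ l - 1)

/-- For `β > 0`, the largest integer that is strictly smaller than `β`. -/
def floorLt (β : ℝ) : ℕ := ⌈β⌉₊ - 1

/-- The Taylor expansion of `f` of degree `n` at the point `x` of `[0,1]^d`, evaluated at `y`: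
the `j`-th summand is `∑_{|s| = j} (y - x)^s / s! * D^s f(x)`. -/
def taylorPoly {d : ℕ} (n : ℕ) (f : (Fin d → ℝ) → ℝ) (x y : Fin d → ℝ) : ℝ :=
  ∑ j ∈ Finset.range (n + 1),
    ((Nat.factorial j : ℝ))⁻¹ * iteratedFDerivWithin ℝ j f (cube d) x (fun _ => y - x)

/-- The Hölder class of exponent `β` and constant `L` on `[0,1]^d`. -/
def IsHolder {d : ℕ} (β L : ℝ) (f : (Fin d → ℝ) → ℝ) : Prop :=
  ContDiffOn ℝ (floorLt β : ℕ) f (cube d) ∧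
    ∀ x ∈ cube d, ∀ y ∈ cube d, |f y - taylorPoly (floorLt β) f x y| ≤ L * ‖x - y‖ ^ β

/-! ### Projections on polynomials, self-similar payoffs -/

/-- The kernel `1{‖u‖_∞ ≤ 1}`. -/
def kernel {d : ℕ} (u : Fin d → ℝ) : ℝ := Set.indicator {v : Fin d → ℝ | ‖v‖ ≤ 1} (fun _ => 1) u

/-- The density `p_X(u | U)` of the covariates conditional on the set `U`. -/
def condDensity {d : ℕ} (pX : (Fin d → ℝ) → ℝ) (U : Set (Fin d → ℝ)) (u : Fin d → ℝ) : ℝ :=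
  pX u / ∫ v in U, pX v

/-- The criterion minimized by the projection at the point `x`. -/
def projLoss {d : ℕ} (pX : (Fin d → ℝ) → ℝ) (U : Set (Fin d → ℝ)) (h : ℝ)
    (f : (Fin d → ℝ) → ℝ) (x : Fin d → ℝ) (g : MvPolynomial (Fin d) ℝ) : ℝ :=
  ∫ u in U, |f u - MvPolynomial.eval u g| ^ 2 * kernel (h⁻¹ • (x - u)) * condDensity pX U u

/-- `g` minimizes the criterion among the polynomials of degree at most `p`. -/
def IsProjection {d : ℕ} (pX : (Fin d → ℝ) → ℝ) (U : Set (Fin d → ℝ)) (h : ℝ) (p : ℕ)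
    (f : (Fin d → ℝ) → ℝ) (x : Fin d → ℝ) (g : MvPolynomial (Fin d) ℝ) : Prop :=
  g.totalDegree ≤ p ∧ ∀ g' : MvPolynomial (Fin d) ℝ, g'.totalDegree ≤ p →
    projLoss pX U h f x g ≤ projLoss pX U h f x g'

open Classical in
/-- The value at `x` of the `L²`-projection of `f` on the polynomials of degree at most `p` over
the hypercube `U`, with bandwidth `h`. -/
def proj {d : ℕ} (pX : (Fin d → ℝ) → ℝ) (U : Set (Fin d → ℝ)) (h : ℝ) (p : ℕ)
    (f : (Fin d → ℝ) → ℝ) (x : Fin d → ℝ) : ℝ :=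
  if hg : ∃ g, IsProjection pX U h p f x g then MvPolynomial.eval x hg.choose else 0

/-- The pair of payoff functions `f 0, f 1` is self-similar with exponent `β` and constants
`b, l₀`. The supremum is taken in `[0, ∞]`. -/
def SelfSimilar {d : ℕ} (βhi : ℝ) (pX : (Fin d → ℝ) → ℝ) (β b l₀ : ℝ)
    (f : Fin 2 → (Fin d → ℝ) → ℝ) : Prop :=
  (∀ k, ∃ L : ℝ, 0 ≤ L ∧ IsHolder β L (f k)) ∧
    ∀ l q p : ℕ, l₀ ≤ l → 1 < q → floorLt β ≤ p → p ≤ floorLt βhi →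
      ENNReal.ofReal (b * (q : ℝ) ^ (-((l : ℝ) * β))) ≤
        ⨆ m ∈ bins d q l, ⨆ k : Fin 2, ⨆ x ∈ bin q l m,
          ENNReal.ofReal |proj pX (bin q l m) (((q : ℝ) ^ l)⁻¹) p (f k) x - f k x|

/-! ### The bandit model -/

/-- The density `pX` is bounded above and away from zero on `[0,1]^d`. -/
def BoundedDensity {d : ℕ} (ρlo ρhi : ℝ) (pX : (Fin d → ℝ) → ℝ) : Prop :=
  Measurable pX ∧ ∀ x ∈ cube d, ρlo ≤ pX x ∧ pX x ≤ ρhi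

/-- Contexts `X 0, X 1, …` and potential rewards `Y t · k` (the reward of arm `k` at the `t`-th
step, of which only that of the chosen arm is observed). The contexts have density `pX`, the
rewards lie in `{0, 1}`, `f k` is the regression function of the reward of arm `k`, and different
time steps are independent. -/
structure IsModel {d : ℕ} {Ω : Type*} [MeasurableSpace Ω] (P : Measure Ω)
    (pX : (Fin d → ℝ) → ℝ) (f : Fin 2 → (Fin d → ℝ) → ℝ)
    (X : ℕ → Ω → Fin d → ℝ) (Y : ℕ → Ω → Fin 2 → ℝ) : Prop where
  measurable_X : ∀ t, Measurable (X t)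
  measurable_Y : ∀ t, Measurable (Y t)
  law_X : ∀ t, P.map (X t) =
    (volume.restrict (cube d)).withDensity (fun x => ENNReal.ofReal (pX x))
  binary : ∀ t, ∀ᵐ ω ∂P, ∀ k, Y t ω k = 0 ∨ Y t ω k = 1
  regression : ∀ t k,
    P[fun ω => Y t ω k | MeasurableSpace.comap (X t) inferInstance] =ᵐ[P] fun ω => f k (X t ω)
  indep : iIndepFun (fun t ω => (X t ω, Y t ω)) P

/-! ### Local polynomial regression -/

/-- The weighted least squares criterion for the data `D` at the point `x`. -/
def lprLoss {d : ℕ} (D : List ((Fin d → ℝ) × ℝ)) (h : ℝ) (x : Fin d → ℝ)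
    (θ : MvPolynomial (Fin d) ℝ) : ℝ :=
  (D.map fun z => (z.2 - MvPolynomial.eval (z.1 - x) θ) ^ 2 * kernel (h⁻¹ • (z.1 - x))).sum

/-- `θ` minimizes the criterion among the polynomials of degree at most `p`. -/
def IsLprMin {d : ℕ} (D : List ((Fin d → ℝ) × ℝ)) (h : ℝ) (p : ℕ) (x : Fin d → ℝ)
    (θ : MvPolynomial (Fin d) ℝ) : Prop :=
  θ.totalDegree ≤ p ∧ ∀ θ' : MvPolynomial (Fin d) ℝ, θ'.totalDegree ≤ p →
    lprLoss D h x θ ≤ lprLoss D h x θ'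

open Classical in
/-- The local polynomial estimator at `x`, with values in `[0,1]`: the value at `0` of the
minimizer, truncated to `[0,1]`, if there is a unique minimizer, and `0` otherwise. -/
def lpr {d : ℕ} (D : List ((Fin d → ℝ) × ℝ)) (h : ℝ) (p : ℕ) (x : Fin d → ℝ) : ℝ :=
  if hθ : ∃! θ, IsLprMin D h p x θ then max 0 (min 1 (MvPolynomial.eval 0 hθ.choose)) else 0

/-! ### The smoothness estimation phase of the policy -/

/-- The inputs of the policy: base `q`, horizon `T`, smallest and largest exponent, tuning
parameter `γ`, under-smoothing coefficient `υ`. -/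
structure Params where
  q : ℕ
  T : ℕ
  βlo : ℝ
  βhi : ℝ
  γ : ℝ
  υ : ℝ

/-- `log_q T`. -/
def Params.lg (a : Params) : ℝ := Real.logb a.q a.T

/-- `log_q log T`. -/
def Params.lglg (a : Params) : ℝ := Real.logb a.q (Real.log a.T)

/-- The resolution `l` of the partition. -/
def Params.level (a : Params) (d : ℕ) : ℕ :=
  ⌈(a.βlo + d - 1) * a.lg / (2 * a.βhi + d) ^ 2⌉₊

/-- The largest round index. -/
def Params.rmax (a : Params) (d : ℕ) : ℕ :=
  ⌈2 * (a.level d : ℝ) * a.βhi + a.υ * a.lglg⌉₊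

/-- The larger bandwidth exponent is `l`, the smaller bandwidth has this exponent. -/
def Params.level₂ (a : Params) (d : ℕ) : ℕ := a.level d + ⌈1 / a.βlo * a.lglg⌉₊

/-- The resolution of the mesh. -/
def Params.meshLevel (a : Params) (d : ℕ) : ℕ :=
  max ⌈a.βhi * (a.level d : ℝ) / a.βlo + a.lglg / a.βlo⌉₊
    ⌈(1 + a.βhi) * (a.level d : ℝ) + a.lglg⌉₊

/-- The mesh points in the hypercube with index `m`. -/
def Params.mesh (a : Params) {d : ℕ} (m : Fin d → ℕ) : Set (Fin d → ℝ) :=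
  {x | x ∈ bin a.q (a.level d) m ∧
    ∀ i, ∃ n : ℕ, 1 ≤ n ∧ n ≤ a.q ^ a.meshLevel d ∧ x i = (n : ℝ) / (a.q : ℝ) ^ a.meshLevel d}

/-- The test made at the end of round `r` in the hypercube `m` with the samples `D k` of the two
arms: at some mesh point, the estimates with the two bandwidths differ by more than the
threshold. -/
def Params.test (a : Params) {d : ℕ} (m : Fin d → ℕ) (r : ℕ)
    (D : Fin 2 → List ((Fin d → ℝ) × ℝ)) : Prop :=
  ∃ k : Fin 2, ∃ x ∈ a.mesh m,
    a.γ * Real.log a.T ^ ((d : ℝ) / (2 * a.βlo) + 1 / 2) / (a.q : ℝ) ^ ((r : ℝ) / 2) <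
      |lpr (D k) (((a.q : ℝ) ^ a.level d)⁻¹) (floorLt a.βhi) x -
        lpr (D k) (((a.q : ℝ) ^ a.level₂ d)⁻¹) (floorLt a.βhi) x|

/-- The memory of the policy: for each hypercube the current round, the samples of each arm
collected in that round (their numbers are the two counters), the flag, and the recorded round
`rlast`. -/
structure State (d : ℕ) where
  round : (Fin d → ℕ) → ℕ
  data : (Fin d → ℕ) → Fin 2 → List ((Fin d → ℝ) × ℝ)
  flag : (Fin d → ℕ) → Prop
  rlast : (Fin d → ℕ) → ℕ

/-- Rounds start at `1`; `rlast` is the largest round index as long as nothing is recorded. -/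
def Params.init (a : Params) (d : ℕ) : State d where
  round := fun _ => 1
  data := fun _ _ => []
  flag := fun _ => False
  rlast := fun _ => a.rmax d

/-- The arm chosen in the hypercube `m`: the arms alternate. -/
def State.arm {d : ℕ} (s : State d) (m : Fin d → ℕ) : Fin 2 :=
  if (s.data m 1).length < (s.data m 0).length then 1 else 0

open Classical in
/-- One time step, with context `x` and potential rewards `y`. -/
def Params.step (a : Params) {d : ℕ} (s : State d) (x : Fin d → ℝ) (y : Fin 2 → ℝ) : State d :=
  let m := binOf a.q (a.level d) x
  let k := s.arm m
  let r := s.round m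
  let D := Function.update (s.data m) k ((x, y k) :: s.data m k)
  if 2 * a.q ^ r ≤ (D 0).length + (D 1).length ∧ r ≤ a.rmax d then
    { round := Function.update s.round m (r + 1)
      data := Function.update s.data m (fun _ => [])
      flag := Function.update s.flag m (s.flag m ∨ a.test m r D)
      rlast := if ¬ s.flag m ∧ a.test m r D then Function.update s.rlast m r else s.rlast }
  else
    { s with data := Function.update s.data m D }

/-- The phase ends when every hypercube is flagged or has completed all rounds. -/
def Params.Done (a : Params) {d : ℕ} (s : State d) : Prop :=
  ∀ m ∈ bins d a.q (a.level d), s.flag m ∨ a.rmax d < s.round m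

/-- The state after `t` time steps on the given contexts and potential rewards, without regard to
the stopping rule. -/
def Params.run (a : Params) {d : ℕ} (x : ℕ → Fin d → ℝ) (y : ℕ → Fin 2 → ℝ) : ℕ → State d
  | 0 => a.init d
  | t + 1 => a.step (Params.run a x y t) (x t) (y t)

/-- `t` is the time step at which the phase ends. -/
def Params.StopsAt (a : Params) {d : ℕ} (x : ℕ → Fin d → ℝ) (y : ℕ → Fin 2 → ℝ) (t : ℕ) : Prop :=
  1 ≤ t ∧ a.Done (a.run x y t) ∧ ∀ s, 1 ≤ s → s < t → ¬ a.Done (a.run x y s)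

/-- The smoothness estimate computed from the state at which the phase ends. -/
def Params.estimate (a : Params) {d : ℕ} (s : State d) : ℝ :=
  1 / (2 * (a.level d : ℝ)) *
    (((sInf (s.rlast '' (bins d a.q (a.level d) : Set (Fin d → ℕ))) : ℕ) : ℝ) - a.υ * a.lglg)

end SACB

end

/-!
As long as the threshold is large compared with the bias `q ^ (-l β)` of the estimators no flag is
raised, and by the time it is small compared with the gap that self-similarity guarantees some flag
has been raised. The thresholds decay like `q ^ (-r / 2)`, so both happen in rounds
`2 l β + O(log_q log T)`, and the smallest recorded round reveals `β`.

**The estimator.** In the coordinates of the monomials the local polynomial estimator solves a least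
squares problem. If its Gram matrix is well conditioned, the estimator is close to the truncated
value of any polynomial for which the moments of the residuals are small (`abs_lpr_sub_le`). The
mean of the Gram matrix is well conditioned because the part of a window inside the hypercube
contains a cube of comparable size with a corner at the centre of the window, on which the `L²` norm
of a polynomial controls the norm of its coefficients (`exists_window_lower`).

**The samples.** When a visit to a hypercube is used for arm `k` in round `r` is decided by the
number of earlier visits alone (`clock`, `run_spec`). Hence a sum over the samples of a round comes
with an exponential supermartingale along the whole sequence of contexts and rewards
(`lintegral_prod_le_one`), and satisfies a Bernstein inequality (`measure_sample_sum_ge_le`), as if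
the samples were drawn independently from the hypercube. Together with the deterministic bound this
gives the deviation of the estimator (`measure_lpr_le`), applied with two targets:
* the Taylor polynomial of the payoff, with a bias of order `h ^ β`
  (`exists_measure_lpr_sub_payoff_le`);
* for the larger bandwidth, whose window is the whole hypercube, the projection of the payoff on the
  polynomials, without any bias, because the residuals of the projection are orthogonal to the
  polynomials (`exists_measure_lpr_sub_projection_le`).

**The gap.** Self-similarity provides a hypercube, an arm and a point at which the projection misses
the payoff by the order `q ^ (-l β)`. The estimator is truncated to `[0,1]`, which could hide this
difference. But the difference has mean zero over the hypercube, so that it is large with either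
sign, and the payoff is almost constant there, hence stays away from `0` or from `1`; one of the two
signs survives truncation. By Hölder continuity it survives at a mesh point as well
(`exists_truncated_gap`). The smaller bandwidth makes the bias of the other estimator smaller by a
factor `log T`, so the two estimators differ by the order of the gap.

**Probabilities.** The number of hypercubes, rounds, arms and mesh points is polynomial in `T`, up
to a factor `log T`, and the threshold exceeds the standard deviation of the estimators by a factor
of order `γ √(log T)`, so that each deviation has probability at most of order `T ^ (-c γ ^ 2)`. A
union bound gives the second claim (`one_sub_le_measure_estimate`). For the first, the phase ends as
soon as each hypercube has been visited `2 ∑_{r ≤ rmax} q ^ r` times, and the number of visits to a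
hypercube has an exponentially small lower tail (`measure_exists_visits_lt_le`).
-/

noncomputable section

namespace SACB

/-! ### Polynomials of bounded degree in coordinates -/

/-- The multi-indices of length at most `p`. -/
def multiIdx (d p : ℕ) : Finset (Fin d →₀ ℕ) :=
  (Finset.range (p + 1)).biUnion fun j => Finset.finsuppAntidiag Finset.univ j

lemma mem_multiIdx {d p : ℕ} {α : Fin d →₀ ℕ} : α ∈ multiIdx d p ↔ ∑ i, α i ≤ p := by
  simp [multiIdx, Finset.mem_finsuppAntidiag]

/-- The monomial function `v ↦ v ^ α`. -/
def feat {d : ℕ} (α : Fin d →₀ ℕ) (v : Fin d → ℝ) : ℝ := ∏ i, v i ^ α i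

/-- The polynomial function of degree at most `p` with coefficients `c`. -/
def lin {d p : ℕ} (c : multiIdx d p → ℝ) (v : Fin d → ℝ) : ℝ := ∑ α, c α * feat α.1 v

/-- The multi-index `0`. -/
def zeroIdx (d p : ℕ) : multiIdx d p := ⟨0, by simp [mem_multiIdx]⟩

lemma continuous_feat {d : ℕ} (α : Fin d →₀ ℕ) : Continuous (feat α) := by
  unfold feat; fun_prop

lemma continuous_lin {d p : ℕ} (c : multiIdx d p → ℝ) : Continuous (lin c) := by
  unfold lin; exact continuous_finsetSum _ fun α _ => continuous_const.mul (continuous_feat _)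

lemma abs_feat_le_one {d : ℕ} (α : Fin d →₀ ℕ) {v : Fin d → ℝ} (hv : ‖v‖ ≤ 1) :
    |feat α v| ≤ 1 := by
  unfold feat
  rw [Finset.abs_prod]
  refine Finset.prod_le_one (fun i _ => abs_nonneg _) fun i _ => ?_
  rw [abs_pow]
  exact pow_le_one₀ (abs_nonneg _) ((norm_le_pi_norm v i).trans hv)

lemma feat_zero_right {d : ℕ} {α : Fin d →₀ ℕ} (hα : α ≠ 0) : feat α 0 = 0 := by
  obtain ⟨i, hi⟩ := Finsupp.ne_iff.1 hα
  exact Finset.prod_eq_zero (Finset.mem_univ i) (by simpa using hi)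

lemma abs_feat_le_norm {d : ℕ} {α : Fin d →₀ ℕ} (hα : α ≠ 0) {v : Fin d → ℝ} (hv : ‖v‖ ≤ 1) :
    |feat α v| ≤ ‖v‖ := by
  obtain ⟨i, hi⟩ := Finsupp.ne_iff.1 hα
  have hi' : α i ≠ 0 := by simpa using hi
  have h1 : ∀ j, |v j| ≤ 1 := fun j => (norm_le_pi_norm v j).trans hv
  unfold feat
  rw [Finset.abs_prod, ← Finset.mul_prod_erase _ _ (Finset.mem_univ i)]
  have h2 : |v i ^ α i| ≤ ‖v‖ := by
    rw [abs_pow]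
    exact (pow_le_of_le_one (abs_nonneg _) (h1 i) hi').trans (norm_le_pi_norm v i)
  have h3 : ∏ j ∈ Finset.univ.erase i, |v j ^ α j| ≤ 1 :=
    Finset.prod_le_one (fun i _ => abs_nonneg _) fun j _ => by
      rw [abs_pow]; exact pow_le_one₀ (abs_nonneg _) (h1 j)
  calc _ ≤ ‖v‖ * 1 := by gcongr
    _ = _ := mul_one _

lemma lin_zero_right {d p : ℕ} (c : multiIdx d p → ℝ) : lin c 0 = c (zeroIdx d p) := by
  unfold lin
  rw [Finset.sum_eq_single (zeroIdx d p)]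
  · simp [feat, zeroIdx]
  · intro α _ hα
    rw [feat_zero_right, mul_zero]
    intro h
    exact hα (Subtype.ext h)
  · simp

lemma abs_lin_le {d p : ℕ} (c : multiIdx d p → ℝ) {v : Fin d → ℝ} (hv : ‖v‖ ≤ 1) :
    |lin c v| ≤ ∑ α, |c α| := by
  unfold lin
  refine (Finset.abs_sum_le_sum_abs _ _).trans (Finset.sum_le_sum fun α _ => ?_)
  rw [abs_mul]
  exact mul_le_of_le_one_right (abs_nonneg _) (abs_feat_le_one _ hv)

lemma abs_lin_sub_le {d p : ℕ} (c : multiIdx d p → ℝ) {v : Fin d → ℝ} (hv : ‖v‖ ≤ 1) :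
    |lin c v - lin c 0| ≤ (∑ α, |c α|) * ‖v‖ := by
  unfold lin
  rw [← Finset.sum_sub_distrib, Finset.sum_mul]
  refine (Finset.abs_sum_le_sum_abs _ _).trans (Finset.sum_le_sum fun α _ => ?_)
  rw [← mul_sub, abs_mul]
  gcongr
  by_cases hα : α.1 = 0
  · simp [hα, feat]
  · rw [feat_zero_right hα, sub_zero]
    exact abs_feat_le_norm hα hv

lemma lin_sub {d p : ℕ} (c c' : multiIdx d p → ℝ) (v : Fin d → ℝ) :
    lin (c - c') v = lin c v - lin c' v := by
  simp [lin, sub_mul]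

lemma eval_eq_lin {d p : ℕ} {θ : MvPolynomial (Fin d) ℝ} (hθ : θ.totalDegree ≤ p)
    (v : Fin d → ℝ) :
    MvPolynomial.eval v θ = lin (fun α : multiIdx d p => θ.coeff α.1) v := by
  have hs : θ.support ⊆ multiIdx d p := by
    intro α hα
    rw [mem_multiIdx]
    have := (MvPolynomial.le_totalDegree hα).trans hθ
    rwa [Finsupp.sum_fintype _ _ (fun _ => rfl)] at this
  rw [MvPolynomial.eval_eq', lin, Finset.sum_subset hs]
  · rw [← Finset.sum_coe_sort]; rfl
  · intro α _ hα
    rw [MvPolynomial.notMem_support_iff.1 hα, zero_mul]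

/-- The polynomial `u ↦ ∑ α, c α * (u / h) ^ α`. -/
def polyOf {d p : ℕ} (h : ℝ) (c : multiIdx d p → ℝ) : MvPolynomial (Fin d) ℝ :=
  ∑ α, MvPolynomial.monomial α.1 (c α * h⁻¹ ^ (∑ i, α.1 i))

lemma totalDegree_polyOf {d p : ℕ} (h : ℝ) (c : multiIdx d p → ℝ) :
    (polyOf h c).totalDegree ≤ p := by
  refine (MvPolynomial.totalDegree_finsetSum _ _).trans (Finset.sup_le fun α _ => ?_)
  refine (MvPolynomial.totalDegree_monomial_le _ _).trans ?_
  rw [Finsupp.sum_fintype _ _ (fun _ => rfl)]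
  exact mem_multiIdx.1 α.2

lemma eval_polyOf {d p : ℕ} (h : ℝ) (c : multiIdx d p → ℝ) (u : Fin d → ℝ) :
    MvPolynomial.eval u (polyOf h c) = lin c (h⁻¹ • u) := by
  unfold polyOf lin feat
  rw [map_sum]
  refine Finset.sum_congr rfl fun α _ => ?_
  rw [MvPolynomial.eval_monomial, Finsupp.prod_fintype _ _ (by simp)]
  simp only [Pi.smul_apply, smul_eq_mul, mul_pow, Finset.prod_mul_distrib,
    Finset.prod_pow_eq_pow_sum]
  ring

lemma exists_polyOf_eq {d p : ℕ} {h : ℝ} (hh : h ≠ 0) {θ : MvPolynomial (Fin d) ℝ}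
    (hθ : θ.totalDegree ≤ p) : ∃ c : multiIdx d p → ℝ, θ = polyOf h c := by
  refine ⟨fun α => θ.coeff α.1 * h ^ (∑ i, α.1 i), MvPolynomial.funext fun u => ?_⟩
  rw [eval_polyOf, eval_eq_lin hθ]
  unfold lin feat
  refine Finset.sum_congr rfl fun α _ => ?_
  simp only [Pi.smul_apply, smul_eq_mul, mul_pow, Finset.prod_mul_distrib,
    Finset.prod_pow_eq_pow_sum]
  rw [inv_pow]
  field_simp

/-- A polynomial function that vanishes on a product of infinite sets has zero coefficients. -/
lemma eq_zero_of_lin_eq_zero {d p : ℕ} (c : multiIdx d p → ℝ) (s : Fin d → Set ℝ)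
    (hs : ∀ i, (s i).Infinite) (h0 : ∀ v ∈ Set.pi Set.univ s, lin c v = 0) : c = 0 := by
  have hp : polyOf 1 c = 0 := by
    refine MvPolynomial.funext_set s hs (fun v hv => ?_)
    rw [eval_polyOf, map_zero, inv_one, one_smul]
    exact h0 v hv
  funext α
  have h2 : (polyOf 1 c).coeff α.1 = c α := by
    unfold polyOf
    rw [MvPolynomial.coeff_sum, Finset.sum_eq_single α]
    · simp
    · intro β _ hβ
      rw [MvPolynomial.coeff_monomial, if_neg (fun h => hβ (Subtype.ext h))]
    · simp
  rw [← h2, hp]; simp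

lemma totalDegree_affine {d : ℕ} (θ : MvPolynomial (Fin d) ℝ) (s : Fin d → ℝ) (h : ℝ) :
    (MvPolynomial.bind₁ (fun i => MvPolynomial.C (s i) + MvPolynomial.C h * MvPolynomial.X i)
      θ).totalDegree ≤ θ.totalDegree := by
  rw [MvPolynomial.bind₁, MvPolynomial.aeval_def, MvPolynomial.eval₂_eq']
  refine (MvPolynomial.totalDegree_finsetSum _ _).trans (Finset.sup_le fun α hα => ?_)
  refine (MvPolynomial.totalDegree_mul _ _).trans ?_
  have h1 : ((algebraMap ℝ (MvPolynomial (Fin d) ℝ)) (θ.coeff α)).totalDegree = 0 :=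
    MvPolynomial.totalDegree_C _
  rw [h1, zero_add]
  refine (MvPolynomial.totalDegree_finsetProd _ _).trans ?_
  refine le_trans (Finset.sum_le_sum fun i _ => ?_)
    ((Finsupp.sum_fintype α (fun _ e => e) (fun _ => rfl)).symm.trans_le
      (MvPolynomial.le_totalDegree hα))
  refine (MvPolynomial.totalDegree_pow _ _).trans ?_
  refine mul_le_of_le_one_right (Nat.zero_le _) ?_
  refine (MvPolynomial.totalDegree_add _ _).trans (max_le (by simp) ?_)
  refine (MvPolynomial.totalDegree_mul _ _).trans ?_
  simp

/-- Polynomial functions of degree at most `p` keep this form after an affine substitution. -/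
lemma exists_lin_affine {d p : ℕ} {θ : MvPolynomial (Fin d) ℝ} (hθ : θ.totalDegree ≤ p)
    (s : Fin d → ℝ) (h : ℝ) :
    ∃ c : multiIdx d p → ℝ, ∀ v, MvPolynomial.eval (s + h • v) θ = lin c v := by
  refine ⟨_, fun v => Eq.trans ?_ (eval_eq_lin ((totalDegree_affine θ s h).trans hθ) v)⟩
  rw [MvPolynomial.bind₁, MvPolynomial.aeval_def, MvPolynomial.eval_eval₂,
    MvPolynomial.eval₂_eq', MvPolynomial.eval_eq']
  simp

/-- The Taylor expansion of degree `n` is a polynomial of degree at most `n` in `y - x`. -/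
lemma exists_poly_taylor {d : ℕ} (n : ℕ) (f : (Fin d → ℝ) → ℝ) (x : Fin d → ℝ) :
    ∃ θ : MvPolynomial (Fin d) ℝ, θ.totalDegree ≤ n ∧
      ∀ y, taylorPoly n f x y = MvPolynomial.eval (y - x) θ := by
  classical
  refine ⟨∑ j ∈ Finset.range (n + 1), MvPolynomial.C ((Nat.factorial j : ℝ))⁻¹ *
    ∑ σ : Fin j → Fin d, MvPolynomial.C (iteratedFDerivWithin ℝ j f (cube d) x
      (fun i => Pi.single (σ i) 1)) * ∏ i, MvPolynomial.X (σ i), ?_, fun y => ?_⟩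
  · refine (MvPolynomial.totalDegree_finsetSum _ _).trans (Finset.sup_le fun j hj => ?_)
    refine (MvPolynomial.totalDegree_mul _ _).trans ?_
    rw [MvPolynomial.totalDegree_C, zero_add]
    refine (MvPolynomial.totalDegree_finsetSum _ _).trans (Finset.sup_le fun σ _ => ?_)
    refine (MvPolynomial.totalDegree_mul _ _).trans ?_
    rw [MvPolynomial.totalDegree_C, zero_add]
    refine (MvPolynomial.totalDegree_finsetProd _ _).trans ?_
    simp
    exact Nat.lt_succ_iff.1 (Finset.mem_range.1 hj)
  · unfold taylorPoly
    rw [map_sum]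
    refine Finset.sum_congr rfl fun j _ => ?_
    rw [map_mul, MvPolynomial.eval_C, map_sum]
    congr 1
    have hy : y - x = ∑ i, (y - x) i • (Pi.single i (1 : ℝ) : Fin d → ℝ) := by
      conv_lhs => rw [← Finset.univ_sum_single (y - x)]
      refine Finset.sum_congr rfl fun i _ => ?_
      ext k
      by_cases hk : k = i
      · subst hk; simp
      · simp [hk]
    conv_lhs => rw [hy]
    rw [ContinuousMultilinearMap.map_sum]
    refine Finset.sum_congr rfl fun σ _ => ?_
    rw [ContinuousMultilinearMap.map_smul_univ]
    simp [map_prod, mul_comm]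

/-- A Taylor expansion of degree at most `p`, in the coordinates `v = (y - s) / h`. -/
lemma exists_lin_taylor {d n p : ℕ} (hn : n ≤ p) (f : (Fin d → ℝ) → ℝ) (x s : Fin d → ℝ) (h : ℝ) :
    ∃ c : multiIdx d p → ℝ, ∀ v, taylorPoly n f x (s + h • v) = lin c v := by
  obtain ⟨θ, hθ, hev⟩ := exists_poly_taylor n f x
  obtain ⟨c, hc⟩ := exists_lin_affine (hθ.trans hn) (s - x) h
  refine ⟨c, fun v => ?_⟩
  rw [hev, ← hc, sub_add_eq_add_sub]

/-! ### Quadratic forms -/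

/-- A positive definite form is bounded below on the unit sphere, by compactness. -/
lemma exists_pos_quadratic_lower {ι : Type*} [Fintype ι] (G : ι → ι → ℝ)
    (hG : ∀ c : ι → ℝ, c ≠ 0 → 0 < ∑ i, ∑ j, c i * c j * G i j) :
    ∃ lam : ℝ, 0 < lam ∧ ∀ c : ι → ℝ, lam * ∑ i, c i ^ 2 ≤ ∑ i, ∑ j, c i * c j * G i j := by
  classical
  rcases isEmpty_or_nonempty ι with hι | ⟨⟨i₀⟩⟩
  · exact ⟨1, one_pos, fun c => by simp⟩
  set S : Set (ι → ℝ) := {c | ∑ i, c i ^ 2 = 1} with hS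
  have hcl : IsClosed S := isClosed_eq (by fun_prop) continuous_const
  have hcomp : IsCompact S := by
    refine (isCompact_closedBall (0 : ι → ℝ) 1).of_isClosed_subset hcl fun c hc => ?_
    rw [mem_closedBall_zero_iff, pi_norm_le_iff_of_nonneg zero_le_one]
    intro i
    have h1 : c i ^ 2 ≤ ∑ i, c i ^ 2 :=
      Finset.single_le_sum (f := fun i => c i ^ 2) (fun i _ => sq_nonneg _) (Finset.mem_univ i)
    rw [hc] at h1
    rw [Real.norm_eq_abs]
    exact (sq_le_one_iff_abs_le_one _).1 h1
  have hne : S.Nonempty := by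
    refine ⟨Pi.single i₀ 1, ?_⟩
    simp only [hS, Set.mem_ofPred_eq]
    rw [Finset.sum_eq_single i₀]
    · simp
    · intro b _ hb; simp [hb]
    · simp
  obtain ⟨c₀, hc₀, hmin⟩ := hcomp.exists_isMinOn hne
    (f := fun c => ∑ i, ∑ j, c i * c j * G i j) (by fun_prop)
  have hc₀ne : c₀ ≠ 0 := by
    rintro rfl
    simp [hS] at hc₀
  refine ⟨_, hG c₀ hc₀ne, fun c => ?_⟩
  by_cases hc : c = 0
  · simp [hc]
  have hpos : 0 < ∑ i, c i ^ 2 := by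
    obtain ⟨i, hi⟩ := Function.ne_iff.1 hc
    exact Finset.sum_pos' (fun i _ => sq_nonneg _) ⟨i, Finset.mem_univ _, by
      have : c i ≠ 0 := by simpa using hi
      positivity⟩
  set ρ := Real.sqrt (∑ i, c i ^ 2) with hρ
  have hρpos : 0 < ρ := Real.sqrt_pos.2 hpos
  have hρsq : ρ ^ 2 = ∑ i, c i ^ 2 := Real.sq_sqrt hpos.le
  have hmem : (fun i => ρ⁻¹ * c i) ∈ S := by
    simp only [hS, Set.mem_ofPred_eq, mul_pow]
    rw [← Finset.mul_sum, ← hρsq]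
    field_simp
  have := hmin hmem
  simp only [Set.mem_ofPred_eq] at this
  have h2 : ∑ i, ∑ j, ρ⁻¹ * c i * (ρ⁻¹ * c j) * G i j
      = (ρ ^ 2)⁻¹ * ∑ i, ∑ j, c i * c j * G i j := by
    rw [Finset.mul_sum]
    refine Finset.sum_congr rfl fun i _ => ?_
    rw [Finset.mul_sum]
    refine Finset.sum_congr rfl fun j _ => ?_
    field_simp
  rw [h2, hρsq] at this
  rwa [inv_mul_eq_div, le_div_iff₀ hpos] at this

lemma sq_lin {d p : ℕ} (c : multiIdx d p → ℝ) (v : Fin d → ℝ) :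
    lin c v ^ 2 = ∑ α, ∑ β, c α * c β * (feat α.1 v * feat β.1 v) := by
  rw [sq, lin, Finset.sum_mul_sum]
  refine Finset.sum_congr rfl fun α _ => Finset.sum_congr rfl fun β _ => ?_
  ring

/-- One of the `2 ^ d` cubes of side `1/2` with a corner at the origin and sides parallel to the
axes. -/
def cornerCube {d : ℕ} (ε : Fin d → Bool) : Set (Fin d → ℝ) :=
  Set.pi Set.univ fun i => if ε i then Set.Icc 0 (1 / 2) else Set.Icc (-(1 / 2)) 0

lemma isCompact_cornerCube {d : ℕ} (ε : Fin d → Bool) : IsCompact (cornerCube ε) := by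
  refine isCompact_univ_pi fun i => ?_
  split_ifs <;> exact isCompact_Icc

/-- On polynomials of bounded degree, the `L²` norm over a corner cube controls the norm of the
coefficients. -/
lemma exists_cornerCube_lower (d p : ℕ) : ∃ lam : ℝ, 0 < lam ∧
    ∀ (ε : Fin d → Bool) (c : multiIdx d p → ℝ),
      lam * ∑ α, c α ^ 2 ≤ ∫ v in cornerCube ε, lin c v ^ 2 := by
  have key : ∀ ε : Fin d → Bool, ∃ lam : ℝ, 0 < lam ∧ ∀ (c : multiIdx d p → ℝ),
      lam * ∑ α, c α ^ 2 ≤ ∫ v in cornerCube ε, lin c v ^ 2 := by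
    intro ε
    have hQ : ∀ c : multiIdx d p → ℝ, ∫ v in cornerCube ε, lin c v ^ 2 =
        ∑ α, ∑ β, c α * c β * ∫ v in cornerCube ε, feat α.1 v * feat β.1 v := by
      intro c
      have hint : ∀ α β : multiIdx d p,
          Integrable (fun v => feat α.1 v * feat β.1 v) (volume.restrict (cornerCube ε)) :=
        fun α β => (((continuous_feat _).mul (continuous_feat _)).continuousOn).integrableOn_compact
          (isCompact_cornerCube ε)
      simp_rw [sq_lin]
      rw [integral_finsetSum _ fun α _ => integrable_finsetSum _ fun β _ =>
        (hint α β).const_mul _]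
      refine Finset.sum_congr rfl fun α _ => ?_
      rw [integral_finsetSum _ fun β _ => (hint α β).const_mul _]
      exact Finset.sum_congr rfl fun β _ => integral_const_mul _ _
    obtain ⟨lam, h0, h1⟩ := exists_pos_quadratic_lower
      (fun α β : multiIdx d p => ∫ v in cornerCube ε, feat α.1 v * feat β.1 v) (by
        intro c hc
        rw [← hQ]
        set U : Set (Fin d → ℝ) := Set.pi Set.univ fun i =>
          if ε i then Set.Ioo 0 (1 / 2) else Set.Ioo (-(1 / 2)) 0 with hU
        have hUo : IsOpen U := isOpen_set_pi Set.finite_univ fun i _ => by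
          split_ifs <;> exact isOpen_Ioo
        have hUsub : U ⊆ cornerCube ε := Set.pi_mono fun i _ => by
          split_ifs <;> exact Set.Ioo_subset_Icc_self
        have hne : ∃ v ∈ U, lin c v ≠ 0 := by
          by_contra! hcon
          refine hc (eq_zero_of_lin_eq_zero c _ (fun i => ?_) hcon)
          split_ifs
          · exact Set.Ioo_infinite (by norm_num)
          · exact Set.Ioo_infinite (by norm_num)
        obtain ⟨v₀, hv₀, hv₀'⟩ := hne
        have hcont : Continuous fun v => lin c v ^ 2 := (continuous_lin c).pow 2
        rw [setIntegral_pos_iff_support_of_nonneg_ae (Filter.Eventually.of_forall fun v =>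
          sq_nonneg _) (hcont.continuousOn.integrableOn_compact (isCompact_cornerCube ε))]
        refine lt_of_lt_of_le ?_ (measure_mono (Set.inter_subset_inter_right _ hUsub))
        refine ((hcont.isOpen_support).inter hUo).measure_pos _ ⟨v₀, ?_, hv₀⟩
        simpa using hv₀')
    exact ⟨lam, h0, fun c => (h1 c).trans_eq (hQ c).symm⟩
  choose lam h0 h1 using key
  refine ⟨Finset.univ.inf' Finset.univ_nonempty lam, ?_, fun ε c => le_trans ?_ (h1 ε c)⟩
  · exact (Finset.lt_inf'_iff _).2 fun ε _ => h0 ε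
  · exact mul_le_mul_of_nonneg_right (Finset.inf'_le _ (Finset.mem_univ ε))
      (Finset.sum_nonneg fun _ _ => sq_nonneg _)

/-! ### Least squares -/

/-- Completing the square around a solution `a` of the normal equations. -/
lemma quadratic_eq_add {ι : Type*} [Fintype ι] {G : ι → ι → ℝ} (hsymm : ∀ i j, G i j = G j i)
    {r a : ι → ℝ} (ha : ∀ i, ∑ j, G i j * a j = r i) (A : ℝ) (b : ι → ℝ) :
    A - 2 * ∑ i, b i * r i + ∑ i, ∑ j, b i * b j * G i j =
      (A - 2 * ∑ i, a i * r i + ∑ i, ∑ j, a i * a j * G i j) +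
        ∑ i, ∑ j, (b i - a i) * (b j - a j) * G i j := by
  have h1 : ∀ u : ι → ℝ, ∑ i, u i * r i = ∑ i, ∑ j, u i * a j * G i j := by
    intro u
    refine Finset.sum_congr rfl fun i _ => ?_
    rw [← ha, Finset.mul_sum]
    exact Finset.sum_congr rfl fun j _ => by ring
  have h2 : ∑ i, ∑ j, a i * b j * G i j = ∑ i, ∑ j, b i * a j * G i j := by
    rw [Finset.sum_comm]
    refine Finset.sum_congr rfl fun i _ => Finset.sum_congr rfl fun j _ => ?_
    rw [hsymm j i]; ring
  have h3 : ∑ i, ∑ j, (b i - a i) * (b j - a j) * G i j =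
      ∑ i, ∑ j, b i * b j * G i j - ∑ i, ∑ j, b i * a j * G i j -
        ∑ i, ∑ j, a i * b j * G i j + ∑ i, ∑ j, a i * a j * G i j := by
    simp only [← Finset.sum_sub_distrib, ← Finset.sum_add_distrib]
    refine Finset.sum_congr rfl fun i _ => Finset.sum_congr rfl fun j _ => ?_
    ring
  rw [h3, h1, h1, h2]
  ring

lemma exists_normal_equations {ι : Type*} [Fintype ι] {G : ι → ι → ℝ} {Λ : ℝ} (hΛ : 0 < Λ)
    (hG : ∀ c : ι → ℝ, Λ * ∑ i, c i ^ 2 ≤ ∑ i, ∑ j, c i * c j * G i j) (r : ι → ℝ) :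
    ∃ a : ι → ℝ, ∀ i, ∑ j, G i j * a j = r i := by
  classical
  have hinj : Function.Injective (Matrix.mulVecLin (Matrix.of G)) := by
    rw [← LinearMap.ker_eq_bot, LinearMap.ker_eq_bot']
    intro c hc
    have h0 : ∀ i, ∑ j, G i j * c j = 0 := fun i => by
      have := congrFun hc i
      simpa [Matrix.mulVec, dotProduct] using this
    have h1 : ∑ i, ∑ j, c i * c j * G i j = 0 := by
      refine Finset.sum_eq_zero fun i _ => ?_
      have : ∑ j, c i * c j * G i j = c i * ∑ j, G i j * c j := by
        rw [Finset.mul_sum]; exact Finset.sum_congr rfl fun j _ => by ring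
      rw [this, h0, mul_zero]
    have h2 : ∑ i, c i ^ 2 = 0 := by
      have := hG c
      rw [h1] at this
      exact le_antisymm (by nlinarith) (Finset.sum_nonneg fun _ _ => sq_nonneg _)
    funext i
    have := (Finset.sum_eq_zero_iff_of_nonneg fun i _ => sq_nonneg (c i)).1 h2 i
      (Finset.mem_univ i)
    simpa using this
  obtain ⟨a, ha⟩ := (LinearMap.injective_iff_surjective.1 hinj) r
  refine ⟨a, fun i => ?_⟩
  have := congrFun ha i
  simpa [Matrix.mulVec, dotProduct] using this

/-- A bound for the solution of a linear system with a positive definite matrix. -/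
lemma abs_le_of_normal_equations {ι : Type*} [Fintype ι] {G : ι → ι → ℝ} {Λ R : ℝ} (hΛ : 0 < Λ)
    (hG : ∀ c : ι → ℝ, Λ * ∑ i, c i ^ 2 ≤ ∑ i, ∑ j, c i * c j * G i j) {c : ι → ℝ}
    (hc : ∀ i, |∑ j, G i j * c j| ≤ R) (i : ι) : |c i| ≤ Fintype.card ι * R / Λ := by
  obtain ⟨m, -, hm⟩ := Finset.exists_max_image Finset.univ (fun i => |c i|) ⟨i, Finset.mem_univ i⟩
  have hR : 0 ≤ R := (abs_nonneg _).trans (hc i)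
  refine (hm i (Finset.mem_univ i)).trans ?_
  have h1 : ∑ i, ∑ j, c i * c j * G i j ≤ Fintype.card ι * (|c m| * R) := by
    rw [← Finset.card_univ, ← nsmul_eq_mul]
    refine Finset.sum_le_card_nsmul _ _ _ fun j _ => ?_
    have : ∑ k, c j * c k * G j k = c j * ∑ k, G j k * c k := by
      rw [Finset.mul_sum]; exact Finset.sum_congr rfl fun j _ => by ring
    rw [this]
    refine (le_abs_self _).trans ?_
    rw [abs_mul]
    exact mul_le_mul (hm j (Finset.mem_univ j)) (hc j) (abs_nonneg _) (abs_nonneg _)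
  have h2 : c m ^ 2 ≤ ∑ i, c i ^ 2 :=
    Finset.single_le_sum (f := fun i => c i ^ 2) (fun i _ => sq_nonneg _) (Finset.mem_univ m)
  have h3 : Λ * |c m| ^ 2 ≤ Fintype.card ι * (|c m| * R) := by
    rw [sq_abs]
    exact (mul_le_mul_of_nonneg_left h2 hΛ.le).trans ((hG c).trans h1)
  rw [le_div_iff₀ hΛ]
  rcases (abs_nonneg (c m)).eq_or_lt with h | h
  · rw [← h, zero_mul]; positivity
  · refine le_of_mul_le_mul_left ?_ h
    linarith

/-- Stability of a lower bound for a quadratic form under entrywise perturbation of its matrix. -/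
lemma gram_lower {ι : Type*} [Fintype ι] {G M : ι → ι → ℝ} {lam δ : ℝ} (hδ : 0 ≤ δ)
    (hM : ∀ c : ι → ℝ, lam * ∑ i, c i ^ 2 ≤ ∑ i, ∑ j, c i * c j * M i j)
    (hGM : ∀ i j, |G i j - M i j| ≤ δ) (c : ι → ℝ) :
    (lam - δ * Fintype.card ι) * ∑ i, c i ^ 2 ≤ ∑ i, ∑ j, c i * c j * G i j := by
  have h1 : ∑ i, ∑ j, c i * c j * M i j - δ * (∑ i, |c i|) ^ 2 ≤ ∑ i, ∑ j, c i * c j * G i j := by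
    rw [sq, Finset.sum_mul_sum, Finset.mul_sum, ← Finset.sum_sub_distrib]
    refine Finset.sum_le_sum fun i _ => ?_
    rw [Finset.mul_sum, ← Finset.sum_sub_distrib]
    refine Finset.sum_le_sum fun j _ => ?_
    have h2 : |c i * c j * (M i j - G i j)| ≤ |c i| * |c j| * δ := by
      rw [abs_mul, abs_mul, abs_sub_comm]
      exact mul_le_mul_of_nonneg_left (hGM i j) (by positivity)
    have := (abs_le.1 h2).2
    nlinarith
  have h3 : (∑ i, |c i|) ^ 2 ≤ Fintype.card ι * ∑ i, c i ^ 2 := by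
    have := sq_sum_le_card_mul_sum_sq (s := Finset.univ) (f := fun i => |c i|)
    simpa [sq_abs] using this
  have := hM c
  have h4 := mul_le_mul_of_nonneg_left h3 hδ
  linarith

lemma list_sum_finset_sum {ι E : Type*} (s : Finset ι) (D : List E) (F : ι → E → ℝ) :
    (D.map fun z => ∑ i ∈ s, F i z).sum = ∑ i ∈ s, (D.map (F i)).sum := by
  induction D with
  | nil => simp
  | cons z D ih => simp [ih, Finset.sum_add_distrib]

lemma list_sum_sub {E : Type*} (D : List E) (F G : E → ℝ) :
    (D.map fun z => F z - G z).sum = (D.map F).sum - (D.map G).sum := by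
  induction D with
  | nil => simp
  | cons z D ih => simp [ih]; ring

lemma list_sum_add {E : Type*} (D : List E) (F G : E → ℝ) :
    (D.map fun z => F z + G z).sum = (D.map F).sum + (D.map G).sum := by
  induction D with
  | nil => simp
  | cons z D ih => simp [ih]; ring

lemma list_sum_mul {E : Type*} (D : List E) (c : ℝ) (F : E → ℝ) :
    (D.map fun z => c * F z).sum = c * (D.map F).sum := by
  induction D with
  | nil => simp
  | cons z D ih => simp [ih]; ring

/-- The Gram matrix of the monomials at the covariates `D`, in the coordinates `(u - x) / h`. -/
def gram {d p : ℕ} (D : List ((Fin d → ℝ) × ℝ)) (h : ℝ) (x : Fin d → ℝ) (α β : multiIdx d p) : ℝ :=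
  (D.map fun z => feat α.1 (h⁻¹ • (z.1 - x)) * feat β.1 (h⁻¹ • (z.1 - x)) *
    kernel (h⁻¹ • (z.1 - x))).sum

/-- The moments of the residuals of the data `D` with respect to the polynomial with coefficients
`a` in the coordinates `(u - x) / h`. -/
def residual {d p : ℕ} (D : List ((Fin d → ℝ) × ℝ)) (h : ℝ) (x : Fin d → ℝ)
    (a : multiIdx d p → ℝ) (α : multiIdx d p) : ℝ :=
  (D.map fun z => feat α.1 (h⁻¹ • (z.1 - x)) * kernel (h⁻¹ • (z.1 - x)) *
    (z.2 - lin a (h⁻¹ • (z.1 - x)))).sum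

lemma residual_eq {d p : ℕ} (D : List ((Fin d → ℝ) × ℝ)) (h : ℝ) (x : Fin d → ℝ)
    (a : multiIdx d p → ℝ) (α : multiIdx d p) :
    residual D h x a α = residual D h x 0 α - ∑ β, gram D h x α β * a β := by
  unfold residual gram
  have : ∀ β : multiIdx d p, (D.map fun z => feat α.1 (h⁻¹ • (z.1 - x)) *
      feat β.1 (h⁻¹ • (z.1 - x)) * kernel (h⁻¹ • (z.1 - x))).sum * a β = (D.map fun z => a β *
      (feat α.1 (h⁻¹ • (z.1 - x)) *
      feat β.1 (h⁻¹ • (z.1 - x)) * kernel (h⁻¹ • (z.1 - x)))).sum := fun β => by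
    rw [list_sum_mul, mul_comm]
  simp_rw [this]
  rw [← list_sum_finset_sum, ← list_sum_sub]
  congr 1
  refine List.map_congr_left fun z _ => ?_
  have h1 : ∑ β : multiIdx d p, a β * (feat α.1 (h⁻¹ • (z.1 - x)) *
      feat β.1 (h⁻¹ • (z.1 - x)) * kernel (h⁻¹ • (z.1 - x))) =
      feat α.1 (h⁻¹ • (z.1 - x)) * kernel (h⁻¹ • (z.1 - x)) * lin a (h⁻¹ • (z.1 - x)) := by
    rw [lin, Finset.mul_sum]
    exact Finset.sum_congr rfl fun β _ => by ring
  have h2 : lin (0 : multiIdx d p → ℝ) (h⁻¹ • (z.1 - x)) = 0 := by simp [lin]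
  rw [h1, h2]
  ring

lemma lprLoss_polyOf {d p : ℕ} (D : List ((Fin d → ℝ) × ℝ)) (h : ℝ) (x : Fin d → ℝ)
    (b : multiIdx d p → ℝ) :
    lprLoss D h x (polyOf h b) = (D.map fun z => z.2 ^ 2 * kernel (h⁻¹ • (z.1 - x))).sum -
      2 * ∑ α, b α * residual D h x 0 α + ∑ α, ∑ β, b α * b β * gram D h x α β := by
  unfold residual gram lprLoss
  simp_rw [← list_sum_mul, ← list_sum_finset_sum]
  rw [← list_sum_mul, ← list_sum_sub, ← list_sum_add]
  congr 1
  refine List.map_congr_left fun z _ => ?_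
  rw [eval_polyOf]
  have h2 : lin (0 : multiIdx d p → ℝ) (h⁻¹ • (z.1 - x)) = 0 := by simp [lin]
  have h3 : ∑ α : multiIdx d p, b α * (feat α.1 (h⁻¹ • (z.1 - x)) * kernel (h⁻¹ • (z.1 - x)) *
      (z.2 - lin (0 : multiIdx d p → ℝ) (h⁻¹ • (z.1 - x)))) =
      z.2 * kernel (h⁻¹ • (z.1 - x)) * lin b (h⁻¹ • (z.1 - x)) := by
    rw [h2, lin, Finset.mul_sum]
    exact Finset.sum_congr rfl fun β _ => by ring
  have h4 : ∑ α : multiIdx d p, ∑ β : multiIdx d p, b α * b β * (feat α.1 (h⁻¹ • (z.1 - x)) *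
      feat β.1 (h⁻¹ • (z.1 - x)) * kernel (h⁻¹ • (z.1 - x))) =
      lin b (h⁻¹ • (z.1 - x)) ^ 2 * kernel (h⁻¹ • (z.1 - x)) := by
    rw [sq_lin, Finset.sum_mul]
    refine Finset.sum_congr rfl fun α _ => ?_
    rw [Finset.sum_mul]
    exact Finset.sum_congr rfl fun β _ => by ring
  rw [h3, h4]
  ring

lemma gram_symm {d p : ℕ} (D : List ((Fin d → ℝ) × ℝ)) (h : ℝ) (x : Fin d → ℝ)
    (α β : multiIdx d p) : gram D h x α β = gram D h x β α := by
  unfold gram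
  congr 1
  exact List.map_congr_left fun z _ => by ring

/-- Truncation to `[0,1]`. -/
def trunc (y : ℝ) : ℝ := max 0 (min 1 y)

lemma abs_trunc_sub_le (y z : ℝ) : |trunc y - trunc z| ≤ |y - z| := by
  unfold trunc
  refine (abs_max_sub_max_le_max _ _ _ _).trans ?_
  rw [sub_self, abs_zero]
  refine max_le (abs_nonneg _) ((abs_min_sub_min_le_max _ _ _ _).trans ?_)
  rw [sub_self, abs_zero]
  exact max_le (abs_nonneg _) le_rfl

lemma trunc_eq_self {y : ℝ} (hy : y ∈ Set.Icc (0 : ℝ) 1) : trunc y = y := by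
  simp [trunc, hy.1, hy.2]

/-- The local polynomial estimator is close to the value of any polynomial with respect to which the
residuals have small moments, if the Gram matrix is well conditioned. -/
theorem abs_lpr_sub_le {d p : ℕ} {D : List ((Fin d → ℝ) × ℝ)} {h : ℝ} (hh : 0 < h)
    {x : Fin d → ℝ} (a : multiIdx d p → ℝ) {Λ R : ℝ} (hΛ : 0 < Λ)
    (hG : ∀ c : multiIdx d p → ℝ, Λ * ∑ α, c α ^ 2 ≤ ∑ α, ∑ β, c α * c β * gram D h x α β)
    (hR : ∀ α, |residual D h x a α| ≤ R) :
    |lpr D h p x - trunc (lin a 0)| ≤ Fintype.card (multiIdx d p) * R / Λ := by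
  obtain ⟨e, he⟩ := exists_normal_equations hΛ hG (residual D h x 0)
  have hmin : ∀ b : multiIdx d p → ℝ, lprLoss D h x (polyOf h b) = lprLoss D h x (polyOf h e) +
      ∑ α, ∑ β, (b α - e α) * (b β - e β) * gram D h x α β := by
    intro b
    rw [lprLoss_polyOf, lprLoss_polyOf]
    exact quadratic_eq_add (gram_symm D h x) he _ b
  have hpos : ∀ c : multiIdx d p → ℝ, 0 ≤ ∑ α, ∑ β, c α * c β * gram D h x α β := fun c =>
    le_trans (mul_nonneg hΛ.le (Finset.sum_nonneg fun _ _ => sq_nonneg _)) (hG c)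
  -- the solution of the normal equations is the unique minimizer, so the junk value is not taken
  have hisMin : IsLprMin D h p x (polyOf h e) := by
    refine ⟨totalDegree_polyOf h e, fun θ' hθ' => ?_⟩
    obtain ⟨b, rfl⟩ := exists_polyOf_eq hh.ne' hθ'
    rw [hmin b]
    exact le_add_of_nonneg_right (hpos fun α => b α - e α)
  have hex : ∃! θ, IsLprMin D h p x θ := by
    refine ⟨polyOf h e, hisMin, fun θ' hθ' => ?_⟩
    obtain ⟨b, rfl⟩ := exists_polyOf_eq hh.ne' hθ'.1
    have h1 := hθ'.2 _ hisMin.1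
    rw [hmin b] at h1
    have h2 := hG fun α => b α - e α
    have h3 : ∑ α, (b α - e α) ^ 2 = 0 := by
      refine le_antisymm ?_ (Finset.sum_nonneg fun _ _ => sq_nonneg _)
      by_contra! hcon
      have := mul_pos hΛ hcon
      linarith
    have h4 : b = e := by
      funext α
      have := (Finset.sum_eq_zero_iff_of_nonneg fun i _ => sq_nonneg (b i - e i)).1 h3 α
        (Finset.mem_univ α)
      rw [sq_eq_zero_iff, sub_eq_zero] at this
      exact this
    rw [h4]
  have hchoose : hex.choose = polyOf h e := hex.unique hex.choose_spec.1 hisMin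
  have hlpr : lpr D h p x = trunc (lin e 0) := by
    unfold lpr
    rw [dif_pos hex, hchoose, eval_polyOf, smul_zero]
    rfl
  rw [hlpr]
  refine (abs_trunc_sub_le _ _).trans ?_
  rw [lin_zero_right, lin_zero_right]
  -- the difference to the target solves the normal equations for the residual moments
  refine abs_le_of_normal_equations hΛ hG (c := fun α => e α - a α) (fun α => ?_) (zeroIdx d p)
  have : ∑ β, gram D h x α β * (e β - a β) = residual D h x a α := by
    rw [residual_eq, ← he]
    simp [mul_sub, Finset.sum_sub_distrib]
  rw [this]
  exact hR α

lemma lpr_mem_Icc {d p : ℕ} (D : List ((Fin d → ℝ) × ℝ)) (h : ℝ) (x : Fin d → ℝ) :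
    lpr D h p x ∈ Set.Icc (0 : ℝ) 1 := by
  unfold lpr
  split_ifs <;> simp

/-! ### The course of the phase in one hypercube -/

/-- The effect of one visit on the round and the two counters of a hypercube. -/
def tick (q R : ℕ) (c : ℕ × ℕ × ℕ) : ℕ × ℕ × ℕ :=
  let n : ℕ × ℕ := if c.2.2 < c.2.1 then (c.2.1, c.2.2 + 1) else (c.2.1 + 1, c.2.2)
  if 2 * q ^ c.1 ≤ n.1 + n.2 ∧ c.1 ≤ R then (c.1 + 1, 0, 0) else (c.1, n)

/-- The round and the two counters of a hypercube after `n` visits; they do not depend on the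
rewards. -/
def clock (q R : ℕ) : ℕ → ℕ × ℕ × ℕ
  | 0 => (1, 0, 0)
  | n + 1 => tick q R (clock q R n)

/-- The next visit after `n` visits is used for a sample of arm `k` in round `r`. -/
def Active (q R r : ℕ) (k : Fin 2) (n : ℕ) : Prop :=
  (clock q R n).1 = r ∧ (if (clock q R n).2.2 < (clock q R n).2.1 then (1 : Fin 2) else 0) = k

/-- The counters of the two arms differ by at most one, and the number `n` of visits is the number of
samples of the completed rounds plus the two counters. -/
lemma clock_spec {q : ℕ} (hq : 1 ≤ q) (R n : ℕ) :
    1 ≤ (clock q R n).1 ∧ (clock q R n).2.2 ≤ (clock q R n).2.1 ∧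
      (clock q R n).2.1 ≤ (clock q R n).2.2 + 1 ∧
      ((clock q R n).1 ≤ R → (clock q R n).2.1 + (clock q R n).2.2 < 2 * q ^ (clock q R n).1) ∧
      n = 2 * ∑ i ∈ Finset.Ico 1 (clock q R n).1, q ^ i +
        ((clock q R n).2.1 + (clock q R n).2.2) := by
  induction n with
  | zero => simp [clock]; omega
  | succ n ih =>
    obtain ⟨h1, h2, h3, h4, h5⟩ := ih
    simp only [clock, tick]
    generalize clock q R n = c at *
    obtain ⟨r, n0, n1⟩ := c
    simp only at *
    by_cases hlt : n1 < n0
    · simp only [hlt, if_true]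
      by_cases hc : 2 * q ^ r ≤ n0 + (n1 + 1) ∧ r ≤ R
      · simp only [hc, and_self, if_true]
        have := h4 hc.2
        have hq' : 1 ≤ q ^ (r + 1) := Nat.one_le_pow _ _ hq
        rw [Finset.sum_Ico_succ_top h1]
        refine ⟨by omega, by omega, by omega, fun _ => by omega, by omega⟩
      · rw [if_neg hc]
        refine ⟨h1, by simp only; omega, by simp only; omega, fun h => ?_, by simp only; omega⟩
        simp only at *
        by_contra hcon
        exact hc ⟨by omega, h⟩
    · simp only [hlt, if_false]
      by_cases hc : 2 * q ^ r ≤ n0 + 1 + n1 ∧ r ≤ R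
      · simp only [hc, and_self, if_true]
        have := h4 hc.2
        have hq' : 1 ≤ q ^ (r + 1) := Nat.one_le_pow _ _ hq
        rw [Finset.sum_Ico_succ_top h1]
        refine ⟨by omega, by omega, by omega, fun _ => by omega, by omega⟩
      · rw [if_neg hc]
        refine ⟨h1, by simp only; omega, by simp only; omega, fun h => ?_, by simp only; omega⟩
        simp only at *
        by_contra hcon
        exact hc ⟨by omega, h⟩

lemma lt_round_of_le {q : ℕ} (hq : 1 ≤ q) {R n : ℕ}
    (hn : 2 * ∑ i ∈ Finset.Ico 1 (R + 1), q ^ i ≤ n) : R < (clock q R n).1 := by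
  obtain ⟨h1, h2, h3, h4, h5⟩ := clock_spec hq R n
  by_contra! hcon
  have h6 := h4 hcon
  have h7 : ∑ i ∈ Finset.Ico 1 ((clock q R n).1 + 1), q ^ i ≤
      ∑ i ∈ Finset.Ico 1 (R + 1), q ^ i :=
    Finset.sum_le_sum_of_subset (Finset.Ico_subset_Ico_right (by omega))
  rw [Finset.sum_Ico_succ_top h1] at h7
  omega

open Classical in
/-- The number of visits to the hypercube `m` before time `t`. -/
def visits {d : ℕ} (q l : ℕ) (x : ℕ → Fin d → ℝ) (m : Fin d → ℕ) : ℕ → ℕ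
  | 0 => 0
  | t + 1 => if binOf q l (x t) = m then visits q l x m t + 1 else visits q l x m t

open Classical in
/-- The samples of arm `k` that are collected before time `t` in round `r` in the
hypercube `m`. -/
def Params.sample (a : Params) {d : ℕ} (x : ℕ → Fin d → ℝ) (y : ℕ → Fin 2 → ℝ)
    (m : Fin d → ℕ) (r : ℕ) (k : Fin 2) : ℕ → List ((Fin d → ℝ) × ℝ)
  | 0 => []
  | t + 1 =>
    if binOf a.q (a.level d) (x t) = m ∧
        Active a.q (a.rmax d) r k (visits a.q (a.level d) x m t) then
      (x t, y t k) :: Params.sample a x y m r k t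
    else Params.sample a x y m r k t

section Course

variable {d : ℕ} (a : Params) (x : ℕ → Fin d → ℝ) (y : ℕ → Fin 2 → ℝ)

/-- The round of the hypercube `m` at time `t`. -/
def Params.roundAt (m : Fin d → ℕ) (t : ℕ) : ℕ :=
  (clock a.q (a.rmax d) (visits a.q (a.level d) x m t)).1

lemma step_of_ne (s : State d) (u : Fin d → ℝ) (v : Fin 2 → ℝ) {m : Fin d → ℕ}
    (hm : binOf a.q (a.level d) u ≠ m) :
    (a.step s u v).round m = s.round m ∧ (a.step s u v).data m = s.data m ∧
      ((a.step s u v).flag m ↔ s.flag m) ∧ (a.step s u v).rlast m = s.rlast m := by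
  classical
  simp only [Params.step]
  split_ifs <;> simp [Function.update_of_ne hm.symm]

/-- The round of a hypercube and its counters are functions of the number of visits, and its data are
the samples of the current round. The first part, that later rounds have no samples yet, keeps the
induction going when a new round begins. -/
lemma run_spec (m : Fin d → ℕ) (t : ℕ) :
    (∀ r k, (clock a.q (a.rmax d) (visits a.q (a.level d) x m t)).1 < r →
      a.sample x y m r k t = []) ∧
    (a.run x y t).round m = a.roundAt x m t ∧
    (∀ k, (a.run x y t).data m k = a.sample x y m (a.roundAt x m t) k t) ∧
    ((a.run x y t).data m 0).length =
      (clock a.q (a.rmax d) (visits a.q (a.level d) x m t)).2.1 ∧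
    ((a.run x y t).data m 1).length =
      (clock a.q (a.rmax d) (visits a.q (a.level d) x m t)).2.2 := by
  classical
  unfold Params.roundAt
  induction t with
  | zero => simp [Params.run, Params.init, visits, clock, Params.sample]
  | succ t ih =>
    obtain ⟨h0, h1, h2, h3, h4⟩ := ih
    by_cases hm : binOf a.q (a.level d) (x t) = m
    · simp only [Params.run, visits, hm, if_true, clock, Params.sample, true_and]
      simp only [Params.step, State.arm, Active, hm, h1, h3, h4]
      have hact : ∀ r k, (clock a.q (a.rmax d) (visits a.q (a.level d) x m t)).1 < r →
          ¬ Active a.q (a.rmax d) r k (visits a.q (a.level d) x m t) := by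
        rintro r k hr ⟨h, -⟩; omega
      simp only [Active] at hact
      obtain ⟨⟨r, n0, n1⟩, hcl⟩ :
        ∃ c, clock a.q (a.rmax d) (visits a.q (a.level d) x m t) = c := ⟨_, rfl⟩
      simp only [hcl, tick] at h0 h1 h2 h3 h4 hact ⊢
      have h2' : (a.run x y t).data m = fun k => a.sample x y m r k t := funext h2
      rw [h2'] at h3 h4 ⊢
      simp only at h3 h4
      by_cases hlt : n1 < n0
      · simp only [hlt, if_true] at hact ⊢
        simp only [Function.update_self, List.length_cons, h4, ne_eq, zero_ne_one,
          not_false_eq_true, Function.update_of_ne, h3]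
        by_cases hc : 2 * a.q ^ r ≤ n0 + (n1 + 1) ∧ r ≤ a.rmax d
        · simp only [hc, and_self, if_true]
          refine ⟨fun r' k hr' => ?_, by simp, fun k => ?_, by simp, by simp⟩
          · rw [if_neg (hact _ _ (by omega)), h0 _ _ (by omega)]
          · rw [if_neg (hact _ _ (by omega)), h0 _ _ (by omega)]
            simp
        · simp only [if_neg hc]
          refine ⟨fun r' k hr' => ?_, by simp [h1], fun k => ?_, by simp [h3], by simp [h4]⟩
          · rw [if_neg (hact _ _ (by omega)), h0 _ _ (by omega)]
          · by_cases hk : k = 1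
            · subst hk; simp
            · rw [if_neg (by rintro ⟨-, h⟩; exact hk h.symm)]
              simp [hk]
      · simp only [hlt, if_false] at hact ⊢
        simp only [Function.update_self, List.length_cons, h4, ne_eq, one_ne_zero,
          not_false_eq_true, Function.update_of_ne, h3]
        by_cases hc : 2 * a.q ^ r ≤ n0 + 1 + n1 ∧ r ≤ a.rmax d
        · simp only [hc, and_self, if_true]
          refine ⟨fun r' k hr' => ?_, by simp, fun k => ?_, by simp, by simp⟩
          · rw [if_neg (hact _ _ (by omega)), h0 _ _ (by omega)]
          · rw [if_neg (hact _ _ (by omega)), h0 _ _ (by omega)]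
            simp
        · simp only [if_neg hc]
          refine ⟨fun r' k hr' => ?_, by simp [h1], fun k => ?_, by simp [h3], by simp [h4]⟩
          · rw [if_neg (hact _ _ (by omega)), h0 _ _ (by omega)]
          · by_cases hk : k = 0
            · subst hk; simp
            · rw [if_neg (by rintro ⟨-, h⟩; exact hk h.symm)]
              simp [hk]
    · obtain ⟨e1, e2, -, -⟩ := step_of_ne a (a.run x y t) (x t) (y t) hm
      simp only [Params.run, visits, hm, if_false, Params.sample, false_and, e1, e2]
      exact ⟨h0, h1, h2, h3, h4⟩

lemma roundAt_mono (m : Fin d → ℕ) (t : ℕ) : a.roundAt x m t ≤ a.roundAt x m (t + 1) := by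
  classical
  unfold Params.roundAt
  simp only [visits]
  split_ifs
  · simp only [clock, tick]
    split_ifs <;> simp
  · exact le_rfl

lemma sample_succ_of_lt (m : Fin d → ℕ) {r t : ℕ} (hr : r < a.roundAt x m t) (k : Fin 2) :
    a.sample x y m r k (t + 1) = a.sample x y m r k t := by
  classical
  simp only [Params.sample]
  rw [if_neg]
  rintro ⟨-, h, -⟩
  unfold Params.roundAt at hr
  omega

/-- The samples of a completed round do not change any more. -/
lemma sample_eq_of_le (m : Fin d → ℕ) {r s t : ℕ} (hst : s ≤ t) (hr : r < a.roundAt x m s)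
    (k : Fin 2) :
    r < a.roundAt x m t ∧ a.sample x y m r k t = a.sample x y m r k s := by
  induction t, hst using Nat.le_induction with
  | base => exact ⟨hr, rfl⟩
  | succ t _ ih =>
    exact ⟨ih.1.trans_le (roundAt_mono a x m t), (sample_succ_of_lt a x y m ih.1 k).trans ih.2⟩

/-- What one step does in the hypercube of the context. -/
lemma round_step_cases (hq : 1 ≤ a.q) {m : Fin d → ℕ} {t : ℕ}
    (hm : binOf a.q (a.level d) (x t) = m) :
    (a.roundAt x m (t + 1) = a.roundAt x m t ∧
      ((a.run x y (t + 1)).flag m ↔ (a.run x y t).flag m) ∧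
      (a.run x y (t + 1)).rlast m = (a.run x y t).rlast m) ∨
    (a.roundAt x m (t + 1) = a.roundAt x m t + 1 ∧ a.roundAt x m t ≤ a.rmax d ∧
      (∀ k, (a.sample x y m (a.roundAt x m t) k (t + 1)).length = a.q ^ a.roundAt x m t) ∧
      ((a.run x y (t + 1)).flag m ↔ (a.run x y t).flag m ∨
        a.test m (a.roundAt x m t) (fun k => a.sample x y m (a.roundAt x m t) k (t + 1))) ∧
      (¬ (a.run x y t).flag m →
        a.test m (a.roundAt x m t) (fun k => a.sample x y m (a.roundAt x m t) k (t + 1)) →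
        (a.run x y (t + 1)).rlast m = a.roundAt x m t) ∧
      ((a.run x y t).flag m ∨
        ¬ a.test m (a.roundAt x m t) (fun k => a.sample x y m (a.roundAt x m t) k (t + 1)) →
        (a.run x y (t + 1)).rlast m = (a.run x y t).rlast m)) := by
  classical
  obtain ⟨-, h1, h2, h3, h4⟩ := run_spec a x y m t
  obtain ⟨-, h5, h6, h7, -⟩ := clock_spec hq (a.rmax d) (visits a.q (a.level d) x m t)
  have hround : a.roundAt x m t = (clock a.q (a.rmax d) (visits a.q (a.level d) x m t)).1 := rfl
  have hround' : a.roundAt x m (t + 1) =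
      (tick a.q (a.rmax d) (clock a.q (a.rmax d) (visits a.q (a.level d) x m t))).1 := by
    unfold Params.roundAt
    simp only [visits, hm, if_true, clock]
  have hD : Function.update ((a.run x y t).data m) ((a.run x y t).arm m)
      ((x t, y t ((a.run x y t).arm m)) :: (a.run x y t).data m ((a.run x y t).arm m)) =
      fun k => a.sample x y m (a.roundAt x m t) k (t + 1) := by
    funext k
    simp only [Params.sample, hm, true_and, Active]
    have harm : (if (clock a.q (a.rmax d) (visits a.q (a.level d) x m t)).2.2 <
        (clock a.q (a.rmax d) (visits a.q (a.level d) x m t)).2.1 then (1 : Fin 2) else 0) =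
        (a.run x y t).arm m := by rw [State.arm, h3, h4]
    rw [harm, ← hround]
    by_cases hk : k = (a.run x y t).arm m
    · subst hk; simp [h2]
    · rw [Function.update_of_ne hk, if_neg (fun h => hk h.2.symm), h2]
  have hlen : ((a.sample x y m (a.roundAt x m t) 0 (t + 1)).length,
      (a.sample x y m (a.roundAt x m t) 1 (t + 1)).length) =
      if (clock a.q (a.rmax d) (visits a.q (a.level d) x m t)).2.2 <
        (clock a.q (a.rmax d) (visits a.q (a.level d) x m t)).2.1 then
      ((clock a.q (a.rmax d) (visits a.q (a.level d) x m t)).2.1,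
        (clock a.q (a.rmax d) (visits a.q (a.level d) x m t)).2.2 + 1) else
      ((clock a.q (a.rmax d) (visits a.q (a.level d) x m t)).2.1 + 1,
        (clock a.q (a.rmax d) (visits a.q (a.level d) x m t)).2.2) := by
    have e0 := congrArg List.length (congrFun hD 0)
    have e1 := congrArg List.length (congrFun hD 1)
    rw [← e0, ← e1]
    simp only [State.arm, h3, h4]
    split_ifs <;> simp [h3, h4]
  rw [hround', hround]
  rw [← hround]
  simp only [Params.run, Params.step, hm, h1, hD]
  simp only [tick, ← hlen, ← hround]
  by_cases hc : 2 * a.q ^ a.roundAt x m t ≤ (a.sample x y m (a.roundAt x m t) 0 (t + 1)).length +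
      (a.sample x y m (a.roundAt x m t) 1 (t + 1)).length ∧ a.roundAt x m t ≤ a.rmax d
  · right
    rw [if_pos hc, if_pos hc]
    have h8 := h7 hc.2
    rw [← hround] at h8
    have hl : (a.sample x y m (a.roundAt x m t) 0 (t + 1)).length = a.q ^ a.roundAt x m t ∧
        (a.sample x y m (a.roundAt x m t) 1 (t + 1)).length = a.q ^ a.roundAt x m t := by
      have hc1 := hc.1
      split_ifs at hlen with hlt <;> (rw [Prod.mk.injEq] at hlen; constructor <;> omega)
    refine ⟨by simp, hc.2, fun k => ?_, by simp, fun hf ht => ?_, fun h => ?_⟩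
    · fin_cases k
      · exact hl.1
      · exact hl.2
    · simp [hf, ht]
    · simp only
      rw [if_neg (by tauto)]
  · left
    rw [if_neg hc, if_neg hc]
    simp

/-- A completed round has `q ^ r` samples of each arm. -/
lemma length_sample (hq : 1 ≤ a.q) (m : Fin d → ℕ) {r t : ℕ} (hr1 : 1 ≤ r)
    (hr : r < a.roundAt x m t) (k : Fin 2) : (a.sample x y m r k t).length = a.q ^ r := by
  classical
  induction t with
  | zero =>
    simp [Params.roundAt, visits, clock] at hr
    omega
  | succ t ih =>
    by_cases hrt : r < a.roundAt x m t
    · rw [sample_succ_of_lt a x y m hrt, ih hrt]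
    · by_cases hm : binOf a.q (a.level d) (x t) = m
      · rcases round_step_cases a x y hq hm with ⟨h, -⟩ | ⟨h, -, h', -⟩
        · omega
        · have : r = a.roundAt x m t := by omega
          rw [this]; exact h' k
      · exfalso
        unfold Params.roundAt at hr hrt
        simp only [visits, hm, if_false] at hr
        exact hrt hr

/-- The flag is raised exactly in the first completed round in which the test is positive. -/
lemma flag_spec (hq : 1 ≤ a.q) (m : Fin d → ℕ) (t : ℕ) :
    ((a.run x y t).flag m → ∃ r, 1 ≤ r ∧ r < a.roundAt x m t ∧
      a.test m r (fun k => a.sample x y m r k t) ∧ (a.run x y t).rlast m = r) ∧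
    (¬ (a.run x y t).flag m → (a.run x y t).rlast m = a.rmax d) ∧
    (∀ r, 1 ≤ r → r < a.roundAt x m t → a.test m r (fun k => a.sample x y m r k t) →
      (a.run x y t).flag m ∧ (a.run x y t).rlast m ≤ r) := by
  classical
  induction t with
  | zero =>
    simp only [Params.run, Params.init, Params.roundAt, visits, clock]
    refine ⟨False.elim, fun _ => trivial, fun r h1 h2 => by omega⟩
  | succ t ih =>
    obtain ⟨i1, i2, i3⟩ := ih
    have hround1 : 1 ≤ a.roundAt x m t := (clock_spec hq _ _).1
    by_cases hm : binOf a.q (a.level d) (x t) = m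
    · rcases round_step_cases a x y hq hm with ⟨h1, h2, h3⟩ | ⟨h1, h2, -, h3, h4, h5⟩
      · rw [h1, h3]
        refine ⟨fun hf => ?_, fun hf => i2 (by rwa [h2] at hf), fun r hr1 hr ht => ?_⟩
        · obtain ⟨r, hr1, hr, ht, hl⟩ := i1 (h2.1 hf)
          refine ⟨r, hr1, hr, ?_, hl⟩
          simpa only [sample_succ_of_lt a x y m hr] using ht
        · simp only [sample_succ_of_lt a x y m hr] at ht
          rw [h2]
          exact i3 r hr1 hr ht
      · rw [h1]
        by_cases hf : (a.run x y t).flag m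
        · obtain ⟨r, hr1, hr, ht, hl⟩ := i1 hf
          rw [h5 (Or.inl hf)]
          refine ⟨fun _ => ⟨r, hr1, by omega, ?_, hl⟩, fun h => absurd (h3.2 (Or.inl hf)) h,
            fun r' hr1' hr' ht' => ⟨h3.2 (Or.inl hf), ?_⟩⟩
          · simpa only [sample_succ_of_lt a x y m hr] using ht
          · by_cases hlt : r' < a.roundAt x m t
            · simp only [sample_succ_of_lt a x y m hlt] at ht'
              exact (i3 r' hr1' hlt ht').2
            · omega
        · by_cases ht : a.test m (a.roundAt x m t)
              (fun k => a.sample x y m (a.roundAt x m t) k (t + 1))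
          · have hl := h4 hf ht
            refine ⟨fun _ => ⟨_, hround1, by omega, ht, hl⟩, fun h => absurd (h3.2 (Or.inr ht)) h,
              fun r' hr1' hr' ht' => ⟨h3.2 (Or.inr ht), ?_⟩⟩
            by_cases hlt : r' < a.roundAt x m t
            · simp only [sample_succ_of_lt a x y m hlt] at ht'
              exact absurd (i3 r' hr1' hlt ht').1 hf
            · omega
          · rw [h5 (Or.inr ht)]
            refine ⟨fun h => ?_, fun _ => i2 hf, fun r' hr1' hr' ht' => ?_⟩
            · rcases h3.1 h with h | h
              · exact absurd h hf
              · exact absurd h ht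
            · by_cases hlt : r' < a.roundAt x m t
              · simp only [sample_succ_of_lt a x y m hlt] at ht'
                exact absurd (i3 r' hr1' hlt ht').1 hf
              · have : r' = a.roundAt x m t := by omega
                subst this
                exact absurd ht' ht
    · obtain ⟨-, -, e3, e4⟩ := step_of_ne a (a.run x y t) (x t) (y t) hm
      have er : a.roundAt x m (t + 1) = a.roundAt x m t := by
        unfold Params.roundAt
        simp only [visits, hm, if_false]
      have es : ∀ r k, a.sample x y m r k (t + 1) = a.sample x y m r k t := fun r k => by
        simp only [Params.sample, hm, false_and, if_false]
      simp only [es, er]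
      simp only [Params.run, e3, e4]
      exact ⟨i1, i2, i3⟩

end Course

/-- If every hypercube is visited often enough before time `n`, the phase ends by time `n`. -/
lemma exists_stopsAt {d : ℕ} (a : Params) (x : ℕ → Fin d → ℝ) (y : ℕ → Fin 2 → ℝ) (hq : 1 ≤ a.q)
    {n : ℕ} (hn : 1 ≤ n)
    (hv : ∀ m ∈ bins d a.q (a.level d),
      2 * ∑ i ∈ Finset.Ico 1 (a.rmax d + 1), a.q ^ i ≤ visits a.q (a.level d) x m n) :
    ∃ t, a.StopsAt x y t ∧ t ≤ n := by
  classical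
  have hex : ∃ t, 1 ≤ t ∧ a.Done (a.run x y t) := by
    refine ⟨n, hn, fun m hm => Or.inr ?_⟩
    rw [(run_spec a x y m n).2.1]
    exact lt_round_of_le hq (hv m hm)
  refine ⟨Nat.find hex, ⟨(Nat.find_spec hex).1, (Nat.find_spec hex).2, fun s hs1 hs hd => ?_⟩,
    Nat.find_min' hex ⟨hn, ?_⟩⟩
  · exact Nat.find_min hex hs ⟨hs1, hd⟩
  · intro m hm
    right
    rw [(run_spec a x y m n).2.1]
    exact lt_round_of_le hq (hv m hm)

/-- Bounds for the smallest recorded round at the end of the phase, if no test is positive before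
round `lo`, and if some hypercube has a positive test in round `r'`. -/
lemma sInf_rlast_bounds {d : ℕ} (a : Params) (x : ℕ → Fin d → ℝ) (y : ℕ → Fin 2 → ℝ)
    (hq : 1 ≤ a.q) {n t : ℕ} (ht : a.StopsAt x y t) (htn : t ≤ n) {lo : ℝ}
    (hlo : lo ≤ a.rmax d)
    (h1 : ∀ m ∈ bins d a.q (a.level d), ∀ r : ℕ, 1 ≤ r → r < a.roundAt x m n → (r : ℝ) < lo →
      ¬ a.test m r (fun k => a.sample x y m r k n))
    {m' : Fin d → ℕ} (hm' : m' ∈ bins d a.q (a.level d)) {r' : ℕ} (hr1 : 1 ≤ r')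
    (hr' : r' ≤ a.rmax d)
    (h2 : r' < a.roundAt x m' n → a.test m' r' (fun k => a.sample x y m' r' k n)) :
    lo ≤ (sInf ((a.run x y t).rlast '' (bins d a.q (a.level d) : Set (Fin d → ℕ))) : ℕ) ∧
      sInf ((a.run x y t).rlast '' (bins d a.q (a.level d) : Set (Fin d → ℕ))) ≤ r' := by
  constructor
  · obtain ⟨m, hm, hmeq⟩ := Nat.sInf_mem
      (s := (a.run x y t).rlast '' (bins d a.q (a.level d) : Set (Fin d → ℕ)))
      ⟨_, ⟨m', hm', rfl⟩⟩
    rw [← hmeq]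
    obtain ⟨f1, f2, -⟩ := flag_spec a x y hq m t
    by_cases hf : (a.run x y t).flag m
    · obtain ⟨r, hr1, hr, htest, hl⟩ := f1 hf
      rw [hl]
      by_contra! hcon
      refine h1 m hm r hr1 (sample_eq_of_le a x y m htn hr 0).1 hcon ?_
      have : (fun k => a.sample x y m r k n) = fun k => a.sample x y m r k t :=
        funext fun k => (sample_eq_of_le a x y m htn hr k).2
      rwa [this]
    · rw [f2 hf]; exact hlo
  · refine (Nat.sInf_le
      (Set.mem_image_of_mem (a.run x y t).rlast (Finset.mem_coe.2 hm'))).trans ?_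
    obtain ⟨f1, f2, f3⟩ := flag_spec a x y hq m' t
    have key : r' < a.roundAt x m' t → (a.run x y t).rlast m' ≤ r' := by
      intro hr
      have hn := (sample_eq_of_le a x y m' htn hr 0).1
      have : (fun k => a.sample x y m' r' k n) = fun k => a.sample x y m' r' k t :=
        funext fun k => (sample_eq_of_le a x y m' htn hr k).2
      refine (f3 r' hr1 hr ?_).2
      rw [← this]
      exact h2 hn
    rcases ht.2.1 m' hm' with hf | hf
    · obtain ⟨r, -, hr, -, hl⟩ := f1 hf
      by_cases hrr : r ≤ r'
      · rw [hl]; exact hrr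
      · exact key (by omega)
    · rw [(run_spec a x y m' t).2.1] at hf
      exact key (by omega)

/-! ### Exponential inequalities along the policy -/

/-- The information in `Z 0, …, Z (t - 1)`. -/
@[reducible] def past {Ω E : Type*} [MeasurableSpace E] (Z : ℕ → Ω → E) (t : ℕ) : MeasurableSpace Ω :=
  ⨆ i ∈ Set.Iio t, MeasurableSpace.comap (Z i) inferInstance

lemma past_mono {Ω E : Type*} [MeasurableSpace E] (Z : ℕ → Ω → E) {s t : ℕ} (h : s ≤ t) :
    past Z s ≤ past Z t :=
  biSup_mono fun _ hi => lt_of_lt_of_le hi h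

lemma past_le {Ω E : Type*} [mΩ : MeasurableSpace Ω] [MeasurableSpace E] {Z : ℕ → Ω → E}
    (hZ : ∀ t, Measurable (Z t)) (t : ℕ) : past Z t ≤ mΩ :=
  iSup₂_le fun i _ => (hZ i).comap_le

lemma measurable_past {Ω E : Type*} [MeasurableSpace E] (Z : ℕ → Ω → E) {s t : ℕ} (h : s < t) :
    Measurable[past Z t] (Z s) := by
  refine Measurable.mono (comap_measurable (Z s)) ?_ le_rfl
  exact le_iSup₂_of_le s h le_rfl

/-- A product of factors `h (Z t)`, where the factor of time `t` is present or not according to the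
past, has expectation at most `1` if `h (Z t)` has expectation at most `1`: it is a nonnegative
supermartingale. -/
lemma lintegral_prod_le_one {Ω E : Type*} [MeasurableSpace Ω] [MeasurableSpace E] {P : Measure Ω}
    [IsProbabilityMeasure P] {Z : ℕ → Ω → E} (hZ : ∀ t, Measurable (Z t)) (hind : iIndepFun Z P)
    {A : ℕ → Set Ω} (hA : ∀ t, MeasurableSet[past Z t] (A t)) {h : E → ENNReal}
    (hh : Measurable h) (hint : ∀ t, ∫⁻ ω, h (Z t ω) ∂P ≤ 1) {M : ℕ → Ω → ENNReal}
    (M0 : ∀ ω, M 0 ω = 1) (M1 : ∀ t, ∀ ω ∈ A t, M (t + 1) ω = M t ω * h (Z t ω))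
    (M2 : ∀ t, ∀ ω ∉ A t, M (t + 1) ω = M t ω) (n : ℕ) :
    Measurable[past Z n] (M n) ∧ ∫⁻ ω, M n ω ∂P ≤ 1 := by
  classical
  induction n with
  | zero =>
    have : M 0 = fun _ => 1 := funext M0
    rw [this]
    exact ⟨measurable_const, by simp⟩
  | succ n ih =>
    obtain ⟨ih1, ih2⟩ := ih
    have hAm : MeasurableSet (A n) := past_le hZ n _ (hA n)
    have hMm : Measurable (M n) := ih1.mono (past_le hZ n) le_rfl
    have heq : M (n + 1) = fun ω => (A n).indicator (M n) ω * h (Z n ω) +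
        (A n)ᶜ.indicator (M n) ω := by
      funext ω
      by_cases hω : ω ∈ A n
      · simp [M1 n ω hω, hω]
      · simp [M2 n ω hω, hω]
    have hm1 : Measurable[past Z n] ((A n).indicator (M n)) := ih1.indicator (hA n)
    refine ⟨?_, ?_⟩
    · rw [heq]
      have e1 : Measurable[past Z (n + 1)] ((A n).indicator (M n)) :=
        hm1.mono (past_mono Z n.le_succ) le_rfl
      have e2 : Measurable[past Z (n + 1)] ((A n)ᶜ.indicator (M n)) :=
        (ih1.indicator (hA n).compl).mono (past_mono Z n.le_succ) le_rfl
      have e3 : Measurable[past Z (n + 1)] (fun ω => h (Z n ω)) :=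
        hh.comp (measurable_past Z n.lt_succ_self)
      exact (e1.mul e3).add e2
    · have hindep : Indep (past Z n) (MeasurableSpace.comap (Z n) inferInstance) P := by
        have := indep_iSup_of_disjoint (fun i => (hZ i).comap_le) hind.iIndep
          (S := Set.Iio n) (T := {n}) (by simp)
        simpa [past] using this
      have hprod : Measurable fun ω => (A n).indicator (M n) ω * h (Z n ω) :=
        (hMm.indicator hAm).mul (hh.comp (hZ n))
      simp only [heq]
      rw [lintegral_add_left hprod]
      have hmul := lintegral_mul_eq_lintegral_mul_lintegral_of_independent_measurableSpace
        (past_le hZ n) (hZ n).comap_le hindep hm1 (hh.comp (comap_measurable (Z n)))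
      simp only [Function.comp_apply] at hmul
      rw [hmul]
      calc (∫⁻ ω, (A n).indicator (M n) ω ∂P) * (∫⁻ ω, h (Z n ω) ∂P) +
            ∫⁻ ω, (A n)ᶜ.indicator (M n) ω ∂P
          ≤ (∫⁻ ω, (A n).indicator (M n) ω ∂P) * 1 + ∫⁻ ω, (A n)ᶜ.indicator (M n) ω ∂P := by
            gcongr
            exact hint n
        _ = ∫⁻ ω, M n ω ∂P := by
            rw [mul_one, lintegral_indicator hAm, lintegral_indicator hAm.compl,
              lintegral_add_compl _ hAm]
        _ ≤ 1 := ih2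

lemma measurable_binOf {d : ℕ} (q l : ℕ) : Measurable (binOf (d := d) q l) := by
  unfold binOf
  refine measurable_pi_lambda _ fun i => ?_
  exact (Nat.measurable_floor.comp ((measurable_pi_apply i).mul_const _)).min measurable_const

lemma measurableSet_binOf {d : ℕ} (q l : ℕ) (m : Fin d → ℕ) :
    MeasurableSet {x : Fin d → ℝ | binOf q l x = m} :=
  measurable_binOf q l (measurableSet_singleton m)

lemma measurable_visits {d : ℕ} {Ω : Type*} {X : ℕ → Ω → Fin d → ℝ} {Y : ℕ → Ω → Fin 2 → ℝ}
    (q l : ℕ) (m : Fin d → ℕ) (t : ℕ) :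
    Measurable[past (fun t ω => (X t ω, Y t ω)) t]
      (fun ω => visits q l (fun s => X s ω) m t) := by
  classical
  induction t with
  | zero => simp only [visits]; exact measurable_const
  | succ t ih =>
    have e1 : Measurable[past (fun t ω => (X t ω, Y t ω)) (t + 1)]
        (fun ω => visits q l (fun s => X s ω) m t) := ih.mono (past_mono _ t.le_succ) le_rfl
    have e2 : Measurable[past (fun t ω => (X t ω, Y t ω)) (t + 1)] (X t) :=
      measurable_fst.comp (measurable_past (fun t ω => (X t ω, Y t ω)) t.lt_succ_self)
    simp only [visits]
    refine Measurable.ite ?_ ((measurable_from_top (f := fun n : ℕ => n + 1)).comp e1) e1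
    exact e2 (measurableSet_binOf q l m)

section

variable {d : ℕ} {Ω : Type*} [MeasurableSpace Ω] {P : Measure Ω} [IsProbabilityMeasure P]
  {X : ℕ → Ω → Fin d → ℝ} {Y : ℕ → Ω → Fin 2 → ℝ}

/-- A lower tail bound for the number of visits to a hypercube. -/
lemma measure_visits_lt_le (hX : ∀ t, Measurable (X t)) (hY : ∀ t, Measurable (Y t))
    (hind : iIndepFun (fun t ω => (X t ω, Y t ω)) P) (q l : ℕ) (m : Fin d → ℕ) {p₀ : ℝ}
    (hp : ∀ t, p₀ ≤ P.real {ω | binOf q l (X t ω) = m}) (n N : ℕ) :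
    P {ω | visits q l (fun s => X s ω) m n < N} ≤ ENNReal.ofReal (Real.exp (N - n * p₀ / 2)) := by
  classical
  set h : (Fin d → ℝ) × (Fin 2 → ℝ) → ENNReal := fun z =>
    ENNReal.ofReal (if binOf q l z.1 = m then Real.exp (p₀ / 2 - 1) else Real.exp (p₀ / 2)) with hh
  have hZ : ∀ t, Measurable fun ω => (X t ω, Y t ω) := fun t => (hX t).prodMk (hY t)
  have hhm : Measurable h := by
    refine (Measurable.ite ?_ measurable_const measurable_const).ennreal_ofReal
    exact measurable_fst (measurableSet_binOf q l m)
  have hint : ∀ t, ∫⁻ ω, h (X t ω, Y t ω) ∂P ≤ 1 := by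
    intro t
    have hB : MeasurableSet {ω | binOf q l (X t ω) = m} := hX t (measurableSet_binOf q l m)
    have hfun : ∀ ω, h (X t ω, Y t ω) = {ω | binOf q l (X t ω) = m}.indicator
        (fun _ => ENNReal.ofReal (Real.exp (p₀ / 2 - 1))) ω +
        {ω | binOf q l (X t ω) = m}ᶜ.indicator
        (fun _ => ENNReal.ofReal (Real.exp (p₀ / 2))) ω := by
      intro ω
      by_cases hω : binOf q l (X t ω) = m <;> simp [hh, hω]
    simp_rw [hfun]
    rw [lintegral_add_left (measurable_const.indicator hB), lintegral_indicator_const hB,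
      lintegral_indicator_const hB.compl, ← ofReal_measureReal, ← ofReal_measureReal,
      probReal_compl_eq_one_sub hB, ← ENNReal.ofReal_mul (Real.exp_nonneg _),
      ← ENNReal.ofReal_mul (Real.exp_nonneg _), ← ENNReal.ofReal_add (by positivity)
        (mul_nonneg (Real.exp_nonneg _) (sub_nonneg.2 measureReal_le_one)),
      ENNReal.ofReal_le_one]
    have hpt := hp t
    set π := P.real {ω | binOf q l (X t ω) = m}
    have hπ : 0 ≤ π := measureReal_nonneg
    have he : Real.exp (-1) ≤ 1 / 2 := by
      have h2 : (2 : ℝ) ≤ Real.exp 1 := by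
        have := Real.add_one_le_exp (1 : ℝ); linarith
      rw [Real.exp_neg, one_div]
      exact inv_anti₀ (by norm_num) h2
    have h3 : 1 - p₀ / 2 ≤ Real.exp (-(p₀ / 2)) := by
      have := Real.add_one_le_exp (-(p₀ / 2)); linarith
    rw [sub_eq_add_neg, Real.exp_add]
    calc Real.exp (p₀ / 2) * Real.exp (-1) * π + Real.exp (p₀ / 2) * (1 - π)
        = Real.exp (p₀ / 2) * (1 - π * (1 - Real.exp (-1))) := by ring
      _ ≤ Real.exp (p₀ / 2) * Real.exp (-(p₀ / 2)) := by
          gcongr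
          nlinarith
      _ = 1 := by rw [← Real.exp_add]; simp
  have hM := lintegral_prod_le_one (P := P) hZ hind (A := fun _ => Set.univ)
    (fun t => MeasurableSet.univ) hhm hint
    (M := fun t ω => ENNReal.ofReal (Real.exp (t * p₀ / 2 - visits q l (fun s => X s ω) m t)))
    (fun ω => by simp [visits]) (fun t ω _ => by
      rw [← ENNReal.ofReal_mul (Real.exp_nonneg _)]
      simp only [visits]
      split_ifs with hb
      · rw [← Real.exp_add]; congr 2; push_cast; ring
      · rw [← Real.exp_add]; congr 2; push_cast; ring) (fun t ω h => absurd (Set.mem_univ _) h) n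
  have hmk := mul_meas_ge_le_lintegral₀ (μ := P)
    ((hM.1.mono (past_le hZ n) le_rfl).aemeasurable)
    (ENNReal.ofReal (Real.exp (n * p₀ / 2 - N)))
  have hpos : ENNReal.ofReal (Real.exp (n * p₀ / 2 - N)) ≠ 0 := by
    simp [Real.exp_pos]
  have hsub : P {ω | visits q l (fun s => X s ω) m n < N} ≤
      P {ω | ENNReal.ofReal (Real.exp (n * p₀ / 2 - N)) ≤
        ENNReal.ofReal (Real.exp (n * p₀ / 2 - visits q l (fun s => X s ω) m n))} := by
    refine measure_mono fun ω hω => ?_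
    refine ENNReal.ofReal_le_ofReal (Real.exp_le_exp.2 ?_)
    have : (visits q l (fun s => X s ω) m n : ℝ) ≤ N := by exact_mod_cast (le_of_lt hω)
    linarith
  refine hsub.trans ?_
  have h1 := hmk.trans hM.2
  have h2 : ENNReal.ofReal (Real.exp (N - n * p₀ / 2)) =
      (ENNReal.ofReal (Real.exp (n * p₀ / 2 - N)))⁻¹ := by
    rw [← ENNReal.ofReal_inv_of_pos (Real.exp_pos _), ← Real.exp_neg]
    congr 2; ring
  rw [h2, ENNReal.le_inv_iff_mul_le, mul_comm]
  exact h1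

/-- Bernstein's inequality for the samples of a completed round. -/
lemma measure_sample_sum_ge_le (a : Params) (hq : 1 ≤ a.q) (hX : ∀ t, Measurable (X t))
    (hY : ∀ t, Measurable (Y t)) (hind : iIndepFun (fun t ω => (X t ω, Y t ω)) P)
    (m : Fin d → ℕ) {r : ℕ} (hr : 1 ≤ r) (k : Fin 2) {g : (Fin d → ℝ) × ℝ → ℝ} (hg : Measurable g)
    {μ v σ : ℝ} (hv : 0 < v) (hσ : 0 ≤ σ) (hσv : σ ≤ 2 * v)
    (hb : ∀ t, ∀ᵐ ω ∂P, binOf a.q (a.level d) (X t ω) = m → |g (X t ω, Y t ω k)| ≤ 1)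
    (h1 : ∀ t, ∫ ω in {ω | binOf a.q (a.level d) (X t ω) = m}, g (X t ω, Y t ω k) ∂P ≤
      μ * P.real {ω | binOf a.q (a.level d) (X t ω) = m})
    (h2 : ∀ t, ∫ ω in {ω | binOf a.q (a.level d) (X t ω) = m}, g (X t ω, Y t ω k) ^ 2 ∂P ≤
      v * P.real {ω | binOf a.q (a.level d) (X t ω) = m}) (n : ℕ) :
    P {ω | r < a.roundAt (fun s => X s ω) m n ∧ (a.q : ℝ) ^ r * (μ + σ) ≤
        ((a.sample (fun s => X s ω) (fun s => Y s ω) m r k n).map g).sum} ≤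
      ENNReal.ofReal (Real.exp (-((a.q : ℝ) ^ r * (σ ^ 2 / (4 * v))))) := by
  classical
  -- the optimal exponent in Chernoff's bound; it is at most `1`, where `exp u ≤ 1 + u + u ^ 2`
  set lam : ℝ := σ / (2 * v) with hlam
  have hlam0 : 0 ≤ lam := by positivity
  have hlam1 : lam ≤ 1 := by rw [hlam, div_le_one (by positivity)]; exact hσv
  set ψ : ℝ := lam * μ + lam ^ 2 * v with hψ
  set h : (Fin d → ℝ) × (Fin 2 → ℝ) → ENNReal := fun z =>
    ENNReal.ofReal (if binOf a.q (a.level d) z.1 = m then Real.exp (lam * g (z.1, z.2 k) - ψ)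
      else 1) with hh
  have hZ : ∀ t, Measurable fun ω => (X t ω, Y t ω) := fun t => (hX t).prodMk (hY t)
  have hgk : Measurable fun z : (Fin d → ℝ) × (Fin 2 → ℝ) => g (z.1, z.2 k) :=
    hg.comp (measurable_fst.prodMk ((measurable_pi_apply k).comp measurable_snd))
  have hhm : Measurable h := by
    refine (Measurable.ite ?_ ?_ measurable_const).ennreal_ofReal
    · exact measurable_fst (measurableSet_binOf _ _ m)
    · exact Real.measurable_exp.comp ((hgk.const_mul _).sub_const _)
  have hint : ∀ t, ∫⁻ ω, h (X t ω, Y t ω) ∂P ≤ 1 := by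
    intro t
    set B : Set Ω := {ω | binOf a.q (a.level d) (X t ω) = m} with hBdef
    have hB : MeasurableSet B := hX t (measurableSet_binOf _ _ m)
    have hgm : Measurable fun ω => g (X t ω, Y t ω k) := hgk.comp (hZ t)
    have hbB : ∀ᵐ ω ∂(P.restrict B), |g (X t ω, Y t ω k)| ≤ 1 := by
      rw [ae_restrict_iff' hB]; exact hb t
    have hgi : IntegrableOn (fun ω => g (X t ω, Y t ω k)) B P :=
      Integrable.of_bound hgm.aestronglyMeasurable 1 hbB
    have hgi2 : IntegrableOn (fun ω => g (X t ω, Y t ω k) ^ 2) B P :=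
      Integrable.of_bound (hgm.pow_const 2).aestronglyMeasurable 1 (by
        filter_upwards [hbB] with ω hω
        rw [Real.norm_eq_abs, abs_pow]
        exact pow_le_one₀ (abs_nonneg _) hω)
    have hfun : ∫⁻ ω, h (X t ω, Y t ω) ∂P = ∫⁻ ω in B,
        ENNReal.ofReal (Real.exp (lam * g (X t ω, Y t ω k) - ψ)) ∂P + P Bᶜ := by
      rw [← lintegral_add_compl _ hB]
      congr 1
      · refine setLIntegral_congr_fun hB fun ω hω => ?_
        have : binOf a.q (a.level d) (X t ω) = m := hω
        simp [hh, this]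
      · rw [← setLIntegral_one]
        refine setLIntegral_congr_fun hB.compl fun ω hω => ?_
        have : ¬ binOf a.q (a.level d) (X t ω) = m := hω
        simp [hh, this]
    have hle : ∫⁻ ω in B, ENNReal.ofReal (Real.exp (lam * g (X t ω, Y t ω k) - ψ)) ∂P ≤
        ENNReal.ofReal (∫ ω in B, Real.exp (-ψ) * (1 + lam * g (X t ω, Y t ω k) +
          lam ^ 2 * g (X t ω, Y t ω k) ^ 2) ∂P) := by
      rw [ofReal_integral_eq_lintegral_ofReal]
      · refine lintegral_mono_ae ?_
        filter_upwards [hbB] with ω hω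
        refine ENNReal.ofReal_le_ofReal ?_
        rw [sub_eq_add_neg, Real.exp_add, mul_comm]
        gcongr
        have habs : |lam * g (X t ω, Y t ω k)| ≤ 1 := by
          rw [abs_mul, abs_of_nonneg hlam0]
          exact mul_le_one₀ hlam1 (abs_nonneg _) hω
        have := (abs_le.1 (Real.abs_exp_sub_one_sub_id_le habs)).2
        nlinarith
      · exact (((integrable_const _).add (hgi.const_mul _)).add (hgi2.const_mul _)).const_mul _
      · filter_upwards [hbB] with ω hω
        have habs : |lam * g (X t ω, Y t ω k)| ≤ 1 := by
          rw [abs_mul, abs_of_nonneg hlam0]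
          exact mul_le_one₀ hlam1 (abs_nonneg _) hω
        have h3 := (abs_le.1 habs).1
        have : 0 ≤ 1 + lam * g (X t ω, Y t ω k) + lam ^ 2 * g (X t ω, Y t ω k) ^ 2 := by
          nlinarith [sq_nonneg (lam * g (X t ω, Y t ω k))]
        simp only [Pi.zero_apply]
        positivity
    have hval : ∫ ω in B, Real.exp (-ψ) * (1 + lam * g (X t ω, Y t ω k) +
          lam ^ 2 * g (X t ω, Y t ω k) ^ 2) ∂P ≤ P.real B := by
      have hsum : ∫ ω in B, (1 + lam * g (X t ω, Y t ω k) +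
          lam ^ 2 * g (X t ω, Y t ω k) ^ 2) ∂P = P.real B +
          lam * ∫ ω in B, g (X t ω, Y t ω k) ∂P + lam ^ 2 * ∫ ω in B, g (X t ω, Y t ω k) ^ 2 ∂P := by
        rw [integral_add, integral_add, integral_const_mul, integral_const_mul]
        · simp
        · exact integrable_const _
        · exact hgi.const_mul _
        · exact (integrable_const _).add (hgi.const_mul _)
        · exact hgi2.const_mul _
      rw [integral_const_mul, hsum]
      have e1 := mul_le_mul_of_nonneg_left (h1 t) hlam0
      have e2 := mul_le_mul_of_nonneg_left (h2 t) (sq_nonneg lam)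
      have e3 : P.real B + lam * ∫ ω in B, g (X t ω, Y t ω k) ∂P +
          lam ^ 2 * ∫ ω in B, g (X t ω, Y t ω k) ^ 2 ∂P ≤ P.real B * Real.exp ψ := by
        have := mul_le_mul_of_nonneg_left (Real.add_one_le_exp ψ) (measureReal_nonneg (μ := P) (s := B))
        rw [hψ] at this ⊢
        linarith
      calc _ ≤ Real.exp (-ψ) * (P.real B * Real.exp ψ) := by gcongr
        _ = P.real B * (Real.exp (-ψ) * Real.exp ψ) := by ring
        _ = P.real B := by rw [← Real.exp_add]; simp
    rw [hfun]
    calc _ ≤ ENNReal.ofReal (P.real B) + P Bᶜ := by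
          gcongr
          exact hle.trans (ENNReal.ofReal_le_ofReal hval)
      _ = 1 := by rw [ofReal_measureReal, measure_add_measure_compl hB, measure_univ]
  have hA : ∀ t, MeasurableSet[past (fun t ω => (X t ω, Y t ω)) t]
      {ω | Active a.q (a.rmax d) r k (visits a.q (a.level d) (fun s => X s ω) m t)} := fun t =>
    (measurable_visits (Y := Y) a.q (a.level d) m t)
      (MeasurableSet.of_discrete (s := {n | Active a.q (a.rmax d) r k n}))
  have hM := lintegral_prod_le_one (P := P) hZ hind hA hhm hint
    (M := fun t ω => ENNReal.ofReal (Real.exp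
      (lam * ((a.sample (fun s => X s ω) (fun s => Y s ω) m r k t).map g).sum -
        ψ * (a.sample (fun s => X s ω) (fun s => Y s ω) m r k t).length)))
    (fun ω => by simp [Params.sample]) (fun t ω hω => by
      have hω' : Active a.q (a.rmax d) r k (visits a.q (a.level d) (fun s => X s ω) m t) := hω
      rw [← ENNReal.ofReal_mul (Real.exp_nonneg _)]
      simp only [Params.sample, hω', and_true]
      split_ifs with hb
      · rw [← Real.exp_add]
        congr 2
        simp only [List.map_cons, List.sum_cons, List.length_cons]
        push_cast
        ring
      · rw [mul_one]) (fun t ω hω => by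
      have hω' : ¬ Active a.q (a.rmax d) r k (visits a.q (a.level d) (fun s => X s ω) m t) := hω
      simp only [Params.sample, hω', and_false, if_false]) n
  have hmk := mul_meas_ge_le_lintegral₀ (μ := P)
    ((hM.1.mono (past_le hZ n) le_rfl).aemeasurable)
    (ENNReal.ofReal (Real.exp ((a.q : ℝ) ^ r * (σ ^ 2 / (4 * v)))))
  refine (measure_mono (t := {ω | ENNReal.ofReal (Real.exp ((a.q : ℝ) ^ r * (σ ^ 2 / (4 * v)))) ≤
    ENNReal.ofReal (Real.exp
      (lam * ((a.sample (fun s => X s ω) (fun s => Y s ω) m r k n).map g).sum -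
        ψ * (a.sample (fun s => X s ω) (fun s => Y s ω) m r k n).length))}) ?_).trans ?_
  · rintro ω ⟨hω1, hω2⟩
    refine ENNReal.ofReal_le_ofReal (Real.exp_le_exp.2 ?_)
    rw [length_sample a _ _ hq m hr hω1]
    have e1 := mul_le_mul_of_nonneg_left hω2 hlam0
    have e2 : (a.q : ℝ) ^ r * (σ ^ 2 / (4 * v)) =
        lam * ((a.q : ℝ) ^ r * (μ + σ)) - ψ * (a.q : ℝ) ^ r := by
      rw [hψ, hlam]; field_simp; ring
    push_cast
    linarith
  · rw [Real.exp_neg, ENNReal.ofReal_inv_of_pos (Real.exp_pos _), ENNReal.le_inv_iff_mul_le,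
      mul_comm]
    exact hmk.trans hM.2

end

/-! ### Hypercubes and windows -/

section Bins

variable {d q l : ℕ} {m : Fin d → ℕ}

lemma bin_eq_Icc (q l : ℕ) (m : Fin d → ℕ) : bin q l m =
    Set.Icc (fun i => (m i : ℝ) / (q : ℝ) ^ l) (fun i => ((m i : ℝ) + 1) / (q : ℝ) ^ l) := by
  ext x
  simp [bin, Set.mem_Icc, Pi.le_def, forall_and]

lemma isCompact_bin (q l : ℕ) (m : Fin d → ℕ) : IsCompact (bin q l m) := by
  rw [bin_eq_Icc]; exact isCompact_Icc

lemma measurableSet_bin (q l : ℕ) (m : Fin d → ℕ) : MeasurableSet (bin q l m) :=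
  (isCompact_bin q l m).measurableSet

lemma mem_cube {x : Fin d → ℝ} : x ∈ cube d ↔ ∀ i, 0 ≤ x i ∧ x i ≤ 1 := by
  simp [cube, Set.mem_Icc, Pi.le_def, forall_and]

lemma mem_bins : m ∈ bins d q l ↔ ∀ i, m i < q ^ l := by
  simp [bins]

lemma bin_subset_cube (hq : 1 ≤ q) (hm : m ∈ bins d q l) : bin q l m ⊆ cube d := by
  intro x hx
  rw [mem_cube]
  intro i
  have hql : (0 : ℝ) < (q : ℝ) ^ l := by positivity
  refine ⟨le_trans (by positivity) (hx i).1, (hx i).2.trans ?_⟩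
  rw [div_le_one hql]
  exact_mod_cast (mem_bins.1 hm i)

lemma binOf_mem_bin (hq : 1 ≤ q) {x : Fin d → ℝ} (hx : x ∈ cube d) (h : binOf q l x = m) :
    x ∈ bin q l m := by
  have hql : (0 : ℝ) < (q : ℝ) ^ l := by positivity
  have hql1 : 1 ≤ q ^ l := Nat.one_le_pow _ _ hq
  rw [mem_cube] at hx
  intro i
  have hi : min ⌊x i * (q : ℝ) ^ l⌋₊ (q ^ l - 1) = m i := congrFun h i
  have h0 : 0 ≤ x i * (q : ℝ) ^ l := mul_nonneg (hx i).1 hql.le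
  rw [div_le_iff₀ hql, le_div_iff₀ hql]
  constructor
  · refine le_trans ?_ (Nat.floor_le h0)
    exact_mod_cast hi ▸ min_le_left _ _
  · rcases min_choice ⌊x i * (q : ℝ) ^ l⌋₊ (q ^ l - 1) with h' | h'
    · rw [← hi, h']
      exact (Nat.lt_floor_add_one _).le
    · rw [← hi, h']
      have : ((q ^ l - 1 : ℕ) : ℝ) + 1 = (q : ℝ) ^ l := by
        rw [Nat.cast_sub hql1]; push_cast; ring
      rw [this]
      exact mul_le_of_le_one_left hql.le (hx i).2

lemma binOf_eq_of_mem_Ico (hq : 1 ≤ q) (hm : m ∈ bins d q l) {x : Fin d → ℝ}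
    (hx : ∀ i, (m i : ℝ) / (q : ℝ) ^ l ≤ x i ∧ x i < ((m i : ℝ) + 1) / (q : ℝ) ^ l) :
    binOf q l x = m := by
  have hql : (0 : ℝ) < (q : ℝ) ^ l := by positivity
  funext i
  have h1 := (hx i).1
  have h2 := (hx i).2
  rw [div_le_iff₀ hql] at h1
  rw [lt_div_iff₀ hql] at h2
  have h3 : ⌊x i * (q : ℝ) ^ l⌋₊ = m i := by
    rw [Nat.floor_eq_iff (le_trans (by positivity) h1)]
    exact ⟨h1, h2⟩
  have := mem_bins.1 hm i
  simp only [binOf, h3]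
  omega

lemma binOf_inter_cube_ae_eq (hq : 1 ≤ q) (hm : m ∈ bins d q l) :
    ({x | binOf q l x = m} ∩ cube d : Set (Fin d → ℝ)) =ᵐ[volume] bin q l m := by
  have h1 : (Set.pi Set.univ fun i => Set.Ico ((m i : ℝ) / (q : ℝ) ^ l)
      (((m i : ℝ) + 1) / (q : ℝ) ^ l)) =ᵐ[volume] bin q l m := by
    rw [bin_eq_Icc]
    exact Measure.univ_pi_Ico_ae_eq_Icc
  have h2 : (Set.pi Set.univ fun i => Set.Ico ((m i : ℝ) / (q : ℝ) ^ l)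
      (((m i : ℝ) + 1) / (q : ℝ) ^ l)) ⊆ {x | binOf q l x = m} ∩ cube d := by
    intro x hx
    have hx' : ∀ i, (m i : ℝ) / (q : ℝ) ^ l ≤ x i ∧ x i < ((m i : ℝ) + 1) / (q : ℝ) ^ l :=
      fun i => hx i (Set.mem_univ i)
    exact ⟨binOf_eq_of_mem_Ico hq hm hx', bin_subset_cube hq hm
      fun i => ⟨(hx' i).1, (hx' i).2.le⟩⟩
  have h3 : ({x | binOf q l x = m} ∩ cube d : Set (Fin d → ℝ)) ⊆ bin q l m :=
    fun x hx => binOf_mem_bin hq hx.2 hx.1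
  exact (Filter.EventuallyLE.antisymm (LE.le.eventuallyLE h3)
    (h1.symm.le.trans (LE.le.eventuallyLE h2)))

lemma volume_bin (q l : ℕ) (m : Fin d → ℕ) :
    volume.real (bin q l m) = (((q : ℝ) ^ l)⁻¹) ^ d := by
  rw [bin_eq_Icc, measureReal_def, Real.volume_Icc_pi_toReal]
  · rw [Finset.prod_congr rfl (g := fun _ => ((q : ℝ) ^ l)⁻¹)]
    · simp
    · intro i _
      rw [add_div, add_sub_cancel_left, one_div]
  · intro i
    simp only
    gcongr
    linarith

lemma norm_sub_le_of_mem_bin (hq : 1 ≤ q) {x u : Fin d → ℝ} (hx : x ∈ bin q l m)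
    (hu : u ∈ bin q l m) : ‖x - u‖ ≤ ((q : ℝ) ^ l)⁻¹ := by
  have hql : (0 : ℝ) < (q : ℝ) ^ l := by positivity
  rw [pi_norm_le_iff_of_nonneg (by positivity)]
  intro i
  have h1 := hx i
  have h2 := hu i
  have h3 : ((m i : ℝ) + 1) / (q : ℝ) ^ l = (m i : ℝ) / (q : ℝ) ^ l + ((q : ℝ) ^ l)⁻¹ := by
    rw [add_div, one_div]
  rw [h3] at h1 h2
  rw [Pi.sub_apply, Real.norm_eq_abs, abs_le]
  constructor <;> linarith

lemma measurable_kernel : Measurable (kernel (d := d)) := by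
  unfold kernel
  exact measurable_const.indicator (measurableSet_le measurable_norm measurable_const)

lemma kernel_nonneg (v : Fin d → ℝ) : 0 ≤ kernel v :=
  Set.indicator_nonneg (fun _ _ => zero_le_one) v

lemma kernel_le_one (v : Fin d → ℝ) : kernel v ≤ 1 :=
  Set.indicator_le_self' (fun _ _ => zero_le_one) v |>.trans le_rfl

lemma kernel_of_norm_le {v : Fin d → ℝ} (hv : ‖v‖ ≤ 1) : kernel v = 1 :=
  Set.indicator_of_mem (s := {v : Fin d → ℝ | ‖v‖ ≤ 1}) hv _

lemma kernel_of_lt_norm {v : Fin d → ℝ} (hv : 1 < ‖v‖) : kernel v = 0 :=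
  Set.indicator_of_notMem (s := {v : Fin d → ℝ | ‖v‖ ≤ 1}) (not_le.2 hv) _

lemma kernel_sq (v : Fin d → ℝ) : kernel v ^ 2 = kernel v := by
  by_cases hv : ‖v‖ ≤ 1
  · simp [kernel_of_norm_le hv]
  · simp [kernel_of_lt_norm (not_le.1 hv)]

/-- A window of bandwidth `h` has volume at most `(2 h) ^ d`. -/
lemma integral_kernel_le {h : ℝ} (hh : 0 < h) (x : Fin d → ℝ) (S : Set (Fin d → ℝ)) :
    ∫ u in S, kernel (h⁻¹ • (u - x)) ≤ (2 * h) ^ d := by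
  have h1 : (fun u => kernel (h⁻¹ • (u - x))) =
      (Metric.closedBall x h).indicator fun _ => (1 : ℝ) := by
    funext u
    have h2 : ‖h⁻¹ • (u - x)‖ ≤ 1 ↔ u ∈ Metric.closedBall x h := by
      rw [norm_smul, norm_inv, Real.norm_of_nonneg hh.le, inv_mul_le_one₀ hh, mem_closedBall_iff_norm]
    by_cases hu : u ∈ Metric.closedBall x h
    · rw [Set.indicator_of_mem hu, kernel_of_norm_le (h2.2 hu)]
    · rw [Set.indicator_of_notMem hu, kernel_of_lt_norm (not_le.1 fun h => hu (h2.1 h))]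
  rw [h1]
  have hi : Integrable ((Metric.closedBall x h).indicator fun _ => (1 : ℝ)) :=
    (integrable_indicator_iff measurableSet_closedBall).2
      (integrableOn_const (isCompact_closedBall x h).measure_ne_top)
  calc _ ≤ ∫ u, (Metric.closedBall x h).indicator (fun _ => (1 : ℝ)) u :=
        setIntegral_le_integral hi (Filter.Eventually.of_forall fun u =>
          Set.indicator_nonneg (fun _ _ => zero_le_one) u)
    _ = (2 * h) ^ d := by
        rw [integral_indicator_const _ measurableSet_closedBall, measureReal_def,
          Real.volume_pi_closedBall x hh.le, ENNReal.toReal_ofReal (by positivity)]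
        simp

/-- Norm equivalence on the polynomials of degree at most `p`, at the scale of a window of
bandwidth at most the side of the hypercube: the window of a point of the hypercube contains a cube
of side `h / 2` with a corner at this point. -/
lemma exists_window_lower (d p : ℕ) : ∃ lam : ℝ, 0 < lam ∧ ∀ (q l : ℕ) (m : Fin d → ℕ), 1 ≤ q →
    ∀ x ∈ bin q l m, ∀ h : ℝ, 0 < h → h ≤ ((q : ℝ) ^ l)⁻¹ → ∀ c : multiIdx d p → ℝ,
      lam * h ^ d * ∑ α, c α ^ 2 ≤
        ∫ u in bin q l m, lin c (h⁻¹ • (u - x)) ^ 2 * kernel (h⁻¹ • (u - x)) := by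
  classical
  obtain ⟨lam, hlam, hlow⟩ := exists_cornerCube_lower d p
  refine ⟨lam, hlam, fun q l m hq x hx h hh hhl c => ?_⟩
  have hql : (0 : ℝ) < (q : ℝ) ^ l := by positivity
  set mid : Fin d → ℝ := fun i => (m i : ℝ) / (q : ℝ) ^ l + ((q : ℝ) ^ l)⁻¹ / 2 with hmid
  set ε : Fin d → Bool := fun i => decide (x i ≤ mid i) with hε
  set G : (Fin d → ℝ) → ℝ := (cornerCube ε).indicator fun v => lin c v ^ 2 with hG
  have hGint : ∫ v, G v = ∫ v in cornerCube ε, lin c v ^ 2 :=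
    integral_indicator (isCompact_cornerCube ε).measurableSet
  have hscale : ∫ u, G (h⁻¹ • (u - x)) = h ^ d * ∫ v, G v := by
    rw [integral_sub_right_eq_self (fun u => G (h⁻¹ • u)) x,
      Measure.integral_comp_inv_smul_of_nonneg _ _ hh.le]
    simp
  have hsub : ∀ u, h⁻¹ • (u - x) ∈ cornerCube ε → u ∈ bin q l m ∧ ‖h⁻¹ • (u - x)‖ ≤ 1 := by
    intro u hu
    have hu' : ∀ i, h⁻¹ * (u i - x i) ∈
        (if ε i then Set.Icc (0 : ℝ) (1 / 2) else Set.Icc (-(1 / 2)) 0) :=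
      fun i => hu i (Set.mem_univ i)
    constructor
    · intro i
      have hxi := hx i
      have h3 : ((m i : ℝ) + 1) / (q : ℝ) ^ l = (m i : ℝ) / (q : ℝ) ^ l + ((q : ℝ) ^ l)⁻¹ := by
        rw [add_div, one_div]
      rw [h3] at hxi ⊢
      have hui := hu' i
      have hueq : u i - x i = h * (h⁻¹ * (u i - x i)) := by field_simp
      by_cases hle : x i ≤ mid i
      · simp only [hε, hle, decide_true, if_true, Set.mem_Icc] at hui
        have e1 := mul_le_mul_of_nonneg_left hui.1 hh.le
        have e2 := mul_le_mul_of_nonneg_left hui.2 hh.le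
        rw [← hueq] at e1 e2
        simp only [hmid] at hle
        constructor <;> linarith
      · simp only [hε, hle, decide_false, Bool.false_eq_true, if_false, Set.mem_Icc] at hui
        have e1 := mul_le_mul_of_nonneg_left hui.1 hh.le
        have e2 := mul_le_mul_of_nonneg_left hui.2 hh.le
        rw [← hueq] at e1 e2
        simp only [hmid, not_le] at hle
        constructor <;> linarith
    · rw [pi_norm_le_iff_of_nonneg zero_le_one]
      intro i
      have hui := hu' i
      rw [Pi.smul_apply, Pi.sub_apply, smul_eq_mul, Real.norm_eq_abs, abs_le]
      split_ifs at hui <;> constructor <;> linarith [hui.1, hui.2]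
  have hcont : Continuous fun u => lin c (h⁻¹ • (u - x)) ^ 2 :=
    ((continuous_lin c).comp (by fun_prop)).pow 2
  have hint : IntegrableOn (fun u => lin c (h⁻¹ • (u - x)) ^ 2 * kernel (h⁻¹ • (u - x)))
      (bin q l m) := by
    refine (hcont.continuousOn.integrableOn_compact (isCompact_bin q l m)).mul_bdd (c := 1) ?_ ?_
    · exact (measurable_kernel.comp (by fun_prop)).aestronglyMeasurable
    · refine Filter.Eventually.of_forall fun u => ?_
      rw [Real.norm_of_nonneg (kernel_nonneg _)]
      exact kernel_le_one _
  calc lam * h ^ d * ∑ α, c α ^ 2 = h ^ d * (lam * ∑ α, c α ^ 2) := by ring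
    _ ≤ h ^ d * ∫ v, G v := by rw [hGint]; gcongr; exact hlow ε c
    _ = ∫ u, G (h⁻¹ • (u - x)) := hscale.symm
    _ ≤ ∫ u, (bin q l m).indicator
          (fun u => lin c (h⁻¹ • (u - x)) ^ 2 * kernel (h⁻¹ • (u - x))) u := by
        refine integral_mono_of_nonneg (Filter.Eventually.of_forall fun u =>
          Set.indicator_nonneg (fun _ _ => sq_nonneg _) _)
          ((integrable_indicator_iff (measurableSet_bin q l m)).2 hint)
          (Filter.Eventually.of_forall fun u => ?_)
        simp only [hG]
        by_cases hu : h⁻¹ • (u - x) ∈ cornerCube ε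
        · rw [Set.indicator_of_mem hu, Set.indicator_of_mem (hsub u hu).1,
            kernel_of_norm_le (hsub u hu).2, mul_one]
        · rw [Set.indicator_of_notMem hu]
          exact Set.indicator_nonneg (fun _ _ => mul_nonneg (sq_nonneg _) (kernel_nonneg _)) _
    _ = _ := integral_indicator (measurableSet_bin q l m)

end Bins

/-! ### The law of the covariates in a hypercube -/

section Law

variable {d q l : ℕ} {m : Fin d → ℕ} {ρlo ρhi : ℝ} {pX : (Fin d → ℝ) → ℝ}

lemma integrableOn_density (hpX : BoundedDensity ρlo ρhi pX) (hρlo : 0 < ρlo) (hq : 1 ≤ q)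
    (hm : m ∈ bins d q l) {F : (Fin d → ℝ) → ℝ} (hF : IntegrableOn F (bin q l m)) :
    IntegrableOn (fun u => F u * pX u) (bin q l m) := by
  refine hF.mul_bdd (c := ρhi) hpX.1.aestronglyMeasurable ?_
  filter_upwards [ae_restrict_mem (measurableSet_bin q l m)] with u hu
  have := hpX.2 u (bin_subset_cube hq hm hu)
  rw [Real.norm_of_nonneg (hρlo.le.trans this.1)]
  exact this.2

lemma integrableOn_one_bin : IntegrableOn (fun _ : Fin d → ℝ => (1 : ℝ)) (bin q l m) :=
  integrableOn_const (isCompact_bin q l m).measure_ne_top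

lemma le_integral_density (hpX : BoundedDensity ρlo ρhi pX) (hρlo : 0 < ρlo) (hq : 1 ≤ q)
    (hm : m ∈ bins d q l) {F : (Fin d → ℝ) → ℝ} (hF : IntegrableOn F (bin q l m))
    (hF0 : ∀ u ∈ bin q l m, 0 ≤ F u) :
    ρlo * ∫ u in bin q l m, F u ≤ ∫ u in bin q l m, F u * pX u := by
  rw [← integral_const_mul]
  refine setIntegral_mono_on (hF.const_mul _) (integrableOn_density hpX hρlo hq hm hF)
    (measurableSet_bin q l m) fun u hu => ?_
  rw [mul_comm]
  exact mul_le_mul_of_nonneg_left (hpX.2 u (bin_subset_cube hq hm hu)).1 (hF0 u hu)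

lemma integral_density_le (hpX : BoundedDensity ρlo ρhi pX) (hρlo : 0 < ρlo) (hq : 1 ≤ q)
    (hm : m ∈ bins d q l) {F : (Fin d → ℝ) → ℝ} (hF : IntegrableOn F (bin q l m))
    (hF0 : ∀ u ∈ bin q l m, 0 ≤ F u) :
    ∫ u in bin q l m, F u * pX u ≤ ρhi * ∫ u in bin q l m, F u := by
  rw [← integral_const_mul]
  refine setIntegral_mono_on (integrableOn_density hpX hρlo hq hm hF) (hF.const_mul _)
    (measurableSet_bin q l m) fun u hu => ?_
  rw [mul_comm ρhi]
  exact mul_le_mul_of_nonneg_left (hpX.2 u (bin_subset_cube hq hm hu)).2 (hF0 u hu)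

lemma le_mass (hpX : BoundedDensity ρlo ρhi pX) (hρlo : 0 < ρlo) (hq : 1 ≤ q)
    (hm : m ∈ bins d q l) : ρlo * (((q : ℝ) ^ l)⁻¹) ^ d ≤ ∫ u in bin q l m, pX u := by
  have := le_integral_density hpX hρlo hq hm integrableOn_one_bin fun _ _ => zero_le_one
  simpa [volume_bin] using this

lemma mass_le (hpX : BoundedDensity ρlo ρhi pX) (hρlo : 0 < ρlo) (hq : 1 ≤ q)
    (hm : m ∈ bins d q l) : ∫ u in bin q l m, pX u ≤ ρhi * (((q : ℝ) ^ l)⁻¹) ^ d := by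
  have := integral_density_le hpX hρlo hq hm integrableOn_one_bin fun _ _ => zero_le_one
  simpa [volume_bin] using this

lemma measurableSet_cube : MeasurableSet (cube d) := measurableSet_Icc

variable {Ω : Type*} [MeasurableSpace Ω] {P : Measure Ω}
  {f : Fin 2 → (Fin d → ℝ) → ℝ} {X : ℕ → Ω → Fin d → ℝ} {Y : ℕ → Ω → Fin 2 → ℝ}

lemma ae_mem_cube (hM : IsModel P pX f X Y) (t : ℕ) : ∀ᵐ ω ∂P, X t ω ∈ cube d := by
  have h1 : ∀ᵐ u ∂(P.map (X t)), u ∈ cube d := by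
    rw [hM.law_X t]
    exact (withDensity_absolutelyContinuous _ _).ae_le (ae_restrict_mem measurableSet_cube)
  exact ae_of_ae_map (hM.measurable_X t).aemeasurable h1

lemma aestronglyMeasurable_law (hM : IsModel P pX f X Y) (t : ℕ) {F : (Fin d → ℝ) → ℝ}
    (hF : AEStronglyMeasurable F (volume.restrict (cube d))) :
    AEStronglyMeasurable F (P.map (X t)) := by
  rw [hM.law_X t]
  exact hF.mono_ac (withDensity_absolutelyContinuous _ _)

/-- Expectations on the event that the context falls in a hypercube. -/
lemma integral_binOf (hpX : BoundedDensity ρlo ρhi pX) (hρlo : 0 < ρlo) (hM : IsModel P pX f X Y)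
    (hq : 1 ≤ q) (hm : m ∈ bins d q l) (t : ℕ) {F : (Fin d → ℝ) → ℝ}
    (hF : AEStronglyMeasurable F (volume.restrict (cube d))) :
    ∫ ω in {ω | binOf q l (X t ω) = m}, F (X t ω) ∂P = ∫ u in bin q l m, F u * pX u := by
  have h1 := setIntegral_map (μ := P) (measurableSet_binOf q l m)
    (aestronglyMeasurable_law hM t hF) (hM.measurable_X t).aemeasurable
  have h2 : X t ⁻¹' {x | binOf q l x = m} = {ω | binOf q l (X t ω) = m} := rfl
  rw [h2] at h1
  rw [← h1, hM.law_X t, restrict_withDensity (measurableSet_binOf q l m),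
    Measure.restrict_restrict (measurableSet_binOf q l m),
    Measure.restrict_congr_set (binOf_inter_cube_ae_eq hq hm),
    integral_withDensity_eq_integral_toReal_smul hpX.1.ennreal_ofReal
      (Filter.Eventually.of_forall fun _ => ENNReal.ofReal_lt_top)]
  refine setIntegral_congr_fun (measurableSet_bin q l m) fun u hu => ?_
  have := hpX.2 u (bin_subset_cube hq hm hu)
  simp only [smul_eq_mul]
  rw [ENNReal.toReal_ofReal (hρlo.le.trans this.1), mul_comm]

lemma measure_binOf (hpX : BoundedDensity ρlo ρhi pX) (hρlo : 0 < ρlo) (hM : IsModel P pX f X Y)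
    (hq : 1 ≤ q) (hm : m ∈ bins d q l) (t : ℕ) :
    P.real {ω | binOf q l (X t ω) = m} = ∫ u in bin q l m, pX u := by
  have := integral_binOf hpX hρlo hM hq hm t (F := fun _ => 1) aestronglyMeasurable_const
  simpa using this

variable [IsProbabilityMeasure P]

lemma integrable_reward (hM : IsModel P pX f X Y) (t : ℕ) (k : Fin 2) :
    Integrable (fun ω => Y t ω k) P := by
  refine Integrable.of_bound ((measurable_pi_apply k).comp (hM.measurable_Y t)).aestronglyMeasurable
    1 ?_
  filter_upwards [hM.binary t] with ω hω
  rcases hω k with h | h <;> simp [h]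

/-- Weighted expectations of the rewards on the event that the context falls in a hypercube. -/
lemma integral_reward_binOf (hpX : BoundedDensity ρlo ρhi pX) (hρlo : 0 < ρlo)
    (hM : IsModel P pX f X Y) (hq : 1 ≤ q) (hm : m ∈ bins d q l) (t : ℕ) (k : Fin 2)
    (hf : AEStronglyMeasurable (f k) (volume.restrict (cube d)))
    {φ : (Fin d → ℝ) → ℝ} (hφ : Measurable φ) {C : ℝ} (hC : ∀ u, |φ u| ≤ C) :
    ∫ ω in {ω | binOf q l (X t ω) = m}, φ (X t ω) * Y t ω k ∂P =
      ∫ u in bin q l m, φ u * f k u * pX u := by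
  have hXm := hM.measurable_X t
  have hle : MeasurableSpace.comap (X t) inferInstance ≤ ‹MeasurableSpace Ω› := hXm.comap_le
  have hφX : Measurable fun ω => φ (X t ω) := hφ.comp hXm
  have hint : Integrable (fun ω => φ (X t ω) * Y t ω k) P :=
    (integrable_reward hM t k).bdd_mul (c := C) hφX.aestronglyMeasurable
      (Filter.Eventually.of_forall fun ω => hC _)
  have hBm : MeasurableSet[MeasurableSpace.comap (X t) inferInstance]
      {ω | binOf q l (X t ω) = m} := ⟨_, measurableSet_binOf q l m, rfl⟩
  have h1 : P[fun ω => φ (X t ω) * Y t ω k | MeasurableSpace.comap (X t) inferInstance] =ᵐ[P]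
      fun ω => φ (X t ω) * f k (X t ω) := by
    have h2 := condExp_mul_of_stronglyMeasurable_left (μ := P)
      (m := MeasurableSpace.comap (X t) inferInstance) (f := fun ω => φ (X t ω))
      (g := fun ω => Y t ω k)
      ((hφ.comp (comap_measurable (X t))).stronglyMeasurable) hint (integrable_reward hM t k)
    refine h2.trans ?_
    filter_upwards [hM.regression t k] with ω hω
    simp only [Pi.mul_apply, hω]
  rw [← setIntegral_condExp hle hint hBm,
    setIntegral_congr_ae (g := fun ω => φ (X t ω) * f k (X t ω)) (hle _ hBm)
      (h1.mono fun ω hω _ => hω)]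
  exact integral_binOf hpX hρlo hM hq hm t (F := fun u => φ u * f k u)
    (hφ.aestronglyMeasurable.mul hf)

/-- The payoff functions take values in `[0,1]`, by continuity. -/
lemma payoff_mem_Icc (hpX : BoundedDensity ρlo ρhi pX) (hρlo : 0 < ρlo)
    (hM : IsModel P pX f X Y) (k : Fin 2) (hf : ContinuousOn (f k) (cube d)) :
    ∀ u ∈ cube d, f k u ∈ Set.Icc (0 : ℝ) 1 := by
  have hle : MeasurableSpace.comap (X 0) inferInstance ≤ ‹MeasurableSpace Ω› :=
    (hM.measurable_X 0).comap_le
  have hfm : AEStronglyMeasurable (f k) (volume.restrict (cube d)) :=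
    hf.aestronglyMeasurable measurableSet_cube
  have h1 : ∀ᵐ ω ∂P, f k (X 0 ω) ∈ Set.Icc (0 : ℝ) 1 := by
    have h2 : (0 : Ω → ℝ) ≤ᵐ[P]
        P[fun ω => Y 0 ω k | MeasurableSpace.comap (X 0) inferInstance] := by
      refine condExp_nonneg ?_
      filter_upwards [hM.binary 0] with ω hω
      rcases hω k with h | h <;> simp [h]
    have h3 : P[fun ω => Y 0 ω k | MeasurableSpace.comap (X 0) inferInstance] ≤ᵐ[P]
        P[fun _ => (1 : ℝ) | MeasurableSpace.comap (X 0) inferInstance] := by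
      refine condExp_mono (integrable_reward hM 0 k) (integrable_const 1) ?_
      filter_upwards [hM.binary 0] with ω hω
      rcases hω k with h | h <;> simp [h]
    rw [condExp_const hle] at h3
    filter_upwards [h2, h3, hM.regression 0 k] with ω e1 e2 e3
    rw [e3] at e1 e2
    exact ⟨e1, e2⟩
  have h4 : ∀ᵐ u ∂(volume.restrict (cube d)), f k u ∈ Set.Icc (0 : ℝ) 1 := by
    have h5 : ∀ᵐ u ∂(P.map (X 0)), f k u ∈ Set.Icc (0 : ℝ) 1 := by
      have hnull := (aestronglyMeasurable_law hM 0 hfm).aemeasurable.nullMeasurable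
        (measurableSet_Icc (a := (0 : ℝ)) (b := 1)).compl
      have hmap := Measure.map_apply₀ (hM.measurable_X 0).aemeasurable hnull
      rw [ae_iff]
      exact hmap.trans (ae_iff.1 h1)
    rw [hM.law_X 0, ae_withDensity_iff hpX.1.ennreal_ofReal] at h5
    filter_upwards [h5, ae_restrict_mem measurableSet_cube] with u e1 e2
    refine e1 ?_
    have := (hpX.2 u e2).1
    simp only [ne_eq, ENNReal.ofReal_eq_zero, not_le]
    exact hρlo.trans_le this
  by_contra! hcon
  obtain ⟨u, hu, hu'⟩ := hcon
  obtain ⟨U, hU, hUeq⟩ := continuousOn_iff'.1 hf (Set.Icc (0 : ℝ) 1)ᶜ isClosed_Icc.isOpen_compl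
  have hint : (interior (cube d)).Nonempty := by
    refine ⟨fun _ => 1 / 2, ?_⟩
    rw [cube, ← Set.pi_univ_Icc, interior_pi_set Set.finite_univ]
    intro i _
    simp only [Pi.zero_apply, Pi.one_apply, interior_Icc]
    norm_num
  have huc : u ∈ closure (interior (cube d)) := by
    have hconv : Convex ℝ (cube d) := convex_Icc 0 1
    rw [hconv.closure_interior_eq_closure_of_nonempty_interior hint]
    exact subset_closure hu
  have huU : u ∈ U := by
    have : u ∈ f k ⁻¹' (Set.Icc (0 : ℝ) 1)ᶜ ∩ cube d := ⟨hu', hu⟩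
    rw [hUeq] at this
    exact this.1
  have hne : (U ∩ interior (cube d)).Nonempty := mem_closure_iff.1 huc U hU huU
  have hpos := (hU.inter isOpen_interior).measure_pos (volume : Measure (Fin d → ℝ)) hne
  have hzero : volume (U ∩ cube d) = 0 := by
    rw [← hUeq]
    rw [ae_restrict_iff' measurableSet_cube] at h4
    refine measure_mono_null ?_ (ae_iff.1 h4)
    rintro v ⟨hv1, hv2⟩
    simp only [Set.mem_ofPred_eq, not_forall]
    exact ⟨hv2, hv1⟩
  exact absurd (measure_mono_null (Set.inter_subset_inter_right U interior_subset) hzero) hpos.ne'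

end Law

/-! ### Concentration of the local polynomial estimator -/

section Concentration

variable {d p : ℕ} {ρlo ρhi : ℝ} {pX : (Fin d → ℝ) → ℝ}
  {Ω : Type*} [MeasurableSpace Ω] {P : Measure Ω} [IsProbabilityMeasure P]
  {f : Fin 2 → (Fin d → ℝ) → ℝ} {X : ℕ → Ω → Fin d → ℝ} {Y : ℕ → Ω → Fin 2 → ℝ}

/-- A two-sided Bernstein inequality for the sum of `g` over the samples of a completed round. The
conditional mean of `g` given the hypercube is `μ` up to `ε`, its conditional second moment is at
most `v`. -/
lemma measure_abs_sample_sum_ge_le (a : Params) (hq : 1 ≤ a.q) (hM : IsModel P pX f X Y)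
    (m : Fin d → ℕ) {r : ℕ} (hr : 1 ≤ r) (k : Fin 2) {g : (Fin d → ℝ) × ℝ → ℝ} (hg : Measurable g)
    {μ ε v σ : ℝ} (hv : 0 < v) (hσ : 0 ≤ σ) (hσv : σ ≤ 2 * v)
    (hb : ∀ t, ∀ᵐ ω ∂P, binOf a.q (a.level d) (X t ω) = m → |g (X t ω, Y t ω k)| ≤ 1)
    (h1 : ∀ t, |∫ ω in {ω | binOf a.q (a.level d) (X t ω) = m}, g (X t ω, Y t ω k) ∂P -
      μ * P.real {ω | binOf a.q (a.level d) (X t ω) = m}| ≤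
        ε * P.real {ω | binOf a.q (a.level d) (X t ω) = m})
    (h2 : ∀ t, ∫ ω in {ω | binOf a.q (a.level d) (X t ω) = m}, g (X t ω, Y t ω k) ^ 2 ∂P ≤
      v * P.real {ω | binOf a.q (a.level d) (X t ω) = m}) (n : ℕ) :
    P {ω | r < a.roundAt (fun s => X s ω) m n ∧ (a.q : ℝ) ^ r * (ε + σ) ≤
        |((a.sample (fun s => X s ω) (fun s => Y s ω) m r k n).map g).sum - (a.q : ℝ) ^ r * μ|} ≤
      ENNReal.ofReal (2 * Real.exp (-((a.q : ℝ) ^ r * (σ ^ 2 / (4 * v))))) := by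
  have e1 := measure_sample_sum_ge_le a hq hM.measurable_X hM.measurable_Y hM.indep m hr k hg
    (μ := μ + ε) hv hσ hσv hb (fun t => by have := (abs_le.1 (h1 t)).2; linarith) h2 n
  have e2 := measure_sample_sum_ge_le a hq hM.measurable_X hM.measurable_Y hM.indep m hr k
    (g := fun z => -g z) hg.neg (μ := -μ + ε) hv hσ hσv (by simpa using hb)
    (fun t => by rw [integral_neg]; have := (abs_le.1 (h1 t)).1; linarith)
    (by simpa using h2) n
  rw [two_mul, ENNReal.ofReal_add (Real.exp_nonneg _) (Real.exp_nonneg _)]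
  refine (measure_mono ?_).trans ((measure_union_le _ _).trans (add_le_add e1 e2))
  rintro ω ⟨hω1, hω2⟩
  rcases le_abs.1 hω2 with h | h
  · left
    exact ⟨hω1, by linarith⟩
  · right
    refine ⟨hω1, ?_⟩
    have h3 : ((a.sample (fun s => X s ω) (fun s => Y s ω) m r k n).map fun z => -g z).sum =
        -((a.sample (fun s => X s ω) (fun s => Y s ω) m r k n).map g).sum := by
      have := list_sum_mul (a.sample (fun s => X s ω) (fun s => Y s ω) m r k n) (-1) g
      simpa using this
    rw [h3]
    linarith

lemma abs_feat_mul_kernel_le (α : Fin d →₀ ℕ) (v : Fin d → ℝ) :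
    |feat α v * kernel v| ≤ kernel v := by
  by_cases hv : ‖v‖ ≤ 1
  · rw [kernel_of_norm_le hv, mul_one]; exact abs_feat_le_one α hv
  · simp [kernel_of_lt_norm (not_le.1 hv)]

lemma measurable_window (h : ℝ) (x : Fin d → ℝ) :
    Measurable fun u : Fin d → ℝ => h⁻¹ • (u - x) := by fun_prop

/-- Outside an event of small probability, the local polynomial estimator from the samples of a
completed round is close to the (truncated) value at `x` of any polynomial such that the means of
the moments of its residuals are small. Here `w` is the order of the conditional probability of the
window. -/
theorem measure_lpr_le (a : Params) (hq : 1 ≤ a.q) (hpX : BoundedDensity ρlo ρhi pX)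
    (hρlo : 0 < ρlo) (hM : IsModel P pX f X Y) {m : Fin d → ℕ}
    (hm : m ∈ bins d a.q (a.level d)) {r : ℕ} (hr : 1 ≤ r) (k : Fin 2)
    (hf : AEStronglyMeasurable (f k) (volume.restrict (cube d)))
    {x : Fin d → ℝ} {h : ℝ} (hh : 0 < h) (e : multiIdx d p → ℝ) {C₀ lam κ w δ ε s : ℝ}
    (hC₀ : 0 < C₀) (hlam : 0 < lam) (hκ : 0 < κ) (hw : 0 < w) (hδ : 0 ≤ δ) (hδκ : δ ≤ 2 * κ)
    (hδlam : δ * Fintype.card (multiIdx d p) ≤ lam / 2) (hs : 0 ≤ s) (hs1 : s ≤ 1)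
    (hup : ∫ u in bin a.q (a.level d) m, kernel (h⁻¹ • (u - x)) * pX u ≤
      κ * w * ∫ u in bin a.q (a.level d) m, pX u)
    (hlow : ∀ c : multiIdx d p → ℝ, lam * w * (∫ u in bin a.q (a.level d) m, pX u) * ∑ α, c α ^ 2 ≤
      ∫ u in bin a.q (a.level d) m, lin c (h⁻¹ • (u - x)) ^ 2 * kernel (h⁻¹ • (u - x)) * pX u)
    (hbd : ∀ u ∈ bin a.q (a.level d) m, ‖h⁻¹ • (u - x)‖ ≤ 1 →
      1 + |lin e (h⁻¹ • (u - x))| ≤ C₀)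
    (hbias : ∀ α : multiIdx d p, |∫ u in bin a.q (a.level d) m, feat α.1 (h⁻¹ • (u - x)) *
      kernel (h⁻¹ • (u - x)) * (f k u - lin e (h⁻¹ • (u - x))) * pX u| ≤
        ε * w * ∫ u in bin a.q (a.level d) m, pX u)
    (hfi : IntegrableOn (f k) (bin a.q (a.level d) m)) (n : ℕ) :
    P {ω | r < a.roundAt (fun s => X s ω) m n ∧
        2 * Fintype.card (multiIdx d p) / lam * (ε + 2 * κ * C₀ * s) <
        |lpr (a.sample (fun s => X s ω) (fun s => Y s ω) m r k n) h p x - trunc (lin e 0)|} ≤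
      ENNReal.ofReal (Fintype.card (multiIdx d p) ^ 2 *
          (2 * Real.exp (-((a.q : ℝ) ^ r * (w * (δ ^ 2 / (4 * κ)))))) +
        Fintype.card (multiIdx d p) * (2 * Real.exp (-((a.q : ℝ) ^ r * (w * (κ * s ^ 2)))))) := by
  classical
  set N : ℕ := Fintype.card (multiIdx d p) with hN
  set q := a.q with hqdef
  set l := a.level d with hldef
  set p₀ : ℝ := ∫ u in bin q l m, pX u with hp₀
  have hp₀pos : 0 < p₀ := by
    refine lt_of_lt_of_le ?_ (le_mass hpX hρlo hq hm)
    have : (0 : ℝ) < q := by exact_mod_cast hq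
    positivity
  have hPB : ∀ t, P.real {ω | binOf q l (X t ω) = m} = p₀ := measure_binOf hpX hρlo hM hq hm
  set D : Ω → List ((Fin d → ℝ) × ℝ) :=
    fun ω => a.sample (fun s => X s ω) (fun s => Y s ω) m r k n with hD
  -- the window function and its second moment
  set K : (Fin d → ℝ) → ℝ := fun u => kernel (h⁻¹ • (u - x)) with hK
  have hKm : Measurable K := measurable_kernel.comp (measurable_window h x)
  have hFm : ∀ α : multiIdx d p, Measurable fun u : Fin d → ℝ => feat α.1 (h⁻¹ • (u - x)) :=
    fun α => (continuous_feat α.1).measurable.comp (measurable_window h x)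
  have hKω : ∀ t, ∫ ω in {ω | binOf q l (X t ω) = m}, K (X t ω) ∂P ≤ κ * w * p₀ := fun t => by
    rw [integral_binOf hpX hρlo hM hq hm t hKm.aestronglyMeasurable]; exact hup
  have hsecond : ∀ (g : (Fin d → ℝ) × ℝ → ℝ), Measurable g → (∀ t, ∀ᵐ ω ∂P,
      binOf q l (X t ω) = m → |g (X t ω, Y t ω k)| ≤ K (X t ω)) → ∀ t,
      ∫ ω in {ω | binOf q l (X t ω) = m}, g (X t ω, Y t ω k) ^ 2 ∂P ≤
        κ * w * P.real {ω | binOf q l (X t ω) = m} := by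
    intro g hg hgb t
    rw [hPB]
    refine le_trans ?_ (hKω t)
    have hB : MeasurableSet {ω | binOf q l (X t ω) = m} :=
      hM.measurable_X t (measurableSet_binOf q l m)
    have hKi : Integrable (fun ω => K (X t ω)) (P.restrict {ω | binOf q l (X t ω) = m}) :=
      Integrable.of_bound (C := 1) (hKm.comp (hM.measurable_X t)).aestronglyMeasurable
        (Filter.Eventually.of_forall fun ω => by
          rw [Real.norm_of_nonneg (kernel_nonneg _)]; exact kernel_le_one _)
    refine integral_mono_of_nonneg (Filter.Eventually.of_forall fun _ => sq_nonneg _) hKi ?_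
    refine (ae_restrict_iff' hB).2 ?_
    filter_upwards [hgb t] with ω hω hωB
    have h1 := hω hωB
    have h2 : K (X t ω) ^ 2 = K (X t ω) := kernel_sq _
    calc g (X t ω, Y t ω k) ^ 2 = |g (X t ω, Y t ω k)| ^ 2 := (sq_abs _).symm
      _ ≤ K (X t ω) ^ 2 := by gcongr
      _ = K (X t ω) := h2
  -- the Gram matrix
  set Mx : multiIdx d p → multiIdx d p → ℝ := fun α β =>
    (∫ u in bin q l m, feat α.1 (h⁻¹ • (u - x)) * feat β.1 (h⁻¹ • (u - x)) * K u * pX u) / p₀ with hMx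
  have hgb : ∀ (α β : multiIdx d p) (u : Fin d → ℝ),
      |feat α.1 (h⁻¹ • (u - x)) * feat β.1 (h⁻¹ • (u - x)) * K u| ≤ K u := by
    intro α β u
    by_cases hv : ‖h⁻¹ • (u - x)‖ ≤ 1
    · rw [abs_mul, abs_mul, abs_of_nonneg (kernel_nonneg _)]
      exact mul_le_of_le_one_left (kernel_nonneg _) (mul_le_one₀ (abs_feat_le_one _ hv)
        (abs_nonneg _) (abs_feat_le_one _ hv))
    · simp [hK, kernel_of_lt_norm (not_le.1 hv)]
  have hgm : ∀ α β : multiIdx d p, Measurable fun u : Fin d → ℝ =>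
      feat α.1 (h⁻¹ • (u - x)) * feat β.1 (h⁻¹ • (u - x)) * K u :=
    fun α β => ((hFm α).mul (hFm β)).mul hKm
  have hgramEvent : ∀ α β : multiIdx d p,
      P {ω | r < a.roundAt (fun s => X s ω) m n ∧ (q : ℝ) ^ r * (0 + δ * w) ≤
        |gram (D ω) h x α β - (q : ℝ) ^ r * Mx α β|} ≤
      ENNReal.ofReal (2 * Real.exp (-((q : ℝ) ^ r * (w * (δ ^ 2 / (4 * κ)))))) := by
    intro α β
    have := measure_abs_sample_sum_ge_le a hq hM m hr k
      (g := fun z => feat α.1 (h⁻¹ • (z.1 - x)) * feat β.1 (h⁻¹ • (z.1 - x)) * K z.1)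
      ((hgm α β).comp measurable_fst) (μ := Mx α β) (ε := 0) (v := κ * w) (σ := δ * w)
      (by positivity) (by positivity) (by nlinarith)
      (fun t => Filter.Eventually.of_forall fun ω _ => (hgb α β _).trans (kernel_le_one _))
      (fun t => by
        have h1 := integral_binOf hpX hρlo hM hq hm t (hgm α β).aestronglyMeasurable
        rw [h1, hPB, hMx]
        simp only
        rw [div_mul_cancel₀ _ hp₀pos.ne', sub_self, abs_zero, zero_mul])
      (hsecond _ ((hgm α β).comp measurable_fst)
        fun t => Filter.Eventually.of_forall fun ω _ => hgb α β _) n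
    have he : (δ * w) ^ 2 / (4 * (κ * w)) = w * (δ ^ 2 / (4 * κ)) := by field_simp
    rw [he] at this
    exact this
  -- the residuals
  have hxi_bd : ∀ (α : multiIdx d p) (t : ℕ), ∀ᵐ ω ∂P, binOf q l (X t ω) = m →
      |C₀⁻¹ * (feat α.1 (h⁻¹ • (X t ω - x)) * K (X t ω) *
        (Y t ω k - lin e (h⁻¹ • (X t ω - x))))| ≤ K (X t ω) := by
    intro α t
    filter_upwards [hM.binary t, ae_mem_cube hM t] with ω hω1 hω2 hω3
    have hmem : X t ω ∈ bin q l m := binOf_mem_bin hq hω2 hω3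
    by_cases hv : ‖h⁻¹ • (X t ω - x)‖ ≤ 1
    · have h1 := hbd _ hmem hv
      have hY : |Y t ω k| ≤ 1 := by rcases hω1 k with h | h <;> simp [h]
      have h2 : |Y t ω k - lin e (h⁻¹ • (X t ω - x))| ≤ C₀ := (abs_sub _ _).trans (by linarith)
      rw [abs_mul, abs_mul, abs_of_nonneg (inv_nonneg.2 hC₀.le), inv_mul_le_iff₀ hC₀, mul_comm C₀]
      exact mul_le_mul (abs_feat_mul_kernel_le _ _) h2 (abs_nonneg _) (kernel_nonneg _)
    · simp [hK, kernel_of_lt_norm (not_le.1 hv)]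
  have hxi_m : ∀ α : multiIdx d p, Measurable fun z : (Fin d → ℝ) × ℝ =>
      C₀⁻¹ * (feat α.1 (h⁻¹ • (z.1 - x)) * K z.1 * (z.2 - lin e (h⁻¹ • (z.1 - x)))) := by
    intro α
    have h1 : Measurable fun u : Fin d → ℝ => lin e (h⁻¹ • (u - x)) :=
      (continuous_lin e).measurable.comp (measurable_window h x)
    exact ((((hFm α).comp measurable_fst).mul (hKm.comp measurable_fst)).mul
      (measurable_snd.sub (h1.comp measurable_fst))).const_mul _
  have hlinm : Measurable fun u : Fin d → ℝ => lin e (h⁻¹ • (u - x)) :=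
    (continuous_lin e).measurable.comp (measurable_window h x)
  have hmean : ∀ (α : multiIdx d p) (t : ℕ),
      ∫ ω in {ω | binOf q l (X t ω) = m}, C₀⁻¹ * (feat α.1 (h⁻¹ • (X t ω - x)) * K (X t ω) *
        (Y t ω k - lin e (h⁻¹ • (X t ω - x)))) ∂P =
      C₀⁻¹ * ∫ u in bin q l m, feat α.1 (h⁻¹ • (u - x)) * K u * (f k u - lin e (h⁻¹ • (u - x))) *
        pX u := by
    intro α t
    set φ : (Fin d → ℝ) → ℝ := fun u => feat α.1 (h⁻¹ • (u - x)) * K u with hφ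
    have hφm : Measurable φ := (hFm α).mul hKm
    have hφ1 : ∀ u, |φ u| ≤ 1 := fun u => (abs_feat_mul_kernel_le _ _).trans (kernel_le_one _)
    have hφl : ∀ u, |φ u * lin e (h⁻¹ • (u - x))| ≤ ∑ β, |e β| := by
      intro u
      by_cases hv : ‖h⁻¹ • (u - x)‖ ≤ 1
      · rw [abs_mul]
        exact (mul_le_of_le_one_left (abs_nonneg _) (hφ1 u)).trans (abs_lin_le e hv)
      · simp only [hφ, hK, kernel_of_lt_norm (not_le.1 hv), mul_zero, zero_mul, abs_zero]
        exact Finset.sum_nonneg fun _ _ => abs_nonneg _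
    have hφli : IntegrableOn (fun u => φ u * lin e (h⁻¹ • (u - x))) (bin q l m) :=
      Measure.integrableOn_of_bounded (M := ∑ β, |e β|) (isCompact_bin q l m).measure_ne_top
        (hφm.mul hlinm).aestronglyMeasurable (Filter.Eventually.of_forall hφl)
    have hφfi : IntegrableOn (fun u => φ u * f k u) (bin q l m) :=
      hfi.bdd_mul (c := 1) hφm.aestronglyMeasurable (Filter.Eventually.of_forall hφ1)
    rw [integral_const_mul]
    congr 1
    have h1 : ∫ ω in {ω | binOf q l (X t ω) = m}, φ (X t ω) *
        (Y t ω k - lin e (h⁻¹ • (X t ω - x))) ∂P =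
        ∫ ω in {ω | binOf q l (X t ω) = m}, φ (X t ω) * Y t ω k ∂P -
        ∫ ω in {ω | binOf q l (X t ω) = m}, φ (X t ω) * lin e (h⁻¹ • (X t ω - x)) ∂P := by
      rw [← integral_sub]
      · simp_rw [mul_sub]
      · exact (((integrable_reward hM t k).bdd_mul (c := 1)
          (hφm.comp (hM.measurable_X t)).aestronglyMeasurable
          (Filter.Eventually.of_forall fun ω => hφ1 _))).integrableOn
      · exact Integrable.of_bound
          ((hφm.mul hlinm).comp (hM.measurable_X t)).aestronglyMeasurable _
          (Filter.Eventually.of_forall fun ω => hφl _)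
    have h3 : ∫ u in bin q l m, φ u * (f k u - lin e (h⁻¹ • (u - x))) * pX u =
        (∫ u in bin q l m, φ u * f k u * pX u) - ∫ u in bin q l m, φ u * lin e (h⁻¹ • (u - x)) * pX u := by
      refine Eq.trans ?_ (integral_sub (integrableOn_density hpX hρlo hq hm hφfi)
        (integrableOn_density hpX hρlo hq hm hφli))
      congr 1
      funext u
      ring
    rw [h1, h3, integral_reward_binOf hpX hρlo hM hq hm t k hf hφm hφ1,
      integral_binOf hpX hρlo hM hq hm t (F := fun u => φ u * lin e (h⁻¹ • (u - x)))
        (hφm.mul hlinm).aestronglyMeasurable]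
  have hresEvent : ∀ α : multiIdx d p,
      P {ω | r < a.roundAt (fun s => X s ω) m n ∧
        (q : ℝ) ^ r * (C₀⁻¹ * (ε * w) + 2 * (κ * w) * s) ≤
        |((D ω).map fun z => C₀⁻¹ * (feat α.1 (h⁻¹ • (z.1 - x)) * K z.1 *
          (z.2 - lin e (h⁻¹ • (z.1 - x))))).sum - (q : ℝ) ^ r * 0|} ≤
      ENNReal.ofReal (2 * Real.exp (-((q : ℝ) ^ r * (w * (κ * s ^ 2))))) := by
    intro α
    have := measure_abs_sample_sum_ge_le a hq hM m hr k
      (g := fun z => C₀⁻¹ * (feat α.1 (h⁻¹ • (z.1 - x)) * K z.1 *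
        (z.2 - lin e (h⁻¹ • (z.1 - x)))))
      (hxi_m α) (μ := 0) (ε := C₀⁻¹ * (ε * w)) (v := κ * w) (σ := 2 * (κ * w) * s)
      (by positivity) (by positivity) (by nlinarith [mul_pos hκ hw])
      (fun t => by
        filter_upwards [hxi_bd α t] with ω hω hωB
        exact (hω hωB).trans (kernel_le_one _))
      (fun t => by
        rw [hmean, hPB, zero_mul, sub_zero, abs_mul, abs_of_nonneg (inv_nonneg.2 hC₀.le), mul_assoc]
        exact mul_le_mul_of_nonneg_left (hbias α) (inv_nonneg.2 hC₀.le))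
      (hsecond _ (hxi_m α) (hxi_bd α)) n
    have he : (2 * (κ * w) * s) ^ 2 / (4 * (κ * w)) = w * (κ * s ^ 2) := by field_simp; ring
    rw [he] at this
    exact this
  -- the union bound
  have hqr : (0 : ℝ) < (q : ℝ) ^ r := by
    have : (0 : ℝ) < q := by exact_mod_cast hq
    positivity
  have hMlow : ∀ c : multiIdx d p → ℝ, (q : ℝ) ^ r * (lam * w) * ∑ α, c α ^ 2 ≤
      ∑ α, ∑ β, c α * c β * ((q : ℝ) ^ r * Mx α β) := by
    intro c
    have hgi : ∀ α β : multiIdx d p, IntegrableOn (fun u => feat α.1 (h⁻¹ • (u - x)) *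
        feat β.1 (h⁻¹ • (u - x)) * K u * pX u) (bin q l m) := fun α β =>
      integrableOn_density hpX hρlo hq hm (Measure.integrableOn_of_bounded (M := 1)
        (isCompact_bin q l m).measure_ne_top (hgm α β).aestronglyMeasurable
        (Filter.Eventually.of_forall fun u => (hgb α β u).trans (kernel_le_one _)))
    have h1 : ∫ u in bin q l m, lin c (h⁻¹ • (u - x)) ^ 2 * kernel (h⁻¹ • (u - x)) * pX u =
        ∑ α, ∑ β, c α * c β * ∫ u in bin q l m, feat α.1 (h⁻¹ • (u - x)) *
          feat β.1 (h⁻¹ • (u - x)) * K u * pX u := by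
      have h2 : ∀ u, lin c (h⁻¹ • (u - x)) ^ 2 * kernel (h⁻¹ • (u - x)) * pX u =
          ∑ α, ∑ β, c α * c β * (feat α.1 (h⁻¹ • (u - x)) *
          feat β.1 (h⁻¹ • (u - x)) * K u * pX u) := by
        intro u
        rw [sq_lin, mul_assoc, Finset.sum_mul]
        refine Finset.sum_congr rfl fun α _ => ?_
        rw [Finset.sum_mul]
        refine Finset.sum_congr rfl fun β _ => ?_
        simp only [hK]; ring
      simp_rw [h2]
      rw [integral_finsetSum _ fun α _ => integrable_finsetSum _ fun β _ =>
        (hgi α β).const_mul _]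
      refine Finset.sum_congr rfl fun α _ => ?_
      rw [integral_finsetSum _ fun β _ => (hgi α β).const_mul _]
      exact Finset.sum_congr rfl fun β _ => integral_const_mul _ _
    have h3 := hlow c
    rw [h1] at h3
    have h4 : ∑ α, ∑ β, c α * c β * ((q : ℝ) ^ r * Mx α β) = (q : ℝ) ^ r * ((∑ α, ∑ β, c α * c β *
        ∫ u in bin q l m, feat α.1 (h⁻¹ • (u - x)) * feat β.1 (h⁻¹ • (u - x)) * K u * pX u) / p₀) := by
      simp only [Finset.sum_div, Finset.mul_sum, hMx]
      refine Finset.sum_congr rfl fun α _ => Finset.sum_congr rfl fun β _ => ?_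
      ring
    rw [h4, mul_assoc]
    refine mul_le_mul_of_nonneg_left ?_ hqr.le
    rw [le_div_iff₀ hp₀pos]
    linarith
  have hsub : {ω | r < a.roundAt (fun s => X s ω) m n ∧ 2 * N / lam * (ε + 2 * κ * C₀ * s) <
        |lpr (D ω) h p x - trunc (lin e 0)|} ⊆
      (⋃ αβ : multiIdx d p × multiIdx d p, {ω | r < a.roundAt (fun s => X s ω) m n ∧
        (q : ℝ) ^ r * (0 + δ * w) ≤
        |gram (D ω) h x αβ.1 αβ.2 - (q : ℝ) ^ r * Mx αβ.1 αβ.2|}) ∪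
      ⋃ α : multiIdx d p, {ω | r < a.roundAt (fun s => X s ω) m n ∧
        (q : ℝ) ^ r * (C₀⁻¹ * (ε * w) + 2 * (κ * w) * s) ≤
        |((D ω).map fun z => C₀⁻¹ * (feat α.1 (h⁻¹ • (z.1 - x)) * K z.1 *
          (z.2 - lin e (h⁻¹ • (z.1 - x))))).sum - (q : ℝ) ^ r * 0|} := by
    rintro ω ⟨hω1, hω2⟩
    by_contra hcon
    simp only [Set.mem_union, Set.mem_iUnion, Set.mem_ofPred_eq, not_or, not_exists, not_and,
      not_le, Prod.forall] at hcon
    obtain ⟨c1, c2⟩ := hcon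
    refine absurd hω2 (not_lt.2 ?_)
    have hG := gram_lower (G := gram (D ω) h x) (M := fun α β => (q : ℝ) ^ r * Mx α β)
      (δ := (q : ℝ) ^ r * (δ * w)) (by positivity) hMlow
      (fun α β => by have := (c1 α β hω1).le; rwa [zero_add] at this)
    have hG' : ∀ c : multiIdx d p → ℝ, (q : ℝ) ^ r * w * (lam / 2) * ∑ α, c α ^ 2 ≤
        ∑ α, ∑ β, c α * c β * gram (D ω) h x α β := by
      intro c
      refine le_trans (mul_le_mul_of_nonneg_right ?_ (Finset.sum_nonneg fun _ _ => sq_nonneg _))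
        (hG c)
      have := mul_le_mul_of_nonneg_left hδlam (mul_pos hqr hw).le
      linarith
    have hR : ∀ α, |residual (D ω) h x e α| ≤
        (q : ℝ) ^ r * w * (ε + 2 * κ * C₀ * s) := by
      intro α
      have h1 := (c2 α hω1).le
      rw [mul_zero, sub_zero, list_sum_mul, abs_mul, abs_of_nonneg (inv_nonneg.2 hC₀.le),
        inv_mul_le_iff₀ hC₀] at h1
      refine h1.trans_eq ?_
      field_simp
    refine (abs_lpr_sub_le hh e (by positivity) hG' hR).trans_eq ?_
    rw [← hN]
    field_simp
  refine (measure_mono hsub).trans ((measure_union_le _ _).trans ?_)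
  rw [ENNReal.ofReal_add (by positivity) (by positivity)]
  refine add_le_add ((measure_iUnion_fintype_le _ _).trans ?_)
    ((measure_iUnion_fintype_le _ _).trans ?_)
  · refine (Finset.sum_le_sum fun αβ _ => hgramEvent αβ.1 αβ.2).trans_eq ?_
    rw [Finset.sum_const, Finset.card_univ, Fintype.card_prod, nsmul_eq_mul, ← hN,
      ENNReal.ofReal_mul (p := (N : ℝ) ^ 2) (by positivity), ENNReal.ofReal_pow (by positivity),
      ENNReal.ofReal_natCast]
    push_cast
    rw [← sq]
  · refine (Finset.sum_le_sum fun α _ => hresEvent α).trans_eq ?_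
    rw [Finset.sum_const, Finset.card_univ, nsmul_eq_mul, ← hN,
      ENNReal.ofReal_mul (p := (N : ℝ)) (by positivity), ENNReal.ofReal_natCast]

end Concentration

/-! ### Hölder functions and their projections -/

section Projection

variable {d p : ℕ} {β L : ℝ} {f : (Fin d → ℝ) → ℝ}

lemma IsHolder.continuousOn (hf : IsHolder β L f) : ContinuousOn f (cube d) :=
  hf.1.continuousOn

/-- The Taylor expansion of a Hölder function at `x`, in the coordinates `(u - x) / h`. -/
lemma IsHolder.exists_lin (hf : IsHolder β L f) (hβ : 0 < β) (hp : floorLt β ≤ p)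
    {x : Fin d → ℝ} (hx : x ∈ cube d) {h : ℝ} (hh : 0 < h) :
    ∃ e : multiIdx d p → ℝ, lin e 0 = f x ∧
      ∀ u ∈ cube d, |f u - lin e (h⁻¹ • (u - x))| ≤ L * ‖u - x‖ ^ β := by
  obtain ⟨e, he⟩ := exists_lin_taylor hp f x x h
  have h1 : ∀ u, lin e (h⁻¹ • (u - x)) = taylorPoly (floorLt β) f x u := by
    intro u
    rw [← he, smul_smul, mul_inv_cancel₀ hh.ne', one_smul, add_sub_cancel]
  refine ⟨e, ?_, fun u hu => ?_⟩
  · have h2 := hf.2 x hx x hx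
    have h3 := h1 x
    rw [sub_self, smul_zero] at h3
    rw [sub_self, norm_zero, Real.zero_rpow hβ.ne', mul_zero, ← h3] at h2
    have := abs_eq_zero.1 (le_antisymm h2 (abs_nonneg _))
    linarith
  · rw [h1, norm_sub_rev]
    exact hf.2 x hx u hu

lemma exists_poly_lin (c : multiIdx d p → ℝ) (h : ℝ) (x : Fin d → ℝ) :
    ∃ θ : MvPolynomial (Fin d) ℝ, θ.totalDegree ≤ p ∧
      ∀ u, MvPolynomial.eval u θ = lin c (h⁻¹ • (u - x)) := by
  refine ⟨_, (totalDegree_affine (polyOf h c) (-x) 1).trans (totalDegree_polyOf h c), fun u => ?_⟩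
  rw [← eval_polyOf, MvPolynomial.bind₁, MvPolynomial.aeval_def, MvPolynomial.eval_eval₂,
    MvPolynomial.eval₂_eq', MvPolynomial.eval_eq']
  simp [sub_eq_neg_add]

lemma exists_lin_poly {θ : MvPolynomial (Fin d) ℝ} (hθ : θ.totalDegree ≤ p) {h : ℝ} (hh : 0 < h)
    (x : Fin d → ℝ) :
    ∃ c : multiIdx d p → ℝ, ∀ u, MvPolynomial.eval u θ = lin c (h⁻¹ • (u - x)) := by
  obtain ⟨c, hc⟩ := exists_lin_affine hθ x h
  refine ⟨c, fun u => ?_⟩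
  rw [← hc, smul_smul, mul_inv_cancel₀ hh.ne', one_smul, add_sub_cancel]

lemma sum_abs_le_of_sum_sq_le {ι : Type*} [Fintype ι] {c : ι → ℝ} {B : ℝ} (hB : 0 ≤ B)
    (h : Fintype.card ι * ∑ i, c i ^ 2 ≤ B ^ 2) : ∑ i, |c i| ≤ B := by
  have h1 := sq_sum_le_card_mul_sum_sq (s := Finset.univ) (f := fun i => |c i|)
  simp only [sq_abs, Finset.card_univ] at h1
  exact abs_le_of_sq_le_sq' (h1.trans h) hB |>.2

/-- A modulus of continuity of Hölder functions with values in `[0,1]`. -/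
lemma exists_holder_modulus (d p : ℕ) {L : ℝ} (hL : 0 < L) : ∃ C : ℝ, 0 < C ∧
    ∀ (β : ℝ) (f : (Fin d → ℝ) → ℝ), 0 < β → floorLt β ≤ p → IsHolder β L f →
      (∀ u ∈ cube d, f u ∈ Set.Icc (0 : ℝ) 1) → ∀ x ∈ cube d, ∀ u ∈ cube d,
        |f u - f x| ≤ C * ‖u - x‖ + L * ‖u - x‖ ^ β := by
  obtain ⟨lam, hlam, hlow⟩ := exists_window_lower d p
  set N : ℕ := Fintype.card (multiIdx d p) with hN
  refine ⟨Real.sqrt (N * (1 + L) ^ 2 / lam) + 1, by positivity, fun β f hβ hp hf hf01 x hx u hu => ?_⟩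
  obtain ⟨e, he0, he⟩ := hf.exists_lin hβ hp hx one_pos
  have hcube : (bin 1 0 fun _ => 0 : Set (Fin d → ℝ)) = cube d := by
    ext v
    simp [bin, mem_cube]
  have hnorm : ∀ v ∈ cube d, ‖v - x‖ ≤ 1 := by
    intro v hv
    have := norm_sub_le_of_mem_bin (q := 1) (l := 0) (m := fun _ : Fin d => 0) le_rfl
      (x := v) (u := x) (by rwa [hcube]) (by rwa [hcube])
    simpa using this
  have hbd : ∀ v ∈ cube d, |lin e ((1 : ℝ)⁻¹ • (v - x))| ≤ 1 + L := by
    intro v hv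
    have h1 := he v hv
    have h2 := hf01 v hv
    have h3 : ‖v - x‖ ^ β ≤ 1 := Real.rpow_le_one (norm_nonneg _) (hnorm v hv) hβ.le
    have h4 : |f v| ≤ 1 := abs_le.2 ⟨by linarith [h2.1], h2.2⟩
    calc |lin e ((1 : ℝ)⁻¹ • (v - x))|
        = |f v - (f v - lin e ((1 : ℝ)⁻¹ • (v - x)))| := by rw [sub_sub_cancel]
      _ ≤ |f v| + |f v - lin e ((1 : ℝ)⁻¹ • (v - x))| := abs_sub _ _
      _ ≤ 1 + L := by nlinarith
  have h1 := hlow 1 0 (fun _ => 0) le_rfl x (by rwa [hcube]) 1 one_pos (by simp) e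
  rw [hcube, one_pow, mul_one] at h1
  have h2 : ∫ v in cube d, lin e ((1 : ℝ)⁻¹ • (v - x)) ^ 2 * kernel ((1 : ℝ)⁻¹ • (v - x)) ≤
      (1 + L) ^ 2 := by
    have h3 : ∫ v in cube d, (1 + L) ^ 2 = (1 + L) ^ 2 := by
      rw [setIntegral_const, ← hcube, volume_bin]
      simp
    rw [← h3]
    refine integral_mono_of_nonneg (Filter.Eventually.of_forall fun v =>
      mul_nonneg (sq_nonneg _) (kernel_nonneg _)) ?_ ?_
    · exact integrableOn_const isCompact_Icc.measure_ne_top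
    · filter_upwards [ae_restrict_mem measurableSet_cube] with v hv
      calc _ ≤ lin e ((1 : ℝ)⁻¹ • (v - x)) ^ 2 * 1 := by
            gcongr; exact kernel_le_one _
        _ = |lin e ((1 : ℝ)⁻¹ • (v - x))| ^ 2 := by rw [mul_one, sq_abs]
        _ ≤ (1 + L) ^ 2 := by gcongr; exact hbd v hv
  have h4 : ∑ α, |e α| ≤ Real.sqrt (N * (1 + L) ^ 2 / lam) := by
    refine sum_abs_le_of_sum_sq_le (Real.sqrt_nonneg _) ?_
    rw [Real.sq_sqrt (by positivity), mul_div_assoc]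
    refine mul_le_mul_of_nonneg_left ?_ (Nat.cast_nonneg _)
    rw [le_div_iff₀ hlam]
    linarith
  have h5 := he u hu
  have h6 := abs_lin_sub_le e (v := (1 : ℝ)⁻¹ • (u - x)) (by simpa using hnorm u hu)
  rw [he0] at h6
  have h7 : ‖(1 : ℝ)⁻¹ • (u - x)‖ = ‖u - x‖ := by simp
  rw [h7] at h6
  calc |f u - f x| = |(f u - lin e ((1 : ℝ)⁻¹ • (u - x))) +
        (lin e ((1 : ℝ)⁻¹ • (u - x)) - f x)| := by rw [sub_add_sub_cancel]
    _ ≤ L * ‖u - x‖ ^ β + (∑ α, |e α|) * ‖u - x‖ := (abs_add_le _ _).trans (add_le_add h5 h6)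
    _ ≤ L * ‖u - x‖ ^ β + (Real.sqrt (N * (1 + L) ^ 2 / lam) + 1) * ‖u - x‖ := by
        gcongr; linarith
    _ = _ := add_comm _ _

variable {q l : ℕ} {m : Fin d → ℕ} {ρlo ρhi : ℝ} {pX : (Fin d → ℝ) → ℝ}

/-- The normal equations of the projection of `f` on the polynomials of degree at most `p` over a
hypercube. -/
def IsOrthogonal (pX : (Fin d → ℝ) → ℝ) (U : Set (Fin d → ℝ)) (p : ℕ) (f : (Fin d → ℝ) → ℝ)
    (g : MvPolynomial (Fin d) ℝ) : Prop :=
  g.totalDegree ≤ p ∧ ∀ θ : MvPolynomial (Fin d) ℝ, θ.totalDegree ≤ p →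
    ∫ u in U, (f u - MvPolynomial.eval u g) * MvPolynomial.eval u θ * pX u = 0

/-- The bandwidth equals the side length of the hypercube, so the kernel is `1` on it and the criterion
is the same at all its points. -/
lemma projLoss_eq (hq : 1 ≤ q) {x : Fin d → ℝ} (hx : x ∈ bin q l m)
    (g : MvPolynomial (Fin d) ℝ) :
    projLoss pX (bin q l m) (((q : ℝ) ^ l)⁻¹) f x g = (∫ v in bin q l m, pX v)⁻¹ *
      ∫ u in bin q l m, (f u - MvPolynomial.eval u g) ^ 2 * pX u := by
  have hql : (0 : ℝ) < (q : ℝ) ^ l := by positivity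
  unfold projLoss
  rw [← integral_const_mul]
  refine setIntegral_congr_fun (measurableSet_bin q l m) fun u hu => ?_
  have h1 : ‖(((q : ℝ) ^ l)⁻¹)⁻¹ • (x - u)‖ ≤ 1 := by
    rw [inv_inv, norm_smul, Real.norm_of_nonneg hql.le]
    have := norm_sub_le_of_mem_bin hq hx hu
    calc (q : ℝ) ^ l * ‖x - u‖ ≤ (q : ℝ) ^ l * ((q : ℝ) ^ l)⁻¹ := by gcongr
      _ = 1 := mul_inv_cancel₀ hql.ne'
  simp only [kernel_of_norm_le h1, condDensity, sq_abs, mul_one]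
  ring

section Normal

lemma continuousOn_sub_eval (hf : ContinuousOn f (cube d)) (g : MvPolynomial (Fin d) ℝ) :
    ContinuousOn (fun u => f u - MvPolynomial.eval u g) (cube d) :=
  hf.sub (MvPolynomial.continuous_eval g).continuousOn

variable (hpX : BoundedDensity ρlo ρhi pX) (hρlo : 0 < ρlo) (hq : 1 ≤ q) (hm : m ∈ bins d q l)

include hpX hρlo hq hm

lemma mass_pos : 0 < ∫ u in bin q l m, pX u := by
  refine lt_of_lt_of_le ?_ (le_mass hpX hρlo hq hm)
  have : (0 : ℝ) < q := by exact_mod_cast hq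
  positivity

lemma integrableOn_density_of_continuous {F : (Fin d → ℝ) → ℝ} (hF : ContinuousOn F (cube d)) :
    IntegrableOn (fun u => F u * pX u) (bin q l m) :=
  integrableOn_density hpX hρlo hq hm
    ((hF.mono (bin_subset_cube hq hm)).integrableOn_compact (isCompact_bin q l m))

/-- First order condition: the criterion is a quadratic function of the step in a direction `θ`. -/
lemma isOrthogonal_of_isProjection (hf : ContinuousOn f (cube d)) {x : Fin d → ℝ} (hx : x ∈ bin q l m)
    {g : MvPolynomial (Fin d) ℝ}
    (hg : IsProjection pX (bin q l m) (((q : ℝ) ^ l)⁻¹) p f x g) :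
    IsOrthogonal pX (bin q l m) p f g := by
  refine ⟨hg.1, fun θ hθ => ?_⟩
  have hp₀ := mass_pos hpX hρlo hq hm
  have hθc : ContinuousOn (fun u => MvPolynomial.eval u θ) (cube d) :=
    (MvPolynomial.continuous_eval θ).continuousOn
  have hD := continuousOn_sub_eval hf g
  set A := ∫ u in bin q l m, (f u - MvPolynomial.eval u g) ^ 2 * pX u with hA
  set B := ∫ u in bin q l m, (f u - MvPolynomial.eval u g) * MvPolynomial.eval u θ * pX u with hB
  set E := ∫ u in bin q l m, MvPolynomial.eval u θ ^ 2 * pX u with hE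
  have hi1 : IntegrableOn (fun u => (f u - MvPolynomial.eval u g) ^ 2 * pX u) (bin q l m) :=
    integrableOn_density_of_continuous hpX hρlo hq hm (hD.pow 2)
  have hi2 : IntegrableOn (fun u => (f u - MvPolynomial.eval u g) * MvPolynomial.eval u θ * pX u)
      (bin q l m) := integrableOn_density_of_continuous hpX hρlo hq hm (hD.mul hθc)
  have hi3 : IntegrableOn (fun u => MvPolynomial.eval u θ ^ 2 * pX u) (bin q l m) :=
    integrableOn_density_of_continuous hpX hρlo hq hm (hθc.pow 2)
  have key : ∀ s : ℝ, 0 ≤ -(2 * s * B) + s ^ 2 * E := by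
    intro s
    have h1 := hg.2 (g + MvPolynomial.C s * θ) ((MvPolynomial.totalDegree_add _ _).trans
      (max_le hg.1 ((MvPolynomial.totalDegree_mul _ _).trans (by
        rw [MvPolynomial.totalDegree_C, zero_add]; exact hθ))))
    rw [projLoss_eq hq hx, projLoss_eq hq hx] at h1
    have h2 := le_of_mul_le_mul_left h1 (inv_pos.2 hp₀)
    have h3 : ∫ u in bin q l m,
        (f u - MvPolynomial.eval u (g + MvPolynomial.C s * θ)) ^ 2 * pX u =
        A - 2 * s * B + s ^ 2 * E := by
      have hi4 : IntegrableOn (fun u => (f u - MvPolynomial.eval u g) ^ 2 * pX u -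
          2 * s * ((f u - MvPolynomial.eval u g) * MvPolynomial.eval u θ * pX u)) (bin q l m) :=
        hi1.sub (hi2.const_mul _)
      rw [hA, hB, hE, ← integral_const_mul, ← integral_const_mul,
        ← integral_sub hi1 (hi2.const_mul _), ← integral_add hi4 (hi3.const_mul _)]
      congr 1
      funext u
      simp only [map_add, map_mul, MvPolynomial.eval_C]
      ring
    rw [h3] at h2
    linarith
  have hE0 : 0 ≤ E := setIntegral_nonneg (measurableSet_bin q l m) fun u hu =>
    mul_nonneg (sq_nonneg _) (hρlo.le.trans (hpX.2 u (bin_subset_cube hq hm hu)).1)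
  have h1 := key (B / (E + 1))
  have h2 : -(2 * (B / (E + 1)) * B) + (B / (E + 1)) ^ 2 * E =
      -(B ^ 2 * (E + 2)) / (E + 1) ^ 2 := by
    field_simp
    ring
  rw [h2] at h1
  have h3 : 0 ≤ -(B ^ 2 * (E + 2)) := by
    by_contra! hcon
    exact absurd h1 (not_le.2 (div_neg_of_neg_of_pos hcon (by positivity)))
  have h4 : B ^ 2 ≤ 0 := by nlinarith [sq_nonneg B]
  exact pow_eq_zero_iff (two_ne_zero) |>.1 (le_antisymm h4 (sq_nonneg _))

/-- The normal equations have a solution because the Gram matrix of the monomials is positive definite. -/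
lemma exists_isProjection (hf : ContinuousOn f (cube d)) {x : Fin d → ℝ} (hx : x ∈ bin q l m) :
    ∃ g, IsProjection pX (bin q l m) (((q : ℝ) ^ l)⁻¹) p f x g := by
  obtain ⟨lam, hlam, hlow⟩ := exists_window_lower d p
  have hql : (0 : ℝ) < (q : ℝ) ^ l := by positivity
  set H : ℝ := ((q : ℝ) ^ l)⁻¹ with hH
  have hHpos : 0 < H := inv_pos.2 hql
  have hp₀ := mass_pos hpX hρlo hq hm
  have hfc : ∀ α : multiIdx d p, ContinuousOn (fun u => feat α.1 (H⁻¹ • (u - x))) (cube d) :=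
    fun α => ((continuous_feat α.1).comp (by fun_prop)).continuousOn
  set G : multiIdx d p → multiIdx d p → ℝ := fun α β =>
    ∫ u in bin q l m, feat α.1 (H⁻¹ • (u - x)) * feat β.1 (H⁻¹ • (u - x)) * pX u with hG
  set r : multiIdx d p → ℝ := fun α =>
    ∫ u in bin q l m, f u * feat α.1 (H⁻¹ • (u - x)) * pX u with hr
  have hGi : ∀ α β : multiIdx d p, IntegrableOn (fun u => feat α.1 (H⁻¹ • (u - x)) *
      feat β.1 (H⁻¹ • (u - x)) * pX u) (bin q l m) := fun α β =>
    integrableOn_density_of_continuous hpX hρlo hq hm ((hfc α).mul (hfc β))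
  have hri : ∀ α : multiIdx d p, IntegrableOn (fun u => f u * feat α.1 (H⁻¹ • (u - x)) * pX u)
      (bin q l m) := fun α =>
    integrableOn_density_of_continuous hpX hρlo hq hm (hf.mul (hfc α))
  have hlinc : ∀ c : multiIdx d p → ℝ, ContinuousOn (fun u => lin c (H⁻¹ • (u - x))) (cube d) :=
    fun c => ((continuous_lin c).comp (by fun_prop)).continuousOn
  have hQ : ∀ c : multiIdx d p → ℝ, ∫ u in bin q l m, lin c (H⁻¹ • (u - x)) ^ 2 * pX u =
      ∑ α, ∑ β, c α * c β * G α β := by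
    intro c
    have h2 : ∀ u, lin c (H⁻¹ • (u - x)) ^ 2 * pX u = ∑ α, ∑ β, c α * c β *
        (feat α.1 (H⁻¹ • (u - x)) * feat β.1 (H⁻¹ • (u - x)) * pX u) := by
      intro u
      rw [sq_lin, Finset.sum_mul]
      refine Finset.sum_congr rfl fun α _ => ?_
      rw [Finset.sum_mul]
      exact Finset.sum_congr rfl fun β _ => by ring
    simp_rw [h2]
    rw [integral_finsetSum _ fun α _ => integrable_finsetSum _ fun β _ => (hGi α β).const_mul _]
    refine Finset.sum_congr rfl fun α _ => ?_
    rw [integral_finsetSum _ fun β _ => (hGi α β).const_mul _]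
    exact Finset.sum_congr rfl fun β _ => integral_const_mul _ _
  have hR : ∀ c : multiIdx d p → ℝ, ∫ u in bin q l m, f u * lin c (H⁻¹ • (u - x)) * pX u =
      ∑ α, c α * r α := by
    intro c
    have h2 : ∀ u, f u * lin c (H⁻¹ • (u - x)) * pX u = ∑ α, c α *
        (f u * feat α.1 (H⁻¹ • (u - x)) * pX u) := by
      intro u
      rw [lin, Finset.mul_sum, Finset.sum_mul]
      exact Finset.sum_congr rfl fun β _ => by ring
    simp_rw [h2]
    rw [integral_finsetSum _ fun α _ => (hri α).const_mul _]
    exact Finset.sum_congr rfl fun β _ => integral_const_mul _ _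
  have hGlow : ∀ c : multiIdx d p → ℝ, ρlo * (lam * H ^ d) * ∑ α, c α ^ 2 ≤
      ∑ α, ∑ β, c α * c β * G α β := by
    intro c
    rw [← hQ, mul_assoc]
    have h1 := hlow q l m hq x hx H hHpos le_rfl c
    have h2 : IntegrableOn (fun u => lin c (H⁻¹ • (u - x)) ^ 2) (bin q l m) :=
      (((hlinc c).pow 2).mono (bin_subset_cube hq hm)).integrableOn_compact (isCompact_bin q l m)
    refine le_trans (mul_le_mul_of_nonneg_left (h1.trans ?_) hρlo.le)
      (le_integral_density hpX hρlo hq hm h2 fun _ _ => sq_nonneg _)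
    refine integral_mono_of_nonneg (Filter.Eventually.of_forall fun u =>
      mul_nonneg (sq_nonneg _) (kernel_nonneg _)) h2 (Filter.Eventually.of_forall fun u => ?_)
    exact mul_le_of_le_one_right (sq_nonneg _) (kernel_le_one _)
  obtain ⟨a, ha⟩ := exists_normal_equations (by positivity) hGlow r
  have hloss : ∀ c : multiIdx d p → ℝ,
      ∫ u in bin q l m, (f u - lin c (H⁻¹ • (u - x))) ^ 2 * pX u =
        (∫ u in bin q l m, f u ^ 2 * pX u) - 2 * ∑ α, c α * r α +
          ∑ α, ∑ β, c α * c β * G α β := by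
    intro c
    rw [← hQ, ← hR]
    have i1 : IntegrableOn (fun u => f u ^ 2 * pX u) (bin q l m) :=
      integrableOn_density_of_continuous hpX hρlo hq hm (hf.pow 2)
    have i2 : IntegrableOn (fun u => f u * lin c (H⁻¹ • (u - x)) * pX u) (bin q l m) :=
      integrableOn_density_of_continuous hpX hρlo hq hm (hf.mul (hlinc c))
    have i3 : IntegrableOn (fun u => lin c (H⁻¹ • (u - x)) ^ 2 * pX u) (bin q l m) :=
      integrableOn_density_of_continuous hpX hρlo hq hm ((hlinc c).pow 2)
    have i4 : IntegrableOn (fun u => f u ^ 2 * pX u -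
        2 * (f u * lin c (H⁻¹ • (u - x)) * pX u)) (bin q l m) := i1.sub (i2.const_mul _)
    rw [← integral_const_mul, ← integral_sub i1 (i2.const_mul _), ← integral_add i4 i3]
    congr 1
    funext u
    ring
  have hsymm : ∀ α β, G α β = G β α := fun α β => by
    simp only [hG]
    congr 1
    funext u
    ring
  obtain ⟨g, hg, hge⟩ := exists_poly_lin a H x
  refine ⟨g, hg, fun g' hg' => ?_⟩
  obtain ⟨c, hc⟩ := exists_lin_poly hg' hHpos x
  rw [projLoss_eq hq hx, projLoss_eq hq hx]
  refine mul_le_mul_of_nonneg_left ?_ (inv_nonneg.2 hp₀.le)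
  simp_rw [hge, hc, hloss]
  rw [quadratic_eq_add hsymm ha _ c]
  refine le_add_of_nonneg_right (le_trans ?_ (hGlow fun α => c α - a α))
  exact mul_nonneg (by positivity) (Finset.sum_nonneg fun _ _ => sq_nonneg _)

end Normal

/-- The projection of a Hölder function is uniformly close to the function, and the difference has
a modulus of continuity at the scale of the hypercube: it is the sum of a Taylor remainder and of a
polynomial whose coefficients at this scale are controlled by the orthogonality. -/
lemma exists_projection_modulus (d p : ℕ) {L ρlo ρhi : ℝ} (hL : 0 < L) (hρlo : 0 < ρlo)
    (hρ : ρlo ≤ ρhi) : ∃ C : ℝ, 0 < C ∧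
    ∀ (β : ℝ) (f : (Fin d → ℝ) → ℝ) (pX : (Fin d → ℝ) → ℝ) (q l : ℕ) (m : Fin d → ℕ)
      (g : MvPolynomial (Fin d) ℝ), 0 < β → floorLt β ≤ p → IsHolder β L f →
      BoundedDensity ρlo ρhi pX → 1 ≤ q → m ∈ bins d q l → IsOrthogonal pX (bin q l m) p f g →
      ∀ x ∈ bin q l m,
        |MvPolynomial.eval x g - f x| ≤ C * (((q : ℝ) ^ l)⁻¹) ^ β ∧
        ∀ u ∈ bin q l m, |(MvPolynomial.eval u g - f u) - (MvPolynomial.eval x g - f x)| ≤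
          C * (((q : ℝ) ^ l)⁻¹) ^ β * ((q : ℝ) ^ l * ‖u - x‖) + L * ‖u - x‖ ^ β := by
  obtain ⟨lam, hlam, hlow⟩ := exists_window_lower d p
  set N : ℕ := Fintype.card (multiIdx d p) with hN
  have hρhi : 0 < ρhi := hρlo.trans_le hρ
  set C : ℝ := Real.sqrt (N * (L ^ 2 * ρhi / (lam * ρlo))) with hC
  refine ⟨C + 1, by positivity, ?_⟩
  intro β f pX q l m g hβ hp hf hpX hq hm hg x hx
  have hql : (0 : ℝ) < (q : ℝ) ^ l := by positivity
  set H : ℝ := ((q : ℝ) ^ l)⁻¹ with hH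
  have hHpos : 0 < H := inv_pos.2 hql
  have hxc := bin_subset_cube hq hm hx
  obtain ⟨e, he0, he⟩ := hf.exists_lin hβ hp hxc hHpos
  obtain ⟨c, hc⟩ := exists_lin_poly hg.1 hHpos x
  obtain ⟨θ, hθ, hθe⟩ := exists_poly_lin (c - e) H x
  have hfc := hf.continuousOn
  have hw : ∀ u, MvPolynomial.eval u θ =
      MvPolynomial.eval u g - lin e (H⁻¹ • (u - x)) := fun u => by
    rw [hθe, lin_sub, hc]
  have hθc : ContinuousOn (fun u => MvPolynomial.eval u θ) (cube d) :=
    (MvPolynomial.continuous_eval θ).continuousOn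
  have hR : ∀ u ∈ bin q l m, |f u - lin e (H⁻¹ • (u - x))| ≤ L * H ^ β := by
    intro u hu
    refine (he u (bin_subset_cube hq hm hu)).trans ?_
    gcongr
    exact norm_sub_le_of_mem_bin hq hu hx
  -- by orthogonality, the second moment of `θ` is at most that of the Taylor remainder
  have hint : ∫ u in bin q l m, MvPolynomial.eval u θ ^ 2 * pX u ≤
      (L * H ^ β) ^ 2 * ∫ u in bin q l m, pX u := by
    have h0 := hg.2 θ hθ
    have i1 : IntegrableOn (fun u => MvPolynomial.eval u θ ^ 2 * pX u) (bin q l m) :=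
      integrableOn_density_of_continuous hpX hρlo hq hm (hθc.pow 2)
    have i2 : IntegrableOn (fun u => (f u - MvPolynomial.eval u g) * MvPolynomial.eval u θ * pX u)
        (bin q l m) := integrableOn_density_of_continuous hpX hρlo hq hm
      ((continuousOn_sub_eval hfc g).mul hθc)
    have i3 : IntegrableOn (fun u => (L * H ^ β) ^ 2 * pX u) (bin q l m) :=
      integrableOn_density_of_continuous hpX hρlo hq hm
        (continuousOn_const (c := (L * H ^ β) ^ 2))
    have h1 : ∫ u in bin q l m, (MvPolynomial.eval u θ ^ 2 * pX u + 2 *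
        ((f u - MvPolynomial.eval u g) * MvPolynomial.eval u θ * pX u)) ≤
        ∫ u in bin q l m, (L * H ^ β) ^ 2 * pX u := by
      refine setIntegral_mono_on (i1.add (i2.const_mul _)) i3 (measurableSet_bin q l m)
        fun u hu => ?_
      have hpu := hρlo.le.trans (hpX.2 u (bin_subset_cube hq hm hu)).1
      have h2 : MvPolynomial.eval u θ ^ 2 + 2 * ((f u - MvPolynomial.eval u g) *
          MvPolynomial.eval u θ) ≤ (L * H ^ β) ^ 2 := by
        have h3 := sq_le_sq.2 ((hR u hu).trans (le_abs_self _))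
        have h4 : f u - lin e (H⁻¹ • (u - x)) =
            (f u - MvPolynomial.eval u g) + MvPolynomial.eval u θ := by rw [hw]; ring
        rw [h4] at h3
        nlinarith [sq_nonneg (f u - MvPolynomial.eval u g)]
      nlinarith [mul_le_mul_of_nonneg_right h2 hpu]
    rw [integral_add i1 (i2.const_mul _), integral_const_mul, h0, mul_zero, add_zero,
      integral_const_mul] at h1
    exact h1
  have hcoef : ∑ α, |(c - e) α| ≤ C * H ^ β := by
    refine sum_abs_le_of_sum_sq_le (by positivity) ?_
    have h1 := hlow q l m hq x hx H hHpos le_rfl (c - e)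
    have i1 : IntegrableOn (fun u => MvPolynomial.eval u θ ^ 2) (bin q l m) :=
      ((hθc.pow 2).mono (bin_subset_cube hq hm)).integrableOn_compact (isCompact_bin q l m)
    have h2 : ∫ u in bin q l m, lin (c - e) (H⁻¹ • (u - x)) ^ 2 * kernel (H⁻¹ • (u - x)) ≤
        ∫ u in bin q l m, MvPolynomial.eval u θ ^ 2 := by
      refine integral_mono_of_nonneg (Filter.Eventually.of_forall fun u =>
        mul_nonneg (sq_nonneg _) (kernel_nonneg _)) i1 (Filter.Eventually.of_forall fun u => ?_)
      simp only [hθe]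
      exact mul_le_of_le_one_right (sq_nonneg _) (kernel_le_one _)
    have h3 := le_integral_density hpX hρlo hq hm i1 fun _ _ => sq_nonneg _
    have h4 := mass_le hpX hρlo hq hm
    have h5 : ρlo * (lam * H ^ d * ∑ α, (c - e) α ^ 2) ≤
        (L * H ^ β) ^ 2 * (ρhi * H ^ d) :=
      (mul_le_mul_of_nonneg_left (h1.trans h2) hρlo.le).trans
        (h3.trans (hint.trans (mul_le_mul_of_nonneg_left h4 (sq_nonneg _))))
    have hHd : 0 < H ^ d := by positivity
    have h6 : ∑ α, (c - e) α ^ 2 ≤ L ^ 2 * ρhi / (lam * ρlo) * (H ^ β) ^ 2 := by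
      rw [div_mul_eq_mul_div, le_div_iff₀ (by positivity)]
      refine le_of_mul_le_mul_right ?_ hHd
      linarith
    rw [mul_pow, hC, Real.sq_sqrt (by positivity), mul_assoc]
    exact mul_le_mul_of_nonneg_left h6 (Nat.cast_nonneg _)
  have hHβ : 0 ≤ H ^ β := by positivity
  have hθx : MvPolynomial.eval x θ = MvPolynomial.eval x g - f x := by
    rw [hw, sub_self, smul_zero, he0]
  have hθ0 : MvPolynomial.eval x θ = lin (c - e) 0 := by rw [hθe, sub_self, smul_zero]
  refine ⟨?_, fun u hu => ?_⟩
  · rw [← hθx, hθ0]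
    refine (abs_lin_le _ (by simp)).trans (hcoef.trans ?_)
    nlinarith
  · have hnorm : ‖H⁻¹ • (u - x)‖ = (q : ℝ) ^ l * ‖u - x‖ := by
      rw [norm_smul, hH, inv_inv, Real.norm_of_nonneg hql.le]
    have hnorm1 : ‖H⁻¹ • (u - x)‖ ≤ 1 := by
      rw [hnorm]
      calc (q : ℝ) ^ l * ‖u - x‖ ≤ (q : ℝ) ^ l * ((q : ℝ) ^ l)⁻¹ := by
            gcongr; exact norm_sub_le_of_mem_bin hq hu hx
        _ = 1 := mul_inv_cancel₀ hql.ne'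
    have h1 := abs_lin_sub_le (c - e) hnorm1
    rw [← hθ0, ← hθe, hnorm] at h1
    have h2 := he u (bin_subset_cube hq hm hu)
    have h3 : (MvPolynomial.eval u g - f u) - (MvPolynomial.eval x g - f x) =
        (MvPolynomial.eval u θ - MvPolynomial.eval x θ) - (f u - lin e (H⁻¹ • (u - x))) := by
      rw [hθx, hw]; ring
    rw [h3]
    refine (abs_sub _ _).trans (add_le_add (h1.trans ?_) h2)
    refine mul_le_mul_of_nonneg_right (hcoef.trans ?_) (by positivity)
    nlinarith

end Projection

/-! ### Self-similar payoffs on the mesh -/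

section SelfSimilarity

variable {d p q l : ℕ} {m : Fin d → ℕ} {β L : ℝ} {f : (Fin d → ℝ) → ℝ} {ρlo ρhi : ℝ}
  {pX : (Fin d → ℝ) → ℝ}

/-- A scale at which both a linear function and all the powers with exponents `β ≥ βlo` are small. -/
lemma exists_small_scale {A L ε βlo : ℝ} (hA : 0 ≤ A) (hL : 0 ≤ L) (hε : 0 < ε) (hβlo : 0 < βlo) :
    ∃ τ : ℝ, 0 < τ ∧ τ ≤ 1 ∧ ∀ t, 0 ≤ t → t ≤ τ → ∀ β, βlo ≤ β → A * t + L * t ^ β ≤ ε := by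
  refine ⟨min 1 (min (ε / (2 * (A + 1))) ((ε / (2 * (L + 1))) ^ βlo⁻¹)), by positivity,
    min_le_left _ _, fun t ht htτ β hβ => ?_⟩
  have h1 : t ≤ 1 := htτ.trans (min_le_left _ _)
  have h2 : t ≤ ε / (2 * (A + 1)) := htτ.trans ((min_le_right _ _).trans (min_le_left _ _))
  have h3 : t ≤ (ε / (2 * (L + 1))) ^ βlo⁻¹ :=
    htτ.trans ((min_le_right _ _).trans (min_le_right _ _))
  have h4 : t ^ β ≤ ε / (2 * (L + 1)) := by
    calc t ^ β ≤ t ^ βlo := by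
          rcases ht.eq_or_lt with h0 | h0
          · rw [← h0, Real.zero_rpow hβlo.ne', Real.zero_rpow (hβlo.trans_le hβ).ne']
          · exact Real.rpow_le_rpow_of_exponent_ge h0 h1 hβ
      _ ≤ ((ε / (2 * (L + 1))) ^ βlo⁻¹) ^ βlo := Real.rpow_le_rpow ht h3 hβlo.le
      _ = _ := by rw [← Real.rpow_mul (by positivity), inv_mul_cancel₀ hβlo.ne', Real.rpow_one]
  rw [le_div_iff₀ (by positivity)] at h2 h4
  have h5 : 0 ≤ t ^ β := Real.rpow_nonneg ht β
  nlinarith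

/-- A window around a point of a hypercube keeps a fixed fraction of its volume inside the hypercube. -/
lemma exists_window_mass_lower (d : ℕ) : ∃ lam : ℝ, 0 < lam ∧ ∀ (q l : ℕ) (m : Fin d → ℕ), 1 ≤ q →
    ∀ x ∈ bin q l m, ∀ h : ℝ, 0 < h → h ≤ ((q : ℝ) ^ l)⁻¹ →
      lam * h ^ d ≤ ∫ u in bin q l m, kernel (h⁻¹ • (u - x)) := by
  obtain ⟨lam, hlam, hlow⟩ := exists_window_lower d 0
  refine ⟨lam, hlam, fun q l m hq x hx h hh hhl => ?_⟩
  obtain ⟨c, hc⟩ := exists_lin_poly (p := 0) (θ := (1 : MvPolynomial (Fin d) ℝ)) (by simp) hh x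
  simp only [map_one] at hc
  have h1 := hlow q l m hq x hx h hh hhl c
  simp only [← hc, one_pow, one_mul] at h1
  have h2 : c (zeroIdx d 0) = 1 := by
    have := hc x
    rw [sub_self, smul_zero, lin_zero_right] at this
    exact this.symm
  have h3 : (1 : ℝ) ≤ ∑ α, c α ^ 2 := by
    have := Finset.single_le_sum (f := fun α => c α ^ 2) (fun α _ => sq_nonneg _)
      (Finset.mem_univ (zeroIdx d 0))
    simpa [h2] using this
  have h4 : 0 < lam * h ^ d := by positivity
  nlinarith

/-- A function of mean zero that is very negative somewhere is positive somewhere else,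
quantitatively in terms of its modulus of continuity. -/
lemma exists_pos_part {C L b ρlo ρhi βlo : ℝ} (d : ℕ) (hC : 0 ≤ C) (hL : 0 ≤ L) (hb : 0 < b)
    (hρlo : 0 < ρlo) (hρ : ρlo ≤ ρhi) (hβlo : 0 < βlo) :
    ∃ c : ℝ, 0 < c ∧ ∀ (β : ℝ) (D : (Fin d → ℝ) → ℝ) (pX : (Fin d → ℝ) → ℝ) (q l : ℕ)
      (m : Fin d → ℕ), βlo ≤ β → BoundedDensity ρlo ρhi pX → 1 ≤ q → m ∈ bins d q l →
      ContinuousOn D (cube d) → ∫ u in bin q l m, D u * pX u = 0 →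
      (∀ x ∈ bin q l m, ∀ u ∈ bin q l m, |D u - D x| ≤
        C * (((q : ℝ) ^ l)⁻¹) ^ β * ((q : ℝ) ^ l * ‖u - x‖) + L * ‖u - x‖ ^ β) →
      (∃ y ∈ bin q l m, D y ≤ -(b * (((q : ℝ) ^ l)⁻¹) ^ β)) →
      ∃ z ∈ bin q l m, c * (((q : ℝ) ^ l)⁻¹) ^ β ≤ D z := by
  obtain ⟨lam, hlam, hlow⟩ := exists_window_mass_lower d
  obtain ⟨τ, hτ, hτ1, hτb⟩ := exists_small_scale hC hL (half_pos hb) hβlo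
  have hρhi : 0 < ρhi := hρlo.trans_le hρ
  refine ⟨b * ρlo * lam * τ ^ d / (4 * ρhi), by positivity, ?_⟩
  intro β D pX q l m hβ hpX hq hm hD hD0 hmod ⟨y, hy, hyb⟩
  have hql : (0 : ℝ) < (q : ℝ) ^ l := by positivity
  set H : ℝ := ((q : ℝ) ^ l)⁻¹ with hH
  have hHpos : 0 < H := inv_pos.2 hql
  set c : ℝ := b * ρlo * lam * τ ^ d / (4 * ρhi) with hc
  have hcpos : 0 < c := by positivity
  have hHβ : 0 < H ^ β := by positivity
  -- if `D` were small everywhere, the window around `y`, on which `D` is at most `-b / 2 * H ^ β`,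
  -- would make its mean negative
  by_contra! hcon
  have hK : ∀ u ∈ bin q l m, D u ≤ c * H ^ β - b / 2 * H ^ β * kernel ((τ * H)⁻¹ • (u - y)) := by
    intro u hu
    rcases le_or_gt ‖(τ * H)⁻¹ • (u - y)‖ 1 with h1 | h1
    · rw [kernel_of_norm_le h1]
      rw [norm_smul, Real.norm_of_nonneg (by positivity), inv_mul_le_iff₀ (by positivity),
        mul_one] at h1
      have h2 := (abs_le.1 (hmod y hy u hu)).2
      have h3 : (q : ℝ) ^ l * ‖u - y‖ ≤ τ := by
        calc (q : ℝ) ^ l * ‖u - y‖ ≤ (q : ℝ) ^ l * (τ * H) := by gcongr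
          _ = τ := by rw [hH]; field_simp
      have h4 : ‖u - y‖ ^ β ≤ τ ^ β * H ^ β := by
        rw [← Real.mul_rpow hτ.le hHpos.le]
        exact Real.rpow_le_rpow (norm_nonneg _) h1 (hβlo.le.trans hβ)
      have h5 := hτb τ hτ.le le_rfl β hβ
      have h6 : C * H ^ β * ((q : ℝ) ^ l * ‖u - y‖) ≤ C * H ^ β * τ := by gcongr
      have h7 : L * ‖u - y‖ ^ β ≤ L * (τ ^ β * H ^ β) := by gcongr
      nlinarith
    · rw [kernel_of_lt_norm h1, mul_zero, sub_zero]
      exact (hcon u hu).le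
  have hKi : IntegrableOn (fun u => kernel ((τ * H)⁻¹ • (u - y))) (bin q l m) := by
    refine Integrable.mono' (integrableOn_one_bin (q := q) (l := l) (m := m))
      (measurable_kernel.comp (measurable_window _ _)).aestronglyMeasurable
      (Filter.Eventually.of_forall fun u => ?_)
    rw [Real.norm_of_nonneg (kernel_nonneg _)]
    exact kernel_le_one _
  have hKp := integrableOn_density hpX hρlo hq hm hKi
  have hp : IntegrableOn pX (bin q l m) := by
    simpa using integrableOn_density hpX hρlo hq hm integrableOn_one_bin
  have h1 : ∫ u in bin q l m, D u * pX u ≤ ∫ u in bin q l m, (c * H ^ β * pX u -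
      b / 2 * H ^ β * (kernel ((τ * H)⁻¹ • (u - y)) * pX u)) := by
    refine setIntegral_mono_on (integrableOn_density_of_continuous hpX hρlo hq hm hD)
      ((hp.const_mul _).sub (hKp.const_mul _)) (measurableSet_bin q l m) fun u hu => ?_
    have := mul_le_mul_of_nonneg_right (hK u hu)
      (hρlo.le.trans (hpX.2 u (bin_subset_cube hq hm hu)).1)
    linarith
  rw [hD0, integral_sub (hp.const_mul _) (hKp.const_mul _), integral_const_mul,
    integral_const_mul] at h1
  have h2 := le_integral_density hpX hρlo hq hm hKi fun u _ => kernel_nonneg _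
  have h3 := hlow q l m hq y hy (τ * H) (by positivity) (mul_le_of_le_one_left hHpos.le hτ1)
  have h4 := mass_le hpX hρlo hq hm
  have h5 : ρlo * (lam * (τ * H) ^ d) ≤
      ∫ u in bin q l m, kernel ((τ * H)⁻¹ • (u - y)) * pX u :=
    (mul_le_mul_of_nonneg_left h3 hρlo.le).trans h2
  have h6 : b / 2 * H ^ β * (ρlo * (lam * (τ * H) ^ d)) ≤ c * H ^ β * (ρhi * H ^ d) := by
    have h7 := mul_le_mul_of_nonneg_left h5 (by positivity : 0 ≤ b / 2 * H ^ β)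
    have h8 := mul_le_mul_of_nonneg_left h4 (by positivity : 0 ≤ c * H ^ β)
    linarith
  have h7 : c * H ^ β * (ρhi * H ^ d) = b / 4 * H ^ β * (ρlo * (lam * (τ * H) ^ d)) := by
    rw [hc, mul_pow]; field_simp
  have h8 : 0 < H ^ β * (ρlo * (lam * (τ * H) ^ d)) := by positivity
  nlinarith

/-- If the projection misses the payoff by the order `H ^ β` somewhere in the hypercube, then it
does so, even after truncation to `[0,1]`, at a point of any sufficiently dense subset: the
payoff is almost constant in the hypercube, so that it stays away from `0` or from `1`, and the
difference attains both signs because it has mean zero. -/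
lemma exists_truncated_gap {L b ρlo ρhi βlo : ℝ} (d p : ℕ) (hL : 0 < L) (hb : 0 < b)
    (hρlo : 0 < ρlo) (hρ : ρlo ≤ ρhi) (hβlo : 0 < βlo) :
    ∃ c τ H₀ : ℝ, 0 < c ∧ 0 < τ ∧ 0 < H₀ ∧ ∀ (β : ℝ) (f : (Fin d → ℝ) → ℝ)
      (pX : (Fin d → ℝ) → ℝ) (q l : ℕ) (m : Fin d → ℕ) (g : MvPolynomial (Fin d) ℝ)
      (Z : Set (Fin d → ℝ)), βlo ≤ β → floorLt β ≤ p → IsHolder β L f →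
      (∀ u ∈ cube d, f u ∈ Set.Icc (0 : ℝ) 1) → BoundedDensity ρlo ρhi pX → 1 ≤ q →
      m ∈ bins d q l → ((q : ℝ) ^ l)⁻¹ ≤ H₀ → IsOrthogonal pX (bin q l m) p f g →
      (∀ y ∈ bin q l m, ∃ z ∈ Z, z ∈ bin q l m ∧ ‖z - y‖ ≤ τ * ((q : ℝ) ^ l)⁻¹) →
      (∃ y ∈ bin q l m, b * (((q : ℝ) ^ l)⁻¹) ^ β ≤ |MvPolynomial.eval y g - f y|) →
      ∃ z ∈ Z, z ∈ bin q l m ∧ c * (((q : ℝ) ^ l)⁻¹) ^ β ≤ |trunc (MvPolynomial.eval z g) - f z| := by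
  obtain ⟨C, hC, hCmod⟩ := exists_projection_modulus d p hL hρlo hρ
  obtain ⟨C₁, hC₁, hfmod⟩ := exists_holder_modulus d p hL
  obtain ⟨c, hc, hpos⟩ := exists_pos_part d hC.le hL.le hb hρlo hρ hβlo
  obtain ⟨τ, hτ, hτ1, hτc⟩ := exists_small_scale hC.le hL.le
    (half_pos (lt_min hc hb)) hβlo
  obtain ⟨H₀, hH₀, -, hH₀4⟩ := exists_small_scale hC₁.le (add_pos hC hL).le
    (by norm_num : (0 : ℝ) < 1 / 4) hβlo
  refine ⟨min c b / 2, τ, H₀, by positivity, hτ, hH₀, ?_⟩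
  intro β f pX q l m g Z hβ hp hf hf01 hpX hq hm hH hg hZ ⟨y, hy, hyb⟩
  have hβpos : 0 < β := hβlo.trans_le hβ
  have hql : (0 : ℝ) < (q : ℝ) ^ l := by positivity
  set H : ℝ := ((q : ℝ) ^ l)⁻¹ with hHdef
  have hHpos : 0 < H := inv_pos.2 hql
  have hHβ : 0 < H ^ β := by positivity
  have hcb : min c b ≤ c := min_le_left _ _
  have hbb : min c b ≤ b := min_le_right _ _
  have hmod := hCmod β f pX q l m g hβpos hp hf hpX hq hm hg
  set D : (Fin d → ℝ) → ℝ := fun u => MvPolynomial.eval u g - f u with hD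
  have hDc : ContinuousOn D (cube d) :=
    (MvPolynomial.continuous_eval g).continuousOn.sub hf.continuousOn
  have hD0 : ∫ u in bin q l m, D u * pX u = 0 := by
    have h1 := hg.2 1 (by simp)
    rw [← neg_eq_zero, ← integral_neg]
    rw [← h1]
    congr 1
    funext u
    simp only [hD, map_one]
    ring
  have hsmall := hH₀4 H hHpos.le hH β hβ
  have hDle : ∀ u ∈ bin q l m, |D u| ≤ 1 / 4 := fun u hu => by
    have := (hmod u hu).1
    nlinarith [mul_pos hC₁ hHpos, mul_pos hL hHβ]
  have hfvar : ∀ u ∈ bin q l m, ∀ v ∈ bin q l m, |f u - f v| ≤ 1 / 4 := fun u hu v hv => by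
    have h1 := hfmod β f hβpos hp hf hf01 v (bin_subset_cube hq hm hv) u (bin_subset_cube hq hm hu)
    have h2 := norm_sub_le_of_mem_bin hq hu hv
    have h3 : ‖u - v‖ ^ β ≤ H ^ β := Real.rpow_le_rpow (norm_nonneg _) h2 hβpos.le
    nlinarith [mul_pos hC hHβ]
  -- the difference attains both signs
  have hplus : ∃ z ∈ bin q l m, min c b * H ^ β ≤ D z := by
    rcases le_abs.1 hyb with h1 | h1
    · exact ⟨y, hy, (mul_le_mul_of_nonneg_right hbb hHβ.le).trans h1⟩
    · obtain ⟨z, hz, hzc⟩ := hpos β D pX q l m hβ hpX hq hm hDc hD0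
        (fun x hx u hu => (hmod x hx).2 u hu) ⟨y, hy, by simp only [hD]; linarith⟩
      exact ⟨z, hz, (mul_le_mul_of_nonneg_right hcb hHβ.le).trans hzc⟩
  have hminus : ∃ z ∈ bin q l m, min c b * H ^ β ≤ -D z := by
    rcases le_abs.1 hyb with h1 | h1
    · obtain ⟨z, hz, hzc⟩ := hpos β (fun u => -D u) pX q l m hβ hpX hq hm hDc.neg
        (by simp only [neg_mul]; rw [integral_neg, hD0, neg_zero])
        (fun x hx u hu => by
          rw [← abs_neg]
          refine le_trans (le_of_eq ?_) ((hmod x hx).2 u hu)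
          congr 1
          simp only [hD]; ring)
        ⟨y, hy, by simp only [hD]; linarith⟩
      exact ⟨z, hz, (mul_le_mul_of_nonneg_right hcb hHβ.le).trans hzc⟩
    · exact ⟨y, hy, (mul_le_mul_of_nonneg_right hbb hHβ.le).trans h1⟩
  -- half of the gap is left at a nearby point of `Z`
  have hnear : ∀ z ∈ bin q l m, ∃ z' ∈ Z, z' ∈ bin q l m ∧
      |D z' - D z| ≤ min c b / 2 * H ^ β := by
    intro z hz
    obtain ⟨z', hz'Z, hz', hzz⟩ := hZ z hz
    refine ⟨z', hz'Z, hz', ((hmod z hz).2 z' hz').trans ?_⟩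
    have h3 : (q : ℝ) ^ l * ‖z' - z‖ ≤ τ := by
      calc (q : ℝ) ^ l * ‖z' - z‖ ≤ (q : ℝ) ^ l * (τ * H) := by gcongr
        _ = τ := by rw [hHdef]; field_simp
    have h4 : ‖z' - z‖ ^ β ≤ τ ^ β * H ^ β := by
      rw [← Real.mul_rpow hτ.le hHpos.le]
      exact Real.rpow_le_rpow (norm_nonneg _) hzz hβpos.le
    have h5 := hτc τ hτ.le le_rfl β hβ
    have h6 : C * H ^ β * ((q : ℝ) ^ l * ‖z' - z‖) ≤ C * H ^ β * τ := by gcongr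
    have h7 : L * ‖z' - z‖ ^ β ≤ L * (τ ^ β * H ^ β) := by gcongr
    nlinarith
  -- `f` is at most `3 / 4` or at least `1 / 4` on the hypercube, and `|D| ≤ 1 / 4`, so a difference
  -- of the right sign leaves `f + D` inside `[0,1]`
  rcases le_or_gt (f y) (1 / 2) with h1 | h1
  · obtain ⟨z, hz, hzc⟩ := hplus
    obtain ⟨z', hz'Z, hz', hzz⟩ := hnear z hz
    refine ⟨z', hz'Z, hz', ?_⟩
    have h2 := (abs_le.1 hzz).1
    have h3 := (abs_le.1 (hfvar z' hz' y hy)).2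
    have h4 := (abs_le.1 (hDle z' hz')).2
    have h5 := (hf01 z' (bin_subset_cube hq hm hz')).1
    have h6 : min c b / 2 * H ^ β ≤ D z' := by linarith
    have h7 : 0 ≤ min c b / 2 * H ^ β := by positivity
    rw [trunc_eq_self ⟨by simp only [hD] at h6; linarith, by simp only [hD] at h4; linarith⟩]
    exact h6.trans (le_abs_self _)
  · obtain ⟨z, hz, hzc⟩ := hminus
    obtain ⟨z', hz'Z, hz', hzz⟩ := hnear z hz
    refine ⟨z', hz'Z, hz', ?_⟩
    have h2 := (abs_le.1 hzz).2
    have h3 := (abs_le.1 (hfvar z' hz' y hy)).1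
    have h4 := (abs_le.1 (hDle z' hz')).1
    have h5 := (hf01 z' (bin_subset_cube hq hm hz')).2
    have h6 : min c b / 2 * H ^ β ≤ -D z' := by linarith
    have h7 : 0 ≤ min c b / 2 * H ^ β := by positivity
    rw [trunc_eq_self ⟨by simp only [hD] at h4; linarith, by simp only [hD] at h6; linarith⟩]
    exact h6.trans (neg_le_abs _)

lemma floorLt_mono {β β' : ℝ} (h : β ≤ β') : floorLt β ≤ floorLt β' :=
  Nat.sub_le_sub_right (Nat.ceil_mono h) 1

/-- Self-similarity provides a hypercube, an arm and a point at which the projection misses the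
payoff. Half of the constant is given up because the supremum need not be attained. -/
lemma SelfSimilar.exists_gap {βhi b l₀ : ℝ} {f : Fin 2 → (Fin d → ℝ) → ℝ}
    (hss : SelfSimilar βhi pX β b l₀ f) (hb : 0 < b) (hβ : β ≤ βhi)
    (hpX : BoundedDensity ρlo ρhi pX) (hρlo : 0 < ρlo) (hl : l₀ ≤ l) (hq : 1 < q) :
    ∃ m ∈ bins d q l, ∃ (k : Fin 2) (g : MvPolynomial (Fin d) ℝ),
      IsOrthogonal pX (bin q l m) (floorLt βhi) (f k) g ∧
        ∃ y ∈ bin q l m, b / 2 * (((q : ℝ) ^ l)⁻¹) ^ β ≤ |MvPolynomial.eval y g - f k y| := by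
  have hql : (0 : ℝ) < (q : ℝ) ^ l := by positivity
  set H : ℝ := ((q : ℝ) ^ l)⁻¹ with hH
  have hHpos : 0 < H := inv_pos.2 hql
  have hpow : (q : ℝ) ^ (-((l : ℝ) * β)) = H ^ β := by
    rw [Real.rpow_neg (Nat.cast_nonneg _), Real.rpow_mul (Nat.cast_nonneg _), Real.rpow_natCast,
      ← Real.inv_rpow hql.le]
  by_contra! hcon
  have h1 := hss.2 l q (floorLt βhi) hl hq (floorLt_mono hβ) le_rfl
  rw [hpow] at h1
  have h2 : (⨆ m ∈ bins d q l, ⨆ k : Fin 2, ⨆ x ∈ bin q l m,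
      ENNReal.ofReal |proj pX (bin q l m) (((q : ℝ) ^ l)⁻¹) (floorLt βhi) (f k) x - f k x|) ≤
        ENNReal.ofReal (b / 2 * H ^ β) := by
    refine iSup₂_le fun m hm => iSup_le fun k => iSup₂_le fun x hx => ?_
    obtain ⟨L', -, hL'⟩ := hss.1 k
    have hex := exists_isProjection (p := floorLt βhi) hpX hρlo hq.le hm hL'.continuousOn hx
    refine ENNReal.ofReal_le_ofReal ?_
    rw [proj, dif_pos hex]
    exact (hcon m hm k _ (isOrthogonal_of_isProjection hpX hρlo hq.le hm hL'.continuousOn hx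
      hex.choose_spec) x hx).le
  have h3 := (ENNReal.ofReal_le_ofReal_iff (by positivity)).1 (h1.trans h2)
  have h4 : 0 < b * H ^ β := by positivity
  linarith

end SelfSimilarity

section Mesh

variable {d : ℕ} {m : Fin d → ℕ} (a : Params)

/-- Rounding the coordinates up, at least to `1`, stays inside the hypercube because the mesh refines the
partition. -/
lemma exists_mem_mesh (hq : 1 ≤ a.q) (hm : m ∈ bins d a.q (a.level d))
    (hl : a.level d ≤ a.meshLevel d) {y : Fin d → ℝ} (hy : y ∈ bin a.q (a.level d) m) :
    ∃ z ∈ a.mesh m, ‖z - y‖ ≤ ((a.q : ℝ) ^ a.meshLevel d)⁻¹ := by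
  set q := a.q
  set l := a.level d
  set M := a.meshLevel d
  have hqr : (0 : ℝ) < q := by exact_mod_cast hq
  have hql : (0 : ℝ) < (q : ℝ) ^ l := by positivity
  have hqM : (0 : ℝ) < (q : ℝ) ^ M := by positivity
  have hy0 : ∀ i, 0 ≤ y i := fun i => (mem_cube.1 (bin_subset_cube hq hm hy) i).1
  set n : Fin d → ℕ := fun i => max 1 ⌈y i * (q : ℝ) ^ M⌉₊ with hn
  have hup : ∀ i, n i ≤ (m i + 1) * q ^ (M - l) := by
    intro i
    refine max_le ?_ (Nat.ceil_le.2 ?_)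
    · exact Nat.mul_pos (Nat.succ_pos _) (pow_pos hq _)
    · have h1 := (hy i).2
      rw [le_div_iff₀ hql] at h1
      have h2 : (q : ℝ) ^ M = (q : ℝ) ^ l * (q : ℝ) ^ (M - l) := by
        rw [← pow_add, Nat.add_sub_cancel' hl]
      push_cast
      rw [h2, ← mul_assoc]
      gcongr
  have hlo : ∀ i, y i * (q : ℝ) ^ M ≤ n i := fun i =>
    (Nat.le_ceil _).trans (Nat.cast_le.2 (le_max_right _ _))
  have hhi : ∀ i, (n i : ℝ) ≤ y i * (q : ℝ) ^ M + 1 := fun i => by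
    have h1 : 0 ≤ y i * (q : ℝ) ^ M := mul_nonneg (hy0 i) hqM.le
    rw [hn]
    push_cast
    exact max_le (by linarith) (Nat.ceil_lt_add_one h1).le
  refine ⟨fun i => (n i : ℝ) / (q : ℝ) ^ M, ⟨fun i => ⟨?_, ?_⟩, fun i => ⟨n i, le_max_left _ _, ?_,
    rfl⟩⟩, ?_⟩
  · rw [le_div_iff₀ hqM]
    exact (mul_le_mul_of_nonneg_right (hy i).1 hqM.le).trans (hlo i)
  · have h2 : (q : ℝ) ^ M = (q : ℝ) ^ l * (q : ℝ) ^ (M - l) := by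
      rw [← pow_add, Nat.add_sub_cancel' hl]
    rw [div_le_div_iff₀ hqM hql]
    calc (n i : ℝ) * (q : ℝ) ^ l ≤ ((m i + 1) * (q : ℝ) ^ (M - l)) * (q : ℝ) ^ l := by
          gcongr; exact_mod_cast hup i
      _ = _ := by rw [h2]; ring
  · calc n i ≤ (m i + 1) * q ^ (M - l) := hup i
      _ ≤ q ^ l * q ^ (M - l) := Nat.mul_le_mul_right _ (mem_bins.1 hm i)
      _ = q ^ M := by rw [← pow_add, Nat.add_sub_cancel' hl]
  · rw [pi_norm_le_iff_of_nonneg (by positivity)]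
    intro i
    rw [Pi.sub_apply, Real.norm_eq_abs]
    have h1 : (n i : ℝ) / (q : ℝ) ^ M - y i = (n i - y i * (q : ℝ) ^ M) * ((q : ℝ) ^ M)⁻¹ := by
      field_simp
    rw [h1, abs_mul, abs_of_pos (inv_pos.2 hqM)]
    refine mul_le_of_le_one_left (by positivity) (abs_le.2 ⟨?_, ?_⟩)
    · linarith [hlo i]
    · linarith [hhi i]

lemma exists_finset_mesh (m : Fin d → ℕ) :
    ∃ Z : Finset (Fin d → ℝ), (Z : Set (Fin d → ℝ)) = a.mesh m ∧
      Z.card ≤ (a.q ^ a.meshLevel d) ^ d := by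
  classical
  set S : Finset (Fin d → ℝ) := (Fintype.piFinset fun _ : Fin d =>
    Finset.Icc 1 (a.q ^ a.meshLevel d)).image
      fun n i => (n i : ℝ) / (a.q : ℝ) ^ a.meshLevel d with hS
  have hsub : a.mesh m ⊆ S := by
    rintro x ⟨-, hx⟩
    choose n h1 h2 h3 using hx
    rw [hS, Finset.coe_image]
    exact ⟨n, Finset.mem_coe.2 (Fintype.mem_piFinset.2 fun i =>
      Finset.mem_Icc.2 ⟨h1 i, h2 i⟩), funext fun i => (h3 i).symm⟩
  refine ⟨S.filter (· ∈ a.mesh m), ?_, ?_⟩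
  · ext x
    simp only [Finset.coe_filter, Set.mem_ofPred_eq]
    exact ⟨fun h => h.2, fun h => ⟨hsub h, h⟩⟩
  · refine (Finset.card_filter_le _ _).trans (Finset.card_image_le.trans ?_)
    simp

end Mesh

/-! ### Deviation of the estimator from payoffs and projections -/

/-- The bias of the estimator enters through the moments of `f - e` over the window, its random
part through a free parameter `s`. -/
lemma exists_measure_lpr_le (d p : ℕ) {ρlo ρhi C₀ : ℝ} (hρlo : 0 < ρlo) (hρ : ρlo ≤ ρhi)
    (hC₀ : 0 < C₀) : ∃ C c : ℝ, 0 < C ∧ 0 < c ∧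
      ∀ {Ω : Type*} [MeasurableSpace Ω] {P : Measure Ω} [IsProbabilityMeasure P]
      {pX : (Fin d → ℝ) → ℝ} {f : Fin 2 → (Fin d → ℝ) → ℝ} {X : ℕ → Ω → Fin d → ℝ}
      {Y : ℕ → Ω → Fin 2 → ℝ} (a : Params), 1 ≤ a.q → BoundedDensity ρlo ρhi pX →
      IsModel P pX f X Y → ∀ {m : Fin d → ℕ}, m ∈ bins d a.q (a.level d) → ∀ {r : ℕ}, 1 ≤ r →
      ∀ k : Fin 2, ContinuousOn (f k) (cube d) → ∀ x ∈ bin a.q (a.level d) m, ∀ {h : ℝ}, 0 < h →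
      h ≤ ((a.q : ℝ) ^ a.level d)⁻¹ → ∀ (e : multiIdx d p → ℝ) {ε s : ℝ}, 0 ≤ ε → 0 ≤ s → s ≤ 1 →
      (∀ u ∈ bin a.q (a.level d) m, ‖h⁻¹ • (u - x)‖ ≤ 1 → 1 + |lin e (h⁻¹ • (u - x))| ≤ C₀) →
      (∀ α : multiIdx d p, |∫ u in bin a.q (a.level d) m, feat α.1 (h⁻¹ • (u - x)) *
        kernel (h⁻¹ • (u - x)) * (f k u - lin e (h⁻¹ • (u - x))) * pX u| ≤
        ε * ∫ u in bin a.q (a.level d) m, kernel (h⁻¹ • (u - x)) * pX u) → ∀ n : ℕ,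
      P {ω | r < a.roundAt (fun s => X s ω) m n ∧ C * (ε + s) <
        |lpr (a.sample (fun s => X s ω) (fun s => Y s ω) m r k n) h p x - trunc (lin e 0)|} ≤
      ENNReal.ofReal (C * Real.exp
        (-(c * ((a.q : ℝ) ^ r * ((h * (a.q : ℝ) ^ a.level d) ^ d * s ^ 2))))) := by
  obtain ⟨lam₀, hlam₀, hlow₀⟩ := exists_window_lower d p
  set N : ℕ := Fintype.card (multiIdx d p) with hN
  have hρhi : 0 < ρhi := hρlo.trans_le hρ
  set κ : ℝ := 2 ^ d * ρhi / ρlo with hκdef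
  have hκ : 0 < κ := by positivity
  set lam : ℝ := ρlo * lam₀ / ρhi with hlamdef
  have hlam : 0 < lam := by positivity
  set δ : ℝ := min (lam / (2 * (N + 1))) (2 * κ) with hδdef
  have hδ : 0 < δ := by positivity
  refine ⟨2 * N / lam * (κ + 2 * κ * C₀) + 2 * N ^ 2 + 2 * N + 1, min (δ ^ 2 / (4 * κ)) κ,
    by positivity, by positivity, ?_⟩
  set C : ℝ := 2 * N / lam * (κ + 2 * κ * C₀) + 2 * N ^ 2 + 2 * N + 1 with hC
  intro Ω _ P _ pX f X Y a hq hpX hM m hm r hr k hf x hx h hh hhl e ε s hε hs hs1 hbd hbias n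
  have hqpos : (0 : ℝ) < a.q := by exact_mod_cast hq
  set Q : ℝ := (a.q : ℝ) ^ a.level d with hQ
  have hQpos : 0 < Q := by positivity
  -- the ratio of the volumes of the window and the hypercube
  set w : ℝ := (h * Q) ^ d with hwdef
  have hw : 0 < w := by positivity
  have hp_hi := mass_le hpX hρlo hq hm
  have hp_lo := le_mass hpX hρlo hq hm
  have hwQ : w * Q⁻¹ ^ d = h ^ d := by
    rw [hwdef, ← mul_pow, mul_assoc, mul_inv_cancel₀ hQpos.ne', mul_one]
  have hKi : IntegrableOn (fun u => kernel (h⁻¹ • (u - x))) (bin a.q (a.level d) m) := by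
    refine Integrable.mono' (integrableOn_one_bin (q := a.q) (l := a.level d) (m := m))
      (measurable_kernel.comp (measurable_window _ _)).aestronglyMeasurable
      (Filter.Eventually.of_forall fun u => ?_)
    rw [Real.norm_of_nonneg (kernel_nonneg _)]
    exact kernel_le_one _
  have hup : ∫ u in bin a.q (a.level d) m, kernel (h⁻¹ • (u - x)) * pX u ≤
      κ * w * ∫ u in bin a.q (a.level d) m, pX u := by
    calc _ ≤ ρhi * (2 * h) ^ d := (integral_density_le hpX hρlo hq hm hKi fun _ _ =>
          kernel_nonneg _).trans (mul_le_mul_of_nonneg_left (integral_kernel_le hh x _) hρhi.le)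
      _ = κ * w * (ρlo * Q⁻¹ ^ d) := by
          rw [mul_pow, ← hwQ, hκdef]; field_simp
      _ ≤ _ := by gcongr
  have hlow : ∀ c : multiIdx d p → ℝ, lam * w * (∫ u in bin a.q (a.level d) m, pX u) *
      ∑ α, c α ^ 2 ≤ ∫ u in bin a.q (a.level d) m,
        lin c (h⁻¹ • (u - x)) ^ 2 * kernel (h⁻¹ • (u - x)) * pX u := by
    intro c
    have hci : IntegrableOn (fun u => lin c (h⁻¹ • (u - x)) ^ 2) (bin a.q (a.level d) m) :=
      ((((continuous_lin c).comp (by fun_prop)).pow 2).continuousOn).integrableOn_compact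
        (isCompact_bin _ _ _)
    have hi : IntegrableOn (fun u => lin c (h⁻¹ • (u - x)) ^ 2 * kernel (h⁻¹ • (u - x)))
        (bin a.q (a.level d) m) := by
      refine hci.mul_bdd (c := 1)
        (measurable_kernel.comp (measurable_window _ _)).aestronglyMeasurable
        (Filter.Eventually.of_forall fun u => ?_)
      rw [Real.norm_of_nonneg (kernel_nonneg _)]
      exact kernel_le_one _
    have hS : 0 ≤ ∑ α, c α ^ 2 := Finset.sum_nonneg fun _ _ => sq_nonneg _
    calc lam * w * (∫ u in bin a.q (a.level d) m, pX u) * ∑ α, c α ^ 2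
        ≤ lam * w * (ρhi * Q⁻¹ ^ d) * ∑ α, c α ^ 2 := by gcongr
      _ = ρlo * (lam₀ * h ^ d * ∑ α, c α ^ 2) := by
          rw [← hwQ, hlamdef]; field_simp
      _ ≤ _ := (mul_le_mul_of_nonneg_left (hlow₀ a.q (a.level d) m hq x hx h hh hhl c)
          hρlo.le).trans (le_integral_density hpX hρlo hq hm hi fun _ _ =>
            mul_nonneg (sq_nonneg _) (kernel_nonneg _))
  have hδN : δ * N ≤ lam / 2 := by
    calc δ * N ≤ lam / (2 * (N + 1)) * (N + 1) := by
          gcongr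
          · exact min_le_left _ _
          · linarith
      _ = lam / 2 := by field_simp
  have hfm : AEStronglyMeasurable (f k) (volume.restrict (cube d)) :=
    hf.aestronglyMeasurable measurableSet_cube
  -- the constant deviation `δ` of the Gram matrix is less likely than the deviation `s ≤ 1` of the
  -- residuals, up to the value of `c`
  have main := measure_lpr_le a hq hpX hρlo hM hm hr k hfm hh e (ε := κ * ε) hC₀ hlam hκ hw
    hδ.le (min_le_right _ _) hδN hs hs1 hup hlow hbd (fun α =>
      (hbias α).trans ((mul_le_mul_of_nonneg_left hup hε).trans_eq (by ring)))
    ((hf.mono (bin_subset_cube hq hm)).integrableOn_compact (isCompact_bin _ _ _)) n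
  refine (measure_mono ?_).trans (main.trans (ENNReal.ofReal_le_ofReal ?_))
  · rintro ω ⟨h1, h2⟩
    refine ⟨h1, lt_of_le_of_lt ?_ h2⟩
    have h3 : 2 * N / lam * (κ * ε + 2 * κ * C₀ * s) ≤ 2 * N / lam * (κ + 2 * κ * C₀) * (ε + s) := by
      rw [mul_assoc (2 * (N : ℝ) / lam)]
      refine mul_le_mul_of_nonneg_left ?_ (by positivity)
      nlinarith [mul_nonneg hκ.le hs, mul_nonneg (mul_nonneg hκ.le hC₀.le) hε]
    refine h3.trans (mul_le_mul_of_nonneg_right ?_ (by positivity))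
    rw [hC]
    have : (0 : ℝ) ≤ N := Nat.cast_nonneg _
    nlinarith
  · have hqr : 0 ≤ (a.q : ℝ) ^ r * w := by positivity
    have hc1 := min_le_left (δ ^ 2 / (4 * κ)) κ
    have hc2 := min_le_right (δ ^ 2 / (4 * κ)) κ
    set c := min (δ ^ 2 / (4 * κ)) κ
    have hcpos : 0 ≤ c := by positivity
    have e1 : Real.exp (-((a.q : ℝ) ^ r * (w * (δ ^ 2 / (4 * κ))))) ≤
        Real.exp (-(c * ((a.q : ℝ) ^ r * (w * s ^ 2)))) := by
      refine Real.exp_le_exp.2 (neg_le_neg ?_)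
      have h1 : c * s ^ 2 ≤ δ ^ 2 / (4 * κ) :=
        (mul_le_of_le_one_right hcpos (pow_le_one₀ hs hs1)).trans hc1
      calc c * ((a.q : ℝ) ^ r * (w * s ^ 2)) = (a.q : ℝ) ^ r * w * (c * s ^ 2) := by ring
        _ ≤ (a.q : ℝ) ^ r * w * (δ ^ 2 / (4 * κ)) := by gcongr
        _ = _ := by ring
    have e2 : Real.exp (-((a.q : ℝ) ^ r * (w * (κ * s ^ 2)))) ≤
        Real.exp (-(c * ((a.q : ℝ) ^ r * (w * s ^ 2)))) := by
      refine Real.exp_le_exp.2 (neg_le_neg ?_)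
      calc c * ((a.q : ℝ) ^ r * (w * s ^ 2)) = (a.q : ℝ) ^ r * w * (c * s ^ 2) := by ring
        _ ≤ (a.q : ℝ) ^ r * w * (κ * s ^ 2) := by gcongr
        _ = _ := by ring
    have hNC : 2 * (N : ℝ) ^ 2 + 2 * N ≤ C := by
      rw [hC]
      have : 0 ≤ 2 * N / lam * (κ + 2 * κ * C₀) := by positivity
      linarith
    have hN0 : (0 : ℝ) ≤ N := Nat.cast_nonneg _
    refine (add_le_add (mul_le_mul_of_nonneg_left (mul_le_mul_of_nonneg_left e1 zero_le_two)
      (sq_nonneg (N : ℝ))) (mul_le_mul_of_nonneg_left (mul_le_mul_of_nonneg_left e2 zero_le_two)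
        hN0)).trans ?_
    rw [show ∀ E : ℝ, (N : ℝ) ^ 2 * (2 * E) + N * (2 * E) = (2 * N ^ 2 + 2 * N) * E from
      fun E => by ring]
    exact mul_le_mul_of_nonneg_right hNC (Real.exp_pos _).le

/-- Deviation of the estimator from the payoff, with the Taylor polynomial as target. -/
lemma exists_measure_lpr_sub_payoff_le (d p : ℕ) {L ρlo ρhi : ℝ} (hL : 0 < L) (hρlo : 0 < ρlo)
    (hρ : ρlo ≤ ρhi) : ∃ C c : ℝ, 0 < C ∧ 0 < c ∧
      ∀ {Ω : Type*} [MeasurableSpace Ω] {P : Measure Ω} [IsProbabilityMeasure P]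
      {pX : (Fin d → ℝ) → ℝ} {f : Fin 2 → (Fin d → ℝ) → ℝ} {X : ℕ → Ω → Fin d → ℝ}
      {Y : ℕ → Ω → Fin 2 → ℝ} (a : Params), 1 ≤ a.q → BoundedDensity ρlo ρhi pX →
      IsModel P pX f X Y → ∀ {β : ℝ}, 0 < β → floorLt β ≤ p → ∀ k : Fin 2, IsHolder β L (f k) →
      ∀ {m : Fin d → ℕ}, m ∈ bins d a.q (a.level d) → ∀ {r : ℕ}, 1 ≤ r →
      ∀ x ∈ bin a.q (a.level d) m, ∀ {h : ℝ}, 0 < h →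
      h ≤ ((a.q : ℝ) ^ a.level d)⁻¹ → ∀ {s : ℝ}, 0 ≤ s → s ≤ 1 → ∀ n : ℕ,
      P {ω | r < a.roundAt (fun s => X s ω) m n ∧ C * (h ^ β + s) <
        |lpr (a.sample (fun s => X s ω) (fun s => Y s ω) m r k n) h p x - f k x|} ≤
      ENNReal.ofReal (C * Real.exp
        (-(c * ((a.q : ℝ) ^ r * ((h * (a.q : ℝ) ^ a.level d) ^ d * s ^ 2))))) := by
  obtain ⟨C, c, hC, hc, H⟩ := exists_measure_lpr_le d p hρlo hρ (by positivity : 0 < 2 + L)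
  refine ⟨C * (L + 1), c, by positivity, hc, ?_⟩
  intro Ω _ P _ pX f X Y a hq hpX hM β hβ hp k hf m hm r hr x hx h hh hhl s hs hs1 n
  have hxc := bin_subset_cube hq hm hx
  have hf01 := payoff_mem_Icc hpX hρlo hM k hf.continuousOn
  obtain ⟨e, he0, he⟩ := hf.exists_lin hβ hp hxc hh
  have hqpos : (1 : ℝ) ≤ a.q := by exact_mod_cast hq
  have hh1 : h ≤ 1 := hhl.trans (inv_le_one_of_one_le₀ (one_le_pow₀ hqpos))
  have hwin : ∀ u ∈ bin a.q (a.level d) m, ‖h⁻¹ • (u - x)‖ ≤ 1 →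
      |f k u - lin e (h⁻¹ • (u - x))| ≤ L * h ^ β := by
    intro u hu h1
    refine (he u (bin_subset_cube hq hm hu)).trans ?_
    rw [norm_smul, Real.norm_of_nonneg (by positivity), inv_mul_le_iff₀ hh, mul_one] at h1
    gcongr
  have hhβ : 0 < h ^ β := by positivity
  have hhβ1 : h ^ β ≤ 1 := Real.rpow_le_one hh.le hh1 hβ.le
  have main := H a hq hpX hM hm hr k hf.continuousOn x hx hh hhl e (ε := L * h ^ β) (by positivity)
    hs hs1 ?_ ?_ n
  · refine (measure_mono ?_).trans (main.trans (ENNReal.ofReal_le_ofReal ?_))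
    · rintro ω ⟨h1, h2⟩
      refine ⟨h1, ?_⟩
      rw [he0, trunc_eq_self (hf01 x hxc)]
      refine lt_of_le_of_lt ?_ h2
      rw [mul_assoc]
      gcongr
      nlinarith
    · gcongr
      nlinarith
  · intro u hu h1
    have h2 := hwin u hu h1
    have h3 := hf01 u (bin_subset_cube hq hm hu)
    have h4 : |lin e (h⁻¹ • (u - x))| ≤ 1 + L := by
      rw [abs_le] at h2 ⊢
      have : L * h ^ β ≤ L := by nlinarith
      constructor <;> linarith [h3.1, h3.2]
    linarith
  · intro α
    have hi : IntegrableOn (fun u => kernel (h⁻¹ • (u - x)) * pX u) (bin a.q (a.level d) m) := by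
      refine integrableOn_density hpX hρlo hq hm ?_
      refine Integrable.mono' (integrableOn_one_bin (q := a.q) (l := a.level d) (m := m))
        (measurable_kernel.comp (measurable_window _ _)).aestronglyMeasurable
        (Filter.Eventually.of_forall fun u => ?_)
      rw [Real.norm_of_nonneg (kernel_nonneg _)]
      exact kernel_le_one _
    rw [← integral_const_mul, ← Real.norm_eq_abs]
    refine norm_integral_le_of_norm_le (hi.const_mul _) ?_
    filter_upwards [ae_restrict_mem (measurableSet_bin _ _ _)] with u hu
    have hpu := hρlo.le.trans (hpX.2 u (bin_subset_cube hq hm hu)).1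
    rw [Real.norm_eq_abs, abs_mul, abs_mul, abs_of_nonneg hpu, ← mul_assoc]
    refine mul_le_mul_of_nonneg_right ?_ hpu
    rcases le_or_gt ‖h⁻¹ • (u - x)‖ 1 with h1 | h1
    · rw [mul_comm]
      exact mul_le_mul (hwin u hu h1) (abs_feat_mul_kernel_le _ _) (abs_nonneg _) (by positivity)
    · simp [kernel_of_lt_norm h1]

/-- Deviation of the estimator with the larger bandwidth from the truncated projection of the
payoff. There is no bias: the window is the whole hypercube, so that the residuals of the
projection are orthogonal to the polynomials. -/
lemma exists_measure_lpr_sub_projection_le (d p : ℕ) {L ρlo ρhi : ℝ} (hL : 0 < L)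
    (hρlo : 0 < ρlo) (hρ : ρlo ≤ ρhi) : ∃ C c : ℝ, 0 < C ∧ 0 < c ∧
      ∀ {Ω : Type*} [MeasurableSpace Ω] {P : Measure Ω} [IsProbabilityMeasure P]
      {pX : (Fin d → ℝ) → ℝ} {f : Fin 2 → (Fin d → ℝ) → ℝ} {X : ℕ → Ω → Fin d → ℝ}
      {Y : ℕ → Ω → Fin 2 → ℝ} (a : Params), 1 ≤ a.q → BoundedDensity ρlo ρhi pX →
      IsModel P pX f X Y → ∀ {β : ℝ}, 0 < β → floorLt β ≤ p → ∀ k : Fin 2, IsHolder β L (f k) →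
      ∀ {m : Fin d → ℕ}, m ∈ bins d a.q (a.level d) → ∀ {r : ℕ}, 1 ≤ r →
      ∀ {g : MvPolynomial (Fin d) ℝ}, IsOrthogonal pX (bin a.q (a.level d) m) p (f k) g →
      ∀ x ∈ bin a.q (a.level d) m, ∀ {s : ℝ}, 0 ≤ s → s ≤ 1 → ∀ n : ℕ,
      P {ω | r < a.roundAt (fun s => X s ω) m n ∧ C * s <
        |lpr (a.sample (fun s => X s ω) (fun s => Y s ω) m r k n) (((a.q : ℝ) ^ a.level d)⁻¹) p x -
          trunc (MvPolynomial.eval x g)|} ≤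
      ENNReal.ofReal (C * Real.exp (-(c * ((a.q : ℝ) ^ r * s ^ 2)))) := by
  obtain ⟨C₁, hC₁, hmod⟩ := exists_projection_modulus d p hL hρlo hρ
  obtain ⟨C, c, hC, hc, H⟩ := exists_measure_lpr_le d p hρlo hρ (by positivity : 0 < 2 + C₁)
  refine ⟨C, c, hC, hc, ?_⟩
  intro Ω _ P _ pX f X Y a hq hpX hM β hβ hp k hf m hm r hr g hg x hx s hs hs1 n
  have hqpos : (1 : ℝ) ≤ a.q := by exact_mod_cast hq
  have hQ : (0 : ℝ) < (a.q : ℝ) ^ a.level d := by positivity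
  set h : ℝ := ((a.q : ℝ) ^ a.level d)⁻¹ with hh
  have hhpos : 0 < h := inv_pos.2 hQ
  have hh1 : h ≤ 1 := inv_le_one_of_one_le₀ (one_le_pow₀ hqpos)
  have hf01 := payoff_mem_Icc hpX hρlo hM k hf.continuousOn
  obtain ⟨e, he⟩ := exists_lin_poly hg.1 hhpos x
  have he0 : lin e 0 = MvPolynomial.eval x g := by
    rw [he, sub_self, smul_zero]
  have hwin : ∀ u ∈ bin a.q (a.level d) m, kernel (h⁻¹ • (u - x)) = 1 := by
    intro u hu
    refine kernel_of_norm_le ?_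
    rw [norm_smul, hh, inv_inv, Real.norm_of_nonneg hQ.le]
    calc (a.q : ℝ) ^ a.level d * ‖u - x‖ ≤ (a.q : ℝ) ^ a.level d * h := by
          gcongr; exact norm_sub_le_of_mem_bin hq hu hx
      _ = 1 := mul_inv_cancel₀ hQ.ne'
  have main := H a hq hpX hM hm hr k hf.continuousOn x hx hhpos le_rfl e le_rfl hs hs1 ?_ ?_ n
  · simp only [zero_add, he0, inv_mul_cancel₀ hQ.ne', hh, one_pow, one_mul] at main
    exact main
  · intro u hu _
    rw [← he]
    have h2 := (hmod β (f k) pX a.q (a.level d) m g hβ hp hf hpX hq hm hg u hu).1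
    have h3 := hf01 u (bin_subset_cube hq hm hu)
    have h4 : C₁ * h ^ β ≤ C₁ := mul_le_of_le_one_right hC₁.le (Real.rpow_le_one hhpos.le hh1 hβ.le)
    have h5 : |MvPolynomial.eval u g| ≤ 1 + C₁ := by
      rw [abs_le] at h2 ⊢
      constructor <;> linarith [h3.1, h3.2]
    linarith
  · intro α
    rw [zero_mul]
    refine le_of_eq (abs_eq_zero.2 ?_)
    obtain ⟨θ, hθ, hθe⟩ := exists_poly_lin (Pi.single α (1 : ℝ)) h x
    rw [← hg.2 θ hθ]
    refine setIntegral_congr_fun (measurableSet_bin _ _ _) fun u hu => ?_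
    have h1 : lin (Pi.single α (1 : ℝ)) (h⁻¹ • (u - x)) = feat α.1 (h⁻¹ • (u - x)) := by
      simp [lin, Pi.single_apply]
    simp only [hwin u hu, hθe, he, h1]
    ring

/-! ### Sizes of the tuning parameters -/

section Sizes

variable (a : Params) {d : ℕ}

/-- The threshold of the test at the end of round `r`. -/
def Params.threshold (a : Params) (d r : ℕ) : ℝ :=
  a.γ * Real.log a.T ^ ((d : ℝ) / (2 * a.βlo) + 1 / 2) / (a.q : ℝ) ^ ((r : ℝ) / 2)

variable {a}

/-- Comparison of powers of the base through their exponents. -/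
lemma Params.rpow_le_rpow (hq : 2 ≤ a.q) {x y : ℝ} (h : x ≤ y) : (a.q : ℝ) ^ x ≤ (a.q : ℝ) ^ y := by
  have h1 : (2 : ℝ) ≤ a.q := by exact_mod_cast hq
  exact Real.rpow_le_rpow_of_exponent_le (by linarith) h

lemma Params.inv_pow_rpow (hq : 2 ≤ a.q) (l : ℕ) (β : ℝ) :
    (((a.q : ℝ) ^ l)⁻¹) ^ β = (a.q : ℝ) ^ (-((l : ℝ) * β)) := by
  rw [Real.rpow_neg (Nat.cast_nonneg _), Real.rpow_mul (Nat.cast_nonneg _), Real.rpow_natCast,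
    ← Real.inv_rpow (by positivity)]

/-- The resolution of the partition is `levelRate d βlo βhi * log_q T`, rounded up. -/
def levelRate (d : ℕ) (βlo βhi : ℝ) : ℝ := (βlo + d - 1) / (2 * βhi + d) ^ 2

lemma Params.le_level : levelRate d a.βlo a.βhi * a.lg ≤ a.level d := by
  refine le_trans (le_of_eq ?_) (Nat.le_ceil _)
  rw [levelRate]
  ring

variable (hq : 2 ≤ a.q) (hG : 1 ≤ Real.log a.T)
include hq hG

lemma Params.T_rpow (x : ℝ) : (a.T : ℝ) ^ x = (a.q : ℝ) ^ (a.lg * x) := by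
  have h1 : (2 : ℝ) ≤ a.q := by exact_mod_cast hq
  have hT : (0 : ℝ) < a.T := by
    by_contra! h
    have : (a.T : ℝ) = 0 := le_antisymm h (Nat.cast_nonneg _)
    rw [this, Real.log_zero] at hG
    linarith
  rw [Real.rpow_mul (by linarith), Params.lg, Real.rpow_logb (by linarith) (by linarith) hT]

lemma Params.log_rpow (x : ℝ) : Real.log a.T ^ x = (a.q : ℝ) ^ (a.lglg * x) := by
  have h1 : (2 : ℝ) ≤ a.q := by exact_mod_cast hq
  rw [Real.rpow_mul (by linarith), Params.lglg,
    Real.rpow_logb (by linarith) (by linarith) (by linarith)]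

lemma Params.lglg_nonneg : 0 ≤ a.lglg := by
  have h1 : (2 : ℝ) ≤ a.q := by exact_mod_cast hq
  exact Real.logb_nonneg (by linarith) hG

lemma Params.lg_nonneg : 0 ≤ a.lg := by
  have h1 : (2 : ℝ) ≤ a.q := by exact_mod_cast hq
  exact div_nonneg (zero_le_one.trans hG) (Real.log_nonneg (by linarith))

lemma Params.threshold_eq (r : ℕ) : a.threshold d r =
    a.γ * (a.q : ℝ) ^ (a.lglg * ((d : ℝ) / (2 * a.βlo) + 1 / 2) - r / 2) := by
  have h1 : (0 : ℝ) < a.q := by exact_mod_cast (zero_lt_two.trans_le hq)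
  rw [Params.threshold, a.log_rpow hq hG, Real.rpow_sub h1, mul_div_assoc]

/-- The squared threshold in units of the variance `q ^ (-r)`. -/
lemma Params.pow_mul_threshold_sq (r : ℕ) : (a.q : ℝ) ^ r * a.threshold d r ^ 2 =
    a.γ ^ 2 * (Real.log a.T ^ ((d : ℝ) / a.βlo) * Real.log a.T) := by
  have h1 : (0 : ℝ) < a.q := by exact_mod_cast (zero_lt_two.trans_le hq)
  have h2 : Real.log a.T = (a.q : ℝ) ^ a.lglg := by
    simpa using a.log_rpow hq hG 1
  rw [a.threshold_eq hq hG, mul_pow, a.log_rpow hq hG, h2, ← Real.rpow_add h1, ← Real.rpow_natCast,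
    ← Real.rpow_natCast ((a.q : ℝ) ^ _), ← Real.rpow_mul h1.le, mul_left_comm, ← Real.rpow_add h1]
  congr 2
  push_cast
  field_simp
  ring

/-- Before the round `2 l β + (d / βlo - 2) log_q log T`, the threshold dominates the bias. -/
lemma Params.le_threshold (hγ : 0 < a.γ) {r : ℕ} {β : ℝ}
    (hr : (r : ℝ) ≤ 2 * a.level d * β + ((d : ℝ) / a.βlo - 2) * a.lglg) :
    a.γ * Real.log a.T * (((a.q : ℝ) ^ a.level d)⁻¹) ^ β ≤ a.threshold d r := by
  have h1 : (0 : ℝ) < a.q := by exact_mod_cast (zero_lt_two.trans_le hq)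
  have h2 : Real.log a.T = (a.q : ℝ) ^ a.lglg := by
    simpa using a.log_rpow hq hG 1
  have h3 := a.lglg_nonneg hq hG
  rw [a.threshold_eq hq hG, a.inv_pow_rpow hq, h2, mul_assoc, ← Real.rpow_add h1]
  refine mul_le_mul_of_nonneg_left (a.rpow_le_rpow hq ?_) hγ.le
  have h4 : (d : ℝ) / (2 * a.βlo) = (d : ℝ) / a.βlo / 2 := by rw [div_div, mul_comm a.βlo]
  rw [h4]
  nlinarith

/-- From the round `2 l β + υ log_q log T` on, the threshold is below the bias, if
`υ = d / βlo + 4`. -/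
lemma Params.threshold_le (hγ : 0 < a.γ) (hυ : a.υ = (d : ℝ) / a.βlo + 4) {r : ℕ} {β : ℝ}
    (hr : 2 * a.level d * β + a.υ * a.lglg ≤ r + 1) :
    a.threshold d r * Real.log a.T ≤ a.γ * a.q * (((a.q : ℝ) ^ a.level d)⁻¹) ^ β := by
  have h1 : (0 : ℝ) < a.q := by exact_mod_cast (zero_lt_two.trans_le hq)
  have h2 : Real.log a.T = (a.q : ℝ) ^ a.lglg := by
    simpa using a.log_rpow hq hG 1
  have h3 := a.lglg_nonneg hq hG
  have h5 : (a.q : ℝ) * (a.q : ℝ) ^ (-((a.level d : ℝ) * β)) =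
      (a.q : ℝ) ^ (1 + -((a.level d : ℝ) * β)) := by
    rw [Real.rpow_add h1, Real.rpow_one]
  rw [a.threshold_eq hq hG, a.inv_pow_rpow hq, h2, mul_assoc, ← Real.rpow_add h1, mul_assoc, h5]
  refine mul_le_mul_of_nonneg_left (a.rpow_le_rpow hq ?_) hγ.le
  have h4 : (d : ℝ) / (2 * a.βlo) = (d : ℝ) / a.βlo / 2 := by rw [div_div, mul_comm a.βlo]
  rw [h4]
  rw [hυ] at hr
  nlinarith

/-- The bias of the smaller bandwidth is smaller by a factor `log T`. -/
lemma Params.inv_level₂_rpow_le {β : ℝ} (hβlo : 0 < a.βlo) (hβ : a.βlo ≤ β) :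
    (((a.q : ℝ) ^ a.level₂ d)⁻¹) ^ β * Real.log a.T ≤ (((a.q : ℝ) ^ a.level d)⁻¹) ^ β := by
  have h1 : (0 : ℝ) < a.q := by exact_mod_cast (zero_lt_two.trans_le hq)
  have h2 : Real.log a.T = (a.q : ℝ) ^ a.lglg := by
    simpa using a.log_rpow hq hG 1
  have h3 := a.lglg_nonneg hq hG
  rw [a.inv_pow_rpow hq, a.inv_pow_rpow hq, h2, ← Real.rpow_add h1]
  refine a.rpow_le_rpow hq ?_
  have h4 := Nat.le_ceil (1 / a.βlo * a.lglg)
  have h5 : (a.level₂ d : ℝ) = a.level d + (⌈1 / a.βlo * a.lglg⌉₊ : ℝ) := by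
    simp [Params.level₂]
  have h6 : a.lglg ≤ (⌈1 / a.βlo * a.lglg⌉₊ : ℝ) * a.βlo := by
    calc a.lglg = 1 / a.βlo * a.lglg * a.βlo := by field_simp
      _ ≤ _ := by gcongr
  have h7 : (⌈1 / a.βlo * a.lglg⌉₊ : ℝ) * a.βlo ≤ (⌈1 / a.βlo * a.lglg⌉₊ : ℝ) * β := by gcongr
  rw [h5]
  linarith

/-- The smaller window has a fraction of order `(log T) ^ (-d / βlo)` of the volume of the hypercube. -/
lemma Params.le_bandwidth_ratio (hβlo : 0 < a.βlo) :
    1 ≤ (a.q : ℝ) ^ d * Real.log a.T ^ ((d : ℝ) / a.βlo) *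
      (((a.q : ℝ) ^ a.level₂ d)⁻¹ * (a.q : ℝ) ^ a.level d) ^ d := by
  have h1 : (0 : ℝ) < a.q := by exact_mod_cast (zero_lt_two.trans_le hq)
  have h3 := a.lglg_nonneg hq hG
  have h4 : (⌈1 / a.βlo * a.lglg⌉₊ : ℝ) ≤ 1 / a.βlo * a.lglg + 1 :=
    (Nat.ceil_lt_add_one (by positivity)).le
  have h5 : (((a.q : ℝ) ^ a.level₂ d)⁻¹ * (a.q : ℝ) ^ a.level d) ^ d =
      (a.q : ℝ) ^ (-((⌈1 / a.βlo * a.lglg⌉₊ : ℝ) * d)) := by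
    rw [Params.level₂, pow_add, mul_inv, mul_right_comm,
      inv_mul_cancel₀ (by positivity), one_mul, inv_pow, ← pow_mul, Real.rpow_neg h1.le,
      ← Nat.cast_mul, Real.rpow_natCast]
  rw [h5, a.log_rpow hq hG, ← Real.rpow_natCast (a.q : ℝ) d, ← Real.rpow_add h1,
    ← Real.rpow_add h1]
  refine Real.one_le_rpow (by exact_mod_cast (one_le_two.trans hq)) ?_
  have h6 : (⌈1 / a.βlo * a.lglg⌉₊ : ℝ) * d ≤ (1 / a.βlo * a.lglg + 1) * d := by gcongr
  have h7 : (1 / a.βlo * a.lglg + 1) * d = d + a.lglg * (d / a.βlo) := by ring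
  linarith

lemma Params.level_mul_log_le_mesh (hβhi : 0 ≤ a.βhi) :
    (a.q : ℝ) ^ a.level d * Real.log a.T ≤ (a.q : ℝ) ^ a.meshLevel d := by
  have h1 : (0 : ℝ) < a.q := by exact_mod_cast (zero_lt_two.trans_le hq)
  have h2 : Real.log a.T = (a.q : ℝ) ^ a.lglg := by
    simpa using a.log_rpow hq hG 1
  rw [h2, ← Real.rpow_natCast, ← Real.rpow_natCast, ← Real.rpow_add h1]
  refine a.rpow_le_rpow hq ?_
  have h3 : (1 + a.βhi) * (a.level d : ℝ) + a.lglg ≤ (a.meshLevel d : ℝ) :=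
    (Nat.le_ceil _).trans (Nat.cast_le.2 (le_max_right _ _))
  have h4 : 0 ≤ a.βhi * (a.level d : ℝ) := by positivity
  linarith

lemma Params.level_le_meshLevel (hβhi : 0 ≤ a.βhi) : a.level d ≤ a.meshLevel d := by
  have h3 : (1 + a.βhi) * (a.level d : ℝ) + a.lglg ≤ (a.meshLevel d : ℝ) :=
    (Nat.le_ceil _).trans (Nat.cast_le.2 (le_max_right _ _))
  have h4 : 0 ≤ a.βhi * (a.level d : ℝ) := by positivity
  have h5 := a.lglg_nonneg hq hG
  exact_mod_cast (by linarith : (a.level d : ℝ) ≤ a.meshLevel d)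

lemma Params.level_le (hβlo : 0 < a.βlo) (hd : 1 ≤ d) :
    (a.level d : ℝ) ≤ levelRate d a.βlo a.βhi * a.lg + 1 := by
  have h1 : (1 : ℝ) ≤ d := by exact_mod_cast hd
  have h2 := a.lg_nonneg hq hG
  refine (Nat.ceil_lt_add_one (div_nonneg (mul_nonneg (by linarith) h2) (sq_nonneg _))).le.trans
    (le_of_eq ?_)
  rw [levelRate]
  ring

lemma Params.rmax_le (hβlo : 0 < a.βlo) (hβ : a.βlo ≤ a.βhi) (hυ : 0 ≤ a.υ) :
    (a.rmax d : ℝ) ≤ 2 * (a.level d : ℝ) * a.βhi + a.υ * a.lglg + 1 := by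
  have h2 := a.lglg_nonneg hq hG
  have h3 : 0 ≤ a.βhi := hβlo.le.trans hβ
  exact (Nat.ceil_lt_add_one (by positivity)).le

lemma Params.meshLevel_le (hβlo : 0 < a.βlo) (hβ : a.βlo ≤ a.βhi) :
    (a.meshLevel d : ℝ) ≤ (a.βhi / a.βlo + 1 + a.βhi) * a.level d + (1 / a.βlo + 1) * a.lglg + 1 := by
  have h2 := a.lglg_nonneg hq hG
  have h3 : 0 ≤ a.βhi := hβlo.le.trans hβ
  have e1 : 0 ≤ a.βhi * (a.level d : ℝ) / a.βlo + a.lglg / a.βlo := by positivity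
  have e2 : 0 ≤ (1 + a.βhi) * (a.level d : ℝ) + a.lglg := by positivity
  have h4 := (Nat.ceil_lt_add_one e1).le
  have h5 := (Nat.ceil_lt_add_one e2).le
  have h6 : (a.βhi / a.βlo + 1 + a.βhi) * (a.level d : ℝ) + (1 / a.βlo + 1) * a.lglg + 1 =
      (a.βhi * (a.level d : ℝ) / a.βlo + a.lglg / a.βlo) +
        ((1 + a.βhi) * (a.level d : ℝ) + a.lglg) + 1 := by ring
  rw [h6, Params.meshLevel, Nat.cast_max]
  exact max_le (by linarith) (by linarith)

lemma Params.lglg_le_lg : a.lglg ≤ a.lg := by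
  have h1 : (2 : ℝ) ≤ a.q := by exact_mod_cast hq
  exact div_le_div_of_nonneg_right (Real.log_le_log (by linarith)
    (Real.log_le_self (Nat.cast_nonneg _))) (Real.log_nonneg (by linarith))

lemma Params.pow_level_le (hβlo : 0 < a.βlo) (hd : 1 ≤ d) (hlg : 1 ≤ a.lg) :
    (a.q : ℝ) ^ (a.level d * d) ≤ (a.T : ℝ) ^ ((levelRate d a.βlo a.βhi + 1) * d) := by
  rw [a.T_rpow hq hG, ← Real.rpow_natCast]
  refine a.rpow_le_rpow hq ?_
  have h3 := a.level_le hq hG hβlo hd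
  push_cast
  calc (a.level d : ℝ) * d ≤ (levelRate d a.βlo a.βhi * a.lg + a.lg) * d := by
        gcongr; linarith
    _ = _ := by ring

/-- The exponent in the bound for the number of events in the union bound. -/
def countRate (d : ℕ) (βlo βhi υ : ℝ) : ℝ :=
  (levelRate d βlo βhi + 1) * d + (2 * (levelRate d βlo βhi + 1) * βhi + υ + 1) +
    ((βhi / βlo + 1 + βhi) * (levelRate d βlo βhi + 1) + (1 / βlo + 1) + 1) * d

/-- The number of hypercubes, rounds and mesh points is bounded by a power of `T`. -/
lemma Params.count_le (hβlo : 0 < a.βlo) (hβ : a.βlo ≤ a.βhi) (hυ : 0 ≤ a.υ) (hd : 1 ≤ d)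
    (hlg : 1 ≤ a.lg) : (a.q : ℝ) ^ (a.level d * d) * a.rmax d * ((a.q : ℝ) ^ a.meshLevel d) ^ d ≤
      (a.T : ℝ) ^ countRate d a.βlo a.βhi a.υ := by
  have h1 : (0 : ℝ) < a.q := by exact_mod_cast (zero_lt_two.trans_le hq)
  have hβhi : 0 ≤ a.βhi := hβlo.le.trans hβ
  have h2 : (a.rmax d : ℝ) ≤ (a.q : ℝ) ^ a.rmax d := by
    exact_mod_cast (Nat.lt_pow_self (by omega : 1 < a.q)).le
  have h3 := a.level_le hq hG hβlo hd
  have h4 := a.rmax_le (d := d) hq hG hβlo hβ hυ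
  have h5 := a.meshLevel_le (d := d) hq hG hβlo hβ
  have h6 := a.lglg_le_lg hq hG
  set A := levelRate d a.βlo a.βhi with hA
  have hl : (a.level d : ℝ) ≤ (A + 1) * a.lg := by linarith
  have hr : (a.rmax d : ℝ) ≤ (2 * (A + 1) * a.βhi + a.υ + 1) * a.lg := by
    calc (a.rmax d : ℝ) ≤ 2 * ((A + 1) * a.lg) * a.βhi + a.υ * a.lg + a.lg := by
          refine h4.trans ?_; gcongr
      _ = _ := by ring
  have hM : (a.meshLevel d : ℝ) ≤
      ((a.βhi / a.βlo + 1 + a.βhi) * (A + 1) + (1 / a.βlo + 1) + 1) * a.lg := by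
    calc (a.meshLevel d : ℝ) ≤ (a.βhi / a.βlo + 1 + a.βhi) * ((A + 1) * a.lg) +
          (1 / a.βlo + 1) * a.lg + a.lg := by
          refine h5.trans ?_; gcongr
      _ = _ := by ring
  calc (a.q : ℝ) ^ (a.level d * d) * a.rmax d * ((a.q : ℝ) ^ a.meshLevel d) ^ d
      ≤ (a.q : ℝ) ^ (a.level d * d) * (a.q : ℝ) ^ a.rmax d * ((a.q : ℝ) ^ a.meshLevel d) ^ d := by
        gcongr
    _ = (a.q : ℝ) ^ ((a.level d * d + a.rmax d + a.meshLevel d * d : ℕ) : ℝ) := by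
        rw [Real.rpow_natCast, ← pow_mul, ← pow_add, ← pow_add]
    _ ≤ _ := by
        rw [a.T_rpow hq hG]
        refine a.rpow_le_rpow hq ?_
        push_cast
        rw [countRate, ← hA]
        calc (a.level d : ℝ) * d + a.rmax d + a.meshLevel d * d
            ≤ (A + 1) * a.lg * d + (2 * (A + 1) * a.βhi + a.υ + 1) * a.lg +
              ((a.βhi / a.βlo + 1 + a.βhi) * (A + 1) + (1 / a.βlo + 1) + 1) * a.lg * d := by
              gcongr
          _ = _ := by ring

/-- The horizon of the first claim dominates the number of samples in all rounds. -/
lemma Params.pow_rmax_le (hβlo : 0 < a.βlo) (hβlo1 : a.βlo ≤ 1) (hβ : a.βlo ≤ a.βhi)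
    (hυ : a.υ = (d : ℝ) / a.βlo + 4) (hd : 1 ≤ d) (hlglg : 3 + 2 * a.βhi + d ≤ a.lglg) :
    4 * (a.q : ℝ) ^ a.rmax d * (a.q : ℝ) ^ (a.level d * d) ≤
      Real.log a.T ^ (2 * (d : ℝ) / a.βlo + 4) *
        (a.T : ℝ) ^ ((a.βlo + d - 1) / (2 * a.βhi + d)) := by
  have h1 : (2 : ℝ) ≤ a.q := by exact_mod_cast hq
  have hdr : (1 : ℝ) ≤ d := by exact_mod_cast hd
  have hβhi : 0 ≤ a.βhi := hβlo.le.trans hβ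
  have h3 := a.level_le hq hG hβlo hd
  have h4 := a.rmax_le (d := d) hq hG hβlo hβ (by rw [hυ]; positivity)
  have h6 := a.lglg_nonneg hq hG
  have h7 : levelRate d a.βlo a.βhi * (2 * a.βhi + d) = (a.βlo + d - 1) / (2 * a.βhi + d) := by
    rw [levelRate]; field_simp
  have h8 : 1 ≤ (d : ℝ) / a.βlo := by rw [le_div_iff₀ hβlo]; linarith
  calc 4 * (a.q : ℝ) ^ a.rmax d * (a.q : ℝ) ^ (a.level d * d)
      ≤ (a.q : ℝ) ^ 2 * (a.q : ℝ) ^ a.rmax d * (a.q : ℝ) ^ (a.level d * d) := by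
        gcongr; nlinarith
    _ = (a.q : ℝ) ^ ((2 + a.rmax d + a.level d * d : ℕ) : ℝ) := by
        rw [Real.rpow_natCast, ← pow_add, ← pow_add]
    _ ≤ _ := by
        rw [a.T_rpow hq hG, a.log_rpow hq hG, ← Real.rpow_add (by linarith)]
        refine a.rpow_le_rpow hq ?_
        push_cast
        rw [← h7]
        have h9 : (a.level d : ℝ) * (2 * a.βhi + d) ≤
            (levelRate d a.βlo a.βhi * a.lg + 1) * (2 * a.βhi + d) := by gcongr
        have h10 : (2 * (d : ℝ)) / a.βlo = 2 * (d / a.βlo) := by ring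
        rw [hυ] at h4
        rw [h10]
        nlinarith [mul_le_mul_of_nonneg_right h8 h6]

lemma Params.T_rpow_le_pow_rmax (hβlo : 0 < a.βlo) (hβ : a.βlo ≤ a.βhi) (hυ : 0 ≤ a.υ) :
    (a.T : ℝ) ^ (2 * levelRate d a.βlo a.βhi * a.βhi) ≤ (a.q : ℝ) ^ a.rmax d := by
  have hβhi : 0 ≤ a.βhi := hβlo.le.trans hβ
  have h6 := a.lglg_nonneg hq hG
  have h3 := a.le_level (d := d)
  rw [a.T_rpow hq hG, ← Real.rpow_natCast]
  refine a.rpow_le_rpow hq (le_trans ?_ (Nat.le_ceil _))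
  nlinarith [mul_le_mul_of_nonneg_right h3 hβhi, mul_nonneg hυ h6]

end Sizes

/-! ### The estimate on the favourable event -/

section Favourable

variable {a : Params} {d : ℕ}

lemma sum_pow_le {q : ℕ} (hq : 2 ≤ q) (R : ℕ) : ∑ i ∈ Finset.Ico 1 (R + 1), q ^ i ≤ 2 * q ^ R := by
  induction R with
  | zero => simp
  | succ R ih =>
    rw [Finset.sum_Ico_succ_top (by omega)]
    have h1 : 2 * q ^ R ≤ q * q ^ R := Nat.mul_le_mul_right _ hq
    have h2 : q ^ (R + 1) = q * q ^ R := by ring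
    omega

/-- If every hypercube has been visited often enough and the estimators are as precise as the
threshold permits, then the phase has ended and the estimate is in the required interval. -/
lemma estimate_mem_Icc {x : ℕ → Fin d → ℝ} {y : ℕ → Fin 2 → ℝ} {f : Fin 2 → (Fin d → ℝ) → ℝ}
    {v : (Fin d → ℝ) → ℝ} {β C c : ℝ} {n : ℕ} {m' : Fin d → ℕ} {k' : Fin 2} {r' : ℕ}
    (hq : 2 ≤ a.q) (hG : 1 ≤ Real.log a.T) (hγ : 0 < a.γ) (hβlo : 0 < a.βlo)
    (hβ : a.βlo ≤ β) (hβhi : β ≤ a.βhi) (hυ : a.υ = (d : ℝ) / a.βlo + 4) (hd : 1 ≤ d)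
    (hlg : 1 ≤ a.lg) (hlglg : 1 ≤ a.lglg) (hC : 0 < C) (hc : 0 < c)
    (hG1 : 4 * C ≤ a.γ * Real.log a.T) (hG2 : 4 * a.γ * a.q ≤ c * Real.log a.T)
    (hG3 : 4 * C ≤ c * Real.log a.T) (hn : 1 ≤ n)
    (hr' : r' = ⌊2 * (a.level d : ℝ) * β + a.υ * a.lglg⌋₊)
    (hv : ∀ m ∈ bins d a.q (a.level d),
      2 * ∑ i ∈ Finset.Ico 1 (a.rmax d + 1), a.q ^ i ≤ visits a.q (a.level d) x m n)
    (hdev : ∀ m ∈ bins d a.q (a.level d), ∀ r, 1 ≤ r → r ≤ a.rmax d → a.threshold d r ≤ 1 →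
      ∀ k, ∀ z ∈ a.mesh m, r < a.roundAt x m n →
        |lpr (a.sample x y m r k n) (((a.q : ℝ) ^ a.level d)⁻¹) (floorLt a.βhi) z - f k z| ≤
          C * ((((a.q : ℝ) ^ a.level d)⁻¹) ^ β + a.threshold d r / (4 * C)) ∧
        |lpr (a.sample x y m r k n) (((a.q : ℝ) ^ a.level₂ d)⁻¹) (floorLt a.βhi) z - f k z| ≤
          C * ((((a.q : ℝ) ^ a.level₂ d)⁻¹) ^ β + a.threshold d r / (4 * C)))
    (hm' : m' ∈ bins d a.q (a.level d))
    (hgap : ∃ z ∈ a.mesh m', c * (((a.q : ℝ) ^ a.level d)⁻¹) ^ β ≤ |v z - f k' z|)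
    (hthr : a.threshold d r' ≤ 1)
    (hdev' : ∀ z ∈ a.mesh m', r' < a.roundAt x m' n →
      |lpr (a.sample x y m' r' k' n) (((a.q : ℝ) ^ a.level d)⁻¹) (floorLt a.βhi) z - v z| ≤
        C * (a.threshold d r' / (4 * C))) :
    ∃ t, a.StopsAt x y t ∧ a.estimate (a.run x y t) ∈
      Set.Icc (β - 3 * (2 * a.βhi + d) ^ 2 * a.lglg / ((a.βlo + d - 1) * a.lg)) β := by
  have hq1 : 1 ≤ a.q := one_le_two.trans hq
  have hqpos : (0 : ℝ) < a.q := by exact_mod_cast hq1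
  have hβ0 : 0 < β := hβlo.trans_le hβ
  have hGpos : 0 < Real.log a.T := zero_lt_one.trans_le hG
  have hdr : (1 : ℝ) ≤ d := by exact_mod_cast hd
  obtain ⟨t, ht, htn⟩ := exists_stopsAt a x y hq1 hn hv
  refine ⟨t, ht, ?_⟩
  set H : ℝ := (((a.q : ℝ) ^ a.level d)⁻¹) ^ β with hH
  set H₂ : ℝ := (((a.q : ℝ) ^ a.level₂ d)⁻¹) ^ β with hH₂
  have hHpos : 0 < H := by positivity
  have hH₂pos : 0 < H₂ := by positivity
  have hHH : H₂ * Real.log a.T ≤ H := a.inv_level₂_rpow_le hq hG hβlo hβ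
  have hH₂H : H₂ ≤ H := le_trans (le_mul_of_one_le_right hH₂pos.le hG) hHH
  have hCs : ∀ r, C * (a.threshold d r / (4 * C)) = a.threshold d r / 4 := fun r => by field_simp
  have hl0 : 0 ≤ 2 * (a.level d : ℝ) * β := by positivity
  have hυ4 : 4 ≤ a.υ := by rw [hυ]; linarith [div_nonneg (zero_le_one.trans hdr) hβlo.le]
  have hυl : 4 ≤ a.υ * a.lglg := by
    linarith [mul_le_mul hυ4 hlglg zero_le_one (by linarith)]
  -- before this round the threshold is at least `γ log T` times the bias
  set lo : ℝ := 2 * a.level d * β + ((d : ℝ) / a.βlo - 2) * a.lglg with hlo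
  have hrmax : 2 * (a.level d : ℝ) * β + a.υ * a.lglg ≤ a.rmax d := by
    refine le_trans ?_ (Nat.le_ceil _)
    gcongr
  have hlormax : lo ≤ a.rmax d := by
    refine le_trans ?_ hrmax
    rw [hlo, hυ]
    linarith
  have hr'1 : 1 ≤ r' := by
    rw [hr']
    exact Nat.le_floor (by push_cast; linarith)
  have hr'le : (r' : ℝ) ≤ 2 * (a.level d : ℝ) * β + a.υ * a.lglg := by
    rw [hr']
    exact Nat.floor_le (by linarith)
  have hr'rmax : r' ≤ a.rmax d := by exact_mod_cast hr'le.trans hrmax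
  have htest : ∀ m r (D : Fin 2 → List ((Fin d → ℝ) × ℝ)), a.test m r D ↔ ∃ k : Fin 2,
      ∃ z ∈ a.mesh m, a.threshold d r <
        |lpr (D k) (((a.q : ℝ) ^ a.level d)⁻¹) (floorLt a.βhi) z -
          lpr (D k) (((a.q : ℝ) ^ a.level₂ d)⁻¹) (floorLt a.βhi) z| := fun _ _ _ => Iff.rfl
  have hbounds := sInf_rlast_bounds a x y hq1 ht htn hlormax ?_ hm' hr'1 hr'rmax ?_
  · obtain ⟨h1, h2⟩ := hbounds
    set s := sInf ((a.run x y t).rlast '' (bins d a.q (a.level d) : Set (Fin d → ℕ)))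
    have h2' : (s : ℝ) ≤ 2 * (a.level d : ℝ) * β + a.υ * a.lglg :=
      (Nat.cast_le.2 h2).trans hr'le
    have hw : 0 < (a.βlo + d - 1) * a.lg := by
      have : 0 < a.βlo + d - 1 := by linarith
      positivity
    have hβhi0 : 0 < a.βhi := hβ0.trans_le hβhi
    have hlev : (a.βlo + d - 1) * a.lg / (2 * a.βhi + d) ^ 2 ≤ a.level d := Nat.le_ceil _
    have hlpos : (0 : ℝ) < a.level d := lt_of_lt_of_le (by positivity) hlev
    have hest : a.estimate (a.run x y t) = (s - a.υ * a.lglg) / (2 * a.level d) := by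
      rw [Params.estimate, one_div_mul_eq_div]
    rw [hest]
    constructor
    · rw [le_div_iff₀ (by positivity)]
      have h3 : 3 * a.lglg ≤ 3 * (2 * a.βhi + d) ^ 2 * a.lglg / ((a.βlo + d - 1) * a.lg) *
          a.level d := by
        rw [div_mul_eq_mul_div, le_div_iff₀ hw]
        rw [div_le_iff₀ (by positivity)] at hlev
        linarith [mul_le_mul_of_nonneg_left hlev (by linarith : 0 ≤ 3 * a.lglg)]
      rw [hlo] at h1
      rw [hυ]
      linarith
    · rw [div_le_iff₀ (by positivity)]
      linarith
  · -- no test is positive in the early rounds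
    intro m hm r hr1 hrn hrlo
    rw [htest]
    rintro ⟨k, z, hz, hlt⟩
    rcases le_or_gt (a.threshold d r) 1 with h1 | h1
    · have hrmax' : r ≤ a.rmax d := by exact_mod_cast hrlo.le.trans hlormax
      obtain ⟨e1, e2⟩ := hdev m hm r hr1 hrmax' h1 k z hz hrn
      rw [mul_add, hCs] at e1 e2
      have e3 := a.le_threshold hq hG hγ hrlo.le
      have e4 : 4 * C * H ≤ a.threshold d r :=
        (mul_le_mul_of_nonneg_right hG1 hHpos.le).trans e3
      have e5 : C * H₂ ≤ C * H := mul_le_mul_of_nonneg_left hH₂H hC.le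
      have e6 := hlt.trans_le (abs_sub_le _ (f k z) _)
      rw [abs_sub_comm (f k z)] at e6
      linarith
    -- both estimators lie in `[0,1]`, so they cannot differ by more than `1`
    · have l1 := lpr_mem_Icc (p := floorLt a.βhi) (a.sample x y m r k n)
        (((a.q : ℝ) ^ a.level d)⁻¹) z
      have l2 := lpr_mem_Icc (p := floorLt a.βhi) (a.sample x y m r k n)
        (((a.q : ℝ) ^ a.level₂ d)⁻¹) z
      have := h1.trans hlt
      rw [lt_abs] at this
      rcases this with h | h <;> linarith [l1.1, l1.2, l2.1, l2.2]
  · -- the test is positive in round `r'`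
    intro hrn
    obtain ⟨z, hz, hzc⟩ := hgap
    rw [htest]
    refine ⟨k', z, hz, ?_⟩
    have e1 := hdev' z hz hrn
    have e2 := (hdev m' hm' r' hr'1 hr'rmax hthr k' z hz hrn).2
    rw [mul_add, hCs] at e2
    rw [hCs] at e1
    have e3 : a.threshold d r' * Real.log a.T ≤ a.γ * a.q * H := by
      refine a.threshold_le hq hG hγ hυ ?_
      rw [hr']
      exact (Nat.lt_floor_add_one _).le
    have e4 : a.threshold d r' ≤ c / 4 * H := by
      refine le_of_mul_le_mul_right (e3.trans ?_) hGpos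
      linarith [mul_le_mul_of_nonneg_right hG2 hHpos.le]
    have e5 : C * H₂ ≤ c / 4 * H := by
      refine le_of_mul_le_mul_right ?_ hGpos
      linarith [mul_le_mul_of_nonneg_right hG3 hHpos.le, mul_le_mul_of_nonneg_left hHH hC.le]
    have e6 := hzc.trans (abs_sub_le (v z)
      (lpr (a.sample x y m' r' k' n) (((a.q : ℝ) ^ a.level d)⁻¹) (floorLt a.βhi) z) (f k' z))
    have e7 := abs_sub_le
      (lpr (a.sample x y m' r' k' n) (((a.q : ℝ) ^ a.level d)⁻¹) (floorLt a.βhi) z)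
      (lpr (a.sample x y m' r' k' n) (((a.q : ℝ) ^ a.level₂ d)⁻¹) (floorLt a.βhi) z) (f k' z)
    rw [abs_sub_comm (v z)] at e6
    have e8 : 0 < c * H := by positivity
    linarith

end Favourable

/-! ### Probabilities of the unfavourable events -/

section Unfavourable

variable {a : Params} {d : ℕ} {Ω : Type*} [MeasurableSpace Ω] {P : Measure Ω}
  [IsProbabilityMeasure P] {pX : (Fin d → ℝ) → ℝ} {f : Fin 2 → (Fin d → ℝ) → ℝ}
  {X : ℕ → Ω → Fin d → ℝ} {Y : ℕ → Ω → Fin 2 → ℝ} {ρlo ρhi : ℝ}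

lemma card_bins (d q l : ℕ) : (bins d q l).card = q ^ (l * d) := by
  simp [bins, pow_mul]

/-- With high probability, every hypercube completes all rounds within the horizon. -/
lemma measure_exists_visits_lt_le (hq : 2 ≤ a.q) (hG : 1 ≤ Real.log a.T) (hβlo : 0 < a.βlo)
    (hβlo1 : a.βlo ≤ 1) (hβ : a.βlo ≤ a.βhi) (hυ : a.υ = (d : ℝ) / a.βlo + 4) (hd : 1 ≤ d)
    (hlg : 1 ≤ a.lg) (hlglg : 3 + 2 * a.βhi + d ≤ a.lglg) (hpX : BoundedDensity ρlo ρhi pX)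
    (hρlo : 0 < ρlo) (hM : IsModel P pX f X Y) {n : ℕ}
    (hn : 4 / ρlo * Real.log a.T ^ (2 * (d : ℝ) / a.βlo + 4) *
        (a.T : ℝ) ^ ((a.βlo + d - 1) / (2 * a.βhi + d)) ≤ n) :
    P {ω | ∃ m ∈ bins d a.q (a.level d), visits a.q (a.level d) (fun s => X s ω) m n <
      2 * ∑ i ∈ Finset.Ico 1 (a.rmax d + 1), a.q ^ i} ≤
    ENNReal.ofReal ((a.T : ℝ) ^ ((levelRate d a.βlo a.βhi + 1) * d) *
      Real.exp (-(a.T : ℝ) ^ (2 * levelRate d a.βlo a.βhi * a.βhi))) := by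
  have hq1 : 1 ≤ a.q := one_le_two.trans hq
  have hqpos : (0 : ℝ) < a.q := by exact_mod_cast hq1
  set N := 2 * ∑ i ∈ Finset.Ico 1 (a.rmax d + 1), a.q ^ i with hN
  set p₀ : ℝ := ρlo * (((a.q : ℝ) ^ a.level d)⁻¹) ^ d with hp₀
  have hset : {ω | ∃ m ∈ bins d a.q (a.level d), visits a.q (a.level d) (fun s => X s ω) m n < N} =
      ⋃ m ∈ bins d a.q (a.level d), {ω | visits a.q (a.level d) (fun s => X s ω) m n < N} := by
    ext ω; simp
  have hNle : (N : ℝ) ≤ 4 * (a.q : ℝ) ^ a.rmax d := by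
    have := sum_pow_le hq (a.rmax d)
    have h2 : N ≤ 4 * a.q ^ a.rmax d := by omega
    exact_mod_cast h2
  have hbig : 16 * (a.q : ℝ) ^ a.rmax d ≤ n * p₀ := by
    have h1 := a.pow_rmax_le hq hG hβlo hβlo1 hβ hυ hd hlglg
    have hQ : (0 : ℝ) < (a.q : ℝ) ^ (a.level d * d) := by positivity
    have h2 : p₀ = ρlo / (a.q : ℝ) ^ (a.level d * d) := by
      rw [hp₀, inv_pow, ← pow_mul]; rfl
    rw [h2, mul_div_assoc', le_div_iff₀ hQ]
    have h3 := mul_le_mul_of_nonneg_right hn hρlo.le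
    have h4 : 4 / ρlo * Real.log a.T ^ (2 * (d : ℝ) / a.βlo + 4) *
        (a.T : ℝ) ^ ((a.βlo + d - 1) / (2 * a.βhi + d)) * ρlo =
        4 * (Real.log a.T ^ (2 * (d : ℝ) / a.βlo + 4) *
          (a.T : ℝ) ^ ((a.βlo + d - 1) / (2 * a.βhi + d))) := by field_simp
    linarith
  have hT := a.T_rpow_le_pow_rmax (d := d) hq hG hβlo hβ (by rw [hυ]; positivity)
  have hone : ∀ m ∈ bins d a.q (a.level d),
      P {ω | visits a.q (a.level d) (fun s => X s ω) m n < N} ≤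
        ENNReal.ofReal (Real.exp (-(a.T : ℝ) ^ (2 * levelRate d a.βlo a.βhi * a.βhi))) := by
    intro m hm
    refine (measure_visits_lt_le hM.measurable_X hM.measurable_Y hM.indep a.q (a.level d) m
      (p₀ := p₀) (fun t => ?_) n N).trans (ENNReal.ofReal_le_ofReal (Real.exp_le_exp.2 ?_))
    · rw [measure_binOf hpX hρlo hM hq1 hm t]
      exact le_mass hpX hρlo hq1 hm
    · have : 0 < (a.q : ℝ) ^ a.rmax d := by positivity
      linarith
  rw [hset]
  refine (measure_biUnion_finset_le _ _).trans ((Finset.sum_le_sum hone).trans ?_)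
  rw [Finset.sum_const, card_bins, nsmul_eq_mul, ← ENNReal.ofReal_natCast,
    ← ENNReal.ofReal_mul (Nat.cast_nonneg _)]
  refine ENNReal.ofReal_le_ofReal (mul_le_mul_of_nonneg_right ?_ (Real.exp_pos _).le)
  push_cast
  exact a.pow_level_le hq hG hβlo hd hlg

/-- The exponential bound for one event, with the tuning of the threshold. -/
lemma exp_threshold_le (hq : 2 ≤ a.q) (hG : 1 ≤ Real.log a.T) {C c w : ℝ} (hc : 0 < c) (hC : 0 < C)
    (hw : 1 ≤ (a.q : ℝ) ^ d * Real.log a.T ^ ((d : ℝ) / a.βlo) * w) (r : ℕ) :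
    Real.exp (-(c * ((a.q : ℝ) ^ r * (w * (a.threshold d r / (4 * C)) ^ 2)))) ≤
      (a.T : ℝ) ^ (-(a.γ ^ 2 * (c / (16 * C ^ 2 * (a.q : ℝ) ^ d)))) := by
  have hqpos : (0 : ℝ) < a.q := by exact_mod_cast (zero_lt_two.trans_le hq)
  have hTpos : (0 : ℝ) < a.T := by
    by_contra! h
    have : (a.T : ℝ) = 0 := le_antisymm h (Nat.cast_nonneg _)
    rw [this, Real.log_zero] at hG
    linarith
  have h1 := a.pow_mul_threshold_sq (d := d) hq hG r
  have h2 : c * ((a.q : ℝ) ^ r * (w * (a.threshold d r / (4 * C)) ^ 2)) =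
      c / (16 * C ^ 2) * (w * ((a.q : ℝ) ^ r * a.threshold d r ^ 2)) := by
    field_simp; ring
  rw [Real.rpow_def_of_pos hTpos]
  refine Real.exp_le_exp.2 ?_
  rw [h2, h1]
  have h3 : Real.log a.T * -(a.γ ^ 2 * (c / (16 * C ^ 2 * (a.q : ℝ) ^ d))) =
      -(c / (16 * C ^ 2) * (a.γ ^ 2 * Real.log a.T) * (((a.q : ℝ) ^ d)⁻¹ * 1)) := by
    field_simp
  rw [h3]
  refine neg_le_neg ?_
  calc c / (16 * C ^ 2) * (a.γ ^ 2 * Real.log a.T) * (((a.q : ℝ) ^ d)⁻¹ * 1)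
      ≤ c / (16 * C ^ 2) * (a.γ ^ 2 * Real.log a.T) * (((a.q : ℝ) ^ d)⁻¹ *
        ((a.q : ℝ) ^ d * Real.log a.T ^ ((d : ℝ) / a.βlo) * w)) := by gcongr
    _ = _ := by field_simp

end Unfavourable

/-! ### The union bound -/

section UnionBound

variable {a : Params} {d : ℕ} {Ω : Type*} [MeasurableSpace Ω] {P : Measure Ω}
  {pX : (Fin d → ℝ) → ℝ} {f : Fin 2 → (Fin d → ℝ) → ℝ}
  {X : ℕ → Ω → Fin d → ℝ} {Y : ℕ → Ω → Fin 2 → ℝ} {ρlo ρhi : ℝ}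

lemma one_sub_le_measureReal [IsProbabilityMeasure P] {S B : Set Ω} {x : ℝ} (hS : Sᶜ ⊆ B) (hx : 0 ≤ x)
    (hB : P B ≤ ENNReal.ofReal x) : 1 - x ≤ P.real S := by
  have h1 : 1 ≤ P.real S + P.real B := by
    rw [← probReal_univ (μ := P)]
    refine (measureReal_mono ?_).trans (measureReal_union_le S B)
    intro ω _
    by_cases h : ω ∈ S
    · exact Or.inl h
    · exact Or.inr (hS h)
  have h2 : P.real B ≤ x := ENNReal.toReal_le_of_le_ofReal hx hB
  linarith

lemma measure_exists_mesh_le (m : Fin d → ℕ) {F : (Fin d → ℝ) → Set Ω} {B : ENNReal}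
    (hF : ∀ z ∈ a.mesh m, P (F z) ≤ B) :
    P {ω | ∃ z ∈ a.mesh m, ω ∈ F z} ≤ ((a.q ^ a.meshLevel d) ^ d : ℕ) * B := by
  obtain ⟨Z, hZ, hcard⟩ := exists_finset_mesh a m
  have hset : {ω | ∃ z ∈ a.mesh m, ω ∈ F z} = ⋃ z ∈ Z, F z := by
    ext ω
    simp [← hZ]
  rw [hset]
  refine (measure_biUnion_finset_le _ _).trans ((Finset.sum_le_sum fun z hz => hF z ?_).trans ?_)
  · rw [← hZ]; exact hz
  · rw [Finset.sum_const, nsmul_eq_mul]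
    gcongr

/-- A union bound over the hypercubes, rounds, arms and mesh points. -/
lemma measure_exists_le {F : (Fin d → ℕ) → ℕ → Fin 2 → (Fin d → ℝ) → Set Ω} {B : ENNReal}
    (hF : ∀ m ∈ bins d a.q (a.level d), ∀ r ∈ Finset.Icc 1 (a.rmax d), ∀ k, ∀ z ∈ a.mesh m,
      P (F m r k z) ≤ B) :
    P {ω | ∃ m ∈ bins d a.q (a.level d), ∃ r ∈ Finset.Icc 1 (a.rmax d), ∃ k, ∃ z ∈ a.mesh m,
      ω ∈ F m r k z} ≤
      ((a.q ^ (a.level d * d) * a.rmax d * 2 * (a.q ^ a.meshLevel d) ^ d : ℕ) : ENNReal) * B := by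
  have hset : {ω | ∃ m ∈ bins d a.q (a.level d), ∃ r ∈ Finset.Icc 1 (a.rmax d), ∃ k,
      ∃ z ∈ a.mesh m, ω ∈ F m r k z} = ⋃ i ∈ (bins d a.q (a.level d) ×ˢ
        (Finset.Icc 1 (a.rmax d) ×ˢ (Finset.univ : Finset (Fin 2)))),
        {ω | ∃ z ∈ a.mesh i.1, ω ∈ F i.1 i.2.1 i.2.2 z} := by
    ext ω
    simp only [Set.mem_ofPred_eq, Set.mem_iUnion, Finset.mem_product, Finset.mem_univ, and_true,
      exists_prop, Prod.exists]
    constructor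
    · rintro ⟨m, hm, r, hr, k, z, hz⟩
      exact ⟨m, r, k, ⟨hm, hr⟩, z, hz⟩
    · rintro ⟨m, r, k, ⟨hm, hr⟩, z, hz⟩
      exact ⟨m, hm, r, hr, k, z, hz⟩
  rw [hset]
  refine (measure_biUnion_finset_le _ _).trans ((Finset.sum_le_sum fun i hi =>
    measure_exists_mesh_le i.1 (B := B) fun z hz => ?_).trans ?_)
  · simp only [Finset.mem_product, Finset.mem_univ, and_true] at hi
    exact hF i.1 hi.1 i.2.1 hi.2 i.2.2 z hz
  · rw [Finset.sum_const, nsmul_eq_mul, ← mul_assoc]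
    simp only [Finset.card_product, card_bins, Nat.card_Icc, Finset.card_univ, Fintype.card_fin]
    rw [← Nat.cast_mul, Nat.add_sub_cancel]
    refine le_of_eq ?_
    congr 2
    ring

/-- The probability of the second claim, in terms of the constants of the deviation bounds and of
the gap between the projection and the payoff. -/
lemma one_sub_le_measure_estimate [IsProbabilityMeasure P] {v : (Fin d → ℝ) → ℝ} {β C c c' : ℝ} {n : ℕ}
    {m' : Fin d → ℕ} {k' : Fin 2}
    (hq : 2 ≤ a.q) (hG : 1 ≤ Real.log a.T) (hγ : 0 < a.γ) (hβlo : 0 < a.βlo)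
    (hβlo1 : a.βlo ≤ 1)
    (hβ : a.βlo ≤ β) (hβhi : β ≤ a.βhi) (hυ : a.υ = (d : ℝ) / a.βlo + 4) (hd : 1 ≤ d)
    (hlg : 1 ≤ a.lg) (hlglg : 3 + 2 * a.βhi + d ≤ a.lglg) (hC : 1 ≤ C) (hc : 0 < c) (hc' : 0 < c')
    (hG1 : 4 * C ≤ a.γ * Real.log a.T) (hG2 : 4 * a.γ * a.q ≤ c' * Real.log a.T)
    (hG3 : 4 * C ≤ c' * Real.log a.T) (hG4 : a.γ * a.q ≤ Real.log a.T)
    (hpX : BoundedDensity ρlo ρhi pX) (hρlo : 0 < ρlo) (hM : IsModel P pX f X Y)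
    (hn1 : 1 ≤ n) (hn : 4 / ρlo * Real.log a.T ^ (2 * (d : ℝ) / a.βlo + 4) *
        (a.T : ℝ) ^ ((a.βlo + d - 1) / (2 * a.βhi + d)) ≤ n)
    (hpay : ∀ m ∈ bins d a.q (a.level d), ∀ r, 1 ≤ r → ∀ k, ∀ z ∈ bin a.q (a.level d) m, ∀ h, 0 < h →
      h ≤ ((a.q : ℝ) ^ a.level d)⁻¹ → ∀ s, 0 ≤ s → s ≤ 1 →
      P {ω | r < a.roundAt (fun s => X s ω) m n ∧ C * (h ^ β + s) <
        |lpr (a.sample (fun s => X s ω) (fun s => Y s ω) m r k n) h (floorLt a.βhi) z - f k z|} ≤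
      ENNReal.ofReal (C * Real.exp
        (-(c * ((a.q : ℝ) ^ r * ((h * (a.q : ℝ) ^ a.level d) ^ d * s ^ 2))))))
    (hm' : m' ∈ bins d a.q (a.level d))
    (hgap : ∃ z ∈ a.mesh m', c' * (((a.q : ℝ) ^ a.level d)⁻¹) ^ β ≤ |v z - f k' z|)
    (hproj : ∀ r, 1 ≤ r → ∀ z ∈ bin a.q (a.level d) m', ∀ s, 0 ≤ s → s ≤ 1 →
      P {ω | r < a.roundAt (fun s => X s ω) m' n ∧ C * s <
        |lpr (a.sample (fun s => X s ω) (fun s => Y s ω) m' r k' n) (((a.q : ℝ) ^ a.level d)⁻¹)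
          (floorLt a.βhi) z - v z|} ≤
      ENNReal.ofReal (C * Real.exp (-(c * ((a.q : ℝ) ^ r * s ^ 2))))) :
    1 - ((a.T : ℝ) ^ ((levelRate d a.βlo a.βhi + 1) * d) *
      Real.exp (-(a.T : ℝ) ^ (2 * levelRate d a.βlo a.βhi * a.βhi)) +
      5 * (a.T : ℝ) ^ countRate d a.βlo a.βhi a.υ *
        (C * (a.T : ℝ) ^ (-(a.γ ^ 2 * (c / (16 * C ^ 2 * (a.q : ℝ) ^ d)))))) ≤
    P.real {ω | ∃ t, a.StopsAt (fun s => X s ω) (fun s => Y s ω) t ∧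
      a.estimate (a.run (fun s => X s ω) (fun s => Y s ω) t) ∈
      Set.Icc (β - 3 * (2 * a.βhi + d) ^ 2 * a.lglg / ((a.βlo + d - 1) * a.lg)) β} := by
  have hq1 : 1 ≤ a.q := one_le_two.trans hq
  have hqpos : (0 : ℝ) < a.q := by exact_mod_cast hq1
  have hq1r : (1 : ℝ) ≤ a.q := by exact_mod_cast hq1
  have hβ0 : 0 < β := hβlo.trans_le hβ
  have hβlh : a.βlo ≤ a.βhi := hβ.trans hβhi
  have hGpos : 0 < Real.log a.T := zero_lt_one.trans_le hG
  have hCpos : 0 < C := zero_lt_one.trans_le hC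
  have hdr : (1 : ℝ) ≤ d := by exact_mod_cast hd
  have hQ : (0 : ℝ) < (a.q : ℝ) ^ a.level d := by positivity
  have hlglg1 : 1 ≤ a.lglg := by linarith
  have hυ0 : 0 ≤ a.υ := by rw [hυ]; positivity
  have hratio := a.le_bandwidth_ratio (d := d) hq hG hβlo
  have hratio1 : 1 ≤ (a.q : ℝ) ^ d * Real.log a.T ^ ((d : ℝ) / a.βlo) * 1 := by
    rw [mul_one]
    exact one_le_mul_of_one_le_of_one_le (one_le_pow₀ hq1r) (Real.one_le_rpow hG (by positivity))
  set h₁ : ℝ := ((a.q : ℝ) ^ a.level d)⁻¹ with hh₁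
  set h₂ : ℝ := ((a.q : ℝ) ^ a.level₂ d)⁻¹ with hh₂
  have hh₁pos : 0 < h₁ := by positivity
  have hh₂pos : 0 < h₂ := by positivity
  have hh₂₁ : h₂ ≤ h₁ := inv_anti₀ hQ (pow_le_pow_right₀ hq1r (Nat.le_add_right _ _))
  set b : ℝ := C * (a.T : ℝ) ^ (-(a.γ ^ 2 * (c / (16 * C ^ 2 * (a.q : ℝ) ^ d)))) with hb
  have hb0 : 0 ≤ b := by positivity
  have hthr0 : ∀ r, 0 ≤ a.threshold d r := fun r => by
    rw [Params.threshold]; positivity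
  have hs1 : ∀ r, a.threshold d r ≤ 1 → a.threshold d r / (4 * C) ≤ 1 := fun r hr => by
    rw [div_le_one (by positivity)]; linarith
  -- the round in which the test is positive
  set r' : ℕ := ⌊2 * (a.level d : ℝ) * β + a.υ * a.lglg⌋₊ with hr'
  have hr'1 : 1 ≤ r' := by
    refine Nat.le_floor ?_
    have h1 : 0 ≤ 2 * (a.level d : ℝ) * β := by positivity
    have h2 : 4 ≤ a.υ := by rw [hυ]; linarith [div_nonneg (zero_le_one.trans hdr) hβlo.le]
    have h3 := mul_le_mul h2 hlglg1 zero_le_one (by linarith)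
    push_cast
    linarith
  have hthr' : a.threshold d r' ≤ 1 := by
    have h1 := a.threshold_le hq hG hγ hυ (Nat.lt_floor_add_one (2 * (a.level d : ℝ) * β +
      a.υ * a.lglg)).le
    have h2 : (((a.q : ℝ) ^ a.level d)⁻¹) ^ β ≤ 1 :=
      Real.rpow_le_one hh₁pos.le (inv_le_one_of_one_le₀ (one_le_pow₀ hq1r)) hβ0.le
    refine le_of_mul_le_mul_right (h1.trans ?_) hGpos
    rw [one_mul]
    exact (mul_le_of_le_one_right (by positivity) h2).trans hG4
  set B₁ : Set Ω := {ω | ∃ m ∈ bins d a.q (a.level d),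
    visits a.q (a.level d) (fun s => X s ω) m n <
      2 * ∑ i ∈ Finset.Ico 1 (a.rmax d + 1), a.q ^ i} with hB₁
  have hPB₁ : P B₁ ≤ ENNReal.ofReal _ := measure_exists_visits_lt_le hq hG hβlo hβlo1 hβlh hυ hd hlg
    hlglg hpX hρlo hM hn
  -- rounds with a threshold above `1` need no estimate, and the deviation bound does not cover them
  set F : ℝ → (Fin d → ℕ) → ℕ → Fin 2 → (Fin d → ℝ) → Set Ω := fun h m r k z =>
    {ω | a.threshold d r ≤ 1 ∧ r < a.roundAt (fun s => X s ω) m n ∧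
      C * (h ^ β + a.threshold d r / (4 * C)) <
        |lpr (a.sample (fun s => X s ω) (fun s => Y s ω) m r k n) h (floorLt a.βhi) z - f k z|}
    with hF
  have hPF : ∀ h, 0 < h → h ≤ h₁ →
      1 ≤ (a.q : ℝ) ^ d * Real.log a.T ^ ((d : ℝ) / a.βlo) * (h * (a.q : ℝ) ^ a.level d) ^ d →
      ∀ m ∈ bins d a.q (a.level d), ∀ r ∈ Finset.Icc 1 (a.rmax d), ∀ k, ∀ z ∈ a.mesh m,
        P (F h m r k z) ≤ ENNReal.ofReal b := by
    intro h hh hh' hw m hm r hr k z hz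
    by_cases hthr : a.threshold d r ≤ 1
    · refine (measure_mono fun ω hω => hω.2).trans ((hpay m hm r (Finset.mem_Icc.1 hr).1 k z hz.1
        h hh hh' _ (div_nonneg (hthr0 r) (by positivity)) (hs1 r hthr)).trans
        (ENNReal.ofReal_le_ofReal ?_))
      exact mul_le_mul_of_nonneg_left (exp_threshold_le hq hG hc hCpos hw r) hCpos.le
    · have : F h m r k z = ∅ := by
        ext ω
        simp [hF, hthr]
      rw [this, measure_empty]
      exact zero_le
  have hP₁ := measure_exists_le (hPF h₁ hh₁pos le_rfl
    (by rwa [hh₁, inv_mul_cancel₀ hQ.ne', one_pow]))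
  have hP₂ := measure_exists_le (hPF h₂ hh₂pos hh₂₁ hratio)
  set E : ℝ → Set Ω := fun h => {ω | ∃ m ∈ bins d a.q (a.level d),
    ∃ r ∈ Finset.Icc 1 (a.rmax d), ∃ k, ∃ z ∈ a.mesh m, ω ∈ F h m r k z} with hE
  set F' : (Fin d → ℝ) → Set Ω := fun z => {ω | r' < a.roundAt (fun s => X s ω) m' n ∧
    C * (a.threshold d r' / (4 * C)) <
      |lpr (a.sample (fun s => X s ω) (fun s => Y s ω) m' r' k' n) h₁ (floorLt a.βhi) z - v z|}
    with hF'
  have hP₃ : P {ω | ∃ z ∈ a.mesh m', ω ∈ F' z} ≤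
      ((a.q ^ a.meshLevel d) ^ d : ℕ) * ENNReal.ofReal b := by
    refine measure_exists_mesh_le m' fun z hz => ?_
    refine (hproj r' hr'1 z hz.1 _ (div_nonneg (hthr0 r') (by positivity))
      (hs1 r' hthr')).trans (ENNReal.ofReal_le_ofReal ?_)
    have := exp_threshold_le hq hG hc hCpos hratio1 r'
    rw [one_mul] at this
    exact mul_le_mul_of_nonneg_left this hCpos.le
  refine one_sub_le_measureReal (B := B₁ ∪ (E h₁ ∪ E h₂ ∪ {ω | ∃ z ∈ a.mesh m', ω ∈ F' z}))
    ?_ (by positivity) ?_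
  · -- outside the unfavourable events, the estimate is in the interval
    rw [Set.compl_subset_comm]
    intro ω hω
    rw [Set.mem_compl_iff, Set.mem_union, Set.mem_union, Set.mem_union, not_or, not_or, not_or] at hω
    obtain ⟨hω1, ⟨hω2, hω3⟩, hω4⟩ := hω
    refine estimate_mem_Icc (C := C) (c := c') (n := n) (m' := m') (k' := k') (r' := r') (v := v)
      hq hG hγ hβlo hβ hβhi hυ hd hlg hlglg1 hCpos hc' hG1 hG2 hG3 hn1 hr' ?_ ?_ hm' hgap hthr' ?_
    · intro m hm
      by_contra! h
      exact hω1 ⟨m, hm, h⟩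
    · intro m hm r hr1 hr2 hthr k z hz hr
      constructor
      · by_contra! h
        exact hω2 ⟨m, hm, r, Finset.mem_Icc.2 ⟨hr1, hr2⟩, k, z, hz, hthr, hr, h⟩
      · by_contra! h
        exact hω3 ⟨m, hm, r, Finset.mem_Icc.2 ⟨hr1, hr2⟩, k, z, hz, hthr, hr, h⟩
    · intro z hz hr
      by_contra! h
      exact hω4 ⟨z, hz, hr, h⟩
  · refine (measure_union_le _ _).trans ?_
    rw [ENNReal.ofReal_add (by positivity) (by positivity)]
    refine add_le_add hPB₁ ?_
    refine (measure_union_le _ _).trans ((add_le_add (measure_union_le _ _) le_rfl).trans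
      ((add_le_add (add_le_add hP₁ hP₂) hP₃).trans ?_))
    rw [← add_mul, ← add_mul, ← Nat.cast_add, ← Nat.cast_add, ← ENNReal.ofReal_natCast,
      ← ENNReal.ofReal_mul (Nat.cast_nonneg _)]
    refine ENNReal.ofReal_le_ofReal (mul_le_mul_of_nonneg_right ?_ hb0)
    have hcount := a.count_le (d := d) hq hG hβlo hβlh hυ0 hd hlg
    refine le_trans ?_ (mul_le_mul_of_nonneg_left hcount (by norm_num : (0 : ℝ) ≤ 5))
    push_cast
    have hr1 : (1 : ℝ) ≤ a.rmax d := by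
      have h1 : r' ≤ a.rmax d := by
        refine (Nat.floor_le_ceil _).trans (Nat.ceil_mono ?_)
        gcongr
      exact_mod_cast hr'1.trans h1
    have hl1 : (1 : ℝ) ≤ (a.q : ℝ) ^ (a.level d * d) := one_le_pow₀ hq1r
    have hM0 : (0 : ℝ) ≤ ((a.q : ℝ) ^ a.meshLevel d) ^ d := by positivity
    have h5 := mul_le_mul_of_nonneg_right (one_le_mul_of_one_le_of_one_le hl1 hr1) hM0
    linarith

end UnionBound

/-! ### Large horizons -/

/-- Every condition on the horizon is implied by a lower bound for `log T` and a bound of `log T` by a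
power of `T`. -/
lemma eventually_horizon {c₃ K K' : ℝ} (hc₃ : 0 < c₃) : ∃ T₀ : ℕ, 0 < T₀ ∧ ∀ T : ℕ, T₀ ≤ T →
    K ≤ Real.log T ∧ K' * Real.log T ≤ (T : ℝ) ^ c₃ := by
  have h1 : Filter.Tendsto (fun T : ℕ => Real.log T) Filter.atTop Filter.atTop :=
    Real.tendsto_log_atTop.comp tendsto_natCast_atTop_atTop
  have h2 := (isLittleO_log_rpow_atTop hc₃).bound (by positivity : 0 < (|K'| + 1)⁻¹)
  have h3 := tendsto_natCast_atTop_atTop.eventually h2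
  obtain ⟨T₀, hT₀⟩ := Filter.eventually_atTop.1 ((h1.eventually_ge_atTop K).and
    ((h1.eventually_ge_atTop 0).and h3))
  refine ⟨T₀ + 1, T₀.succ_pos, fun T hT => ?_⟩
  obtain ⟨e1, e2, e3⟩ := hT₀ T (by omega)
  refine ⟨e1, ?_⟩
  rw [Real.norm_of_nonneg e2, Real.norm_of_nonneg (by positivity),
    le_inv_mul_iff₀ (by positivity)] at e3
  nlinarith [le_abs_self K']

end SACB

end

theorem theorem3 (d : ℕ) (hd : 1 ≤ d) (βlo βhi b L ρlo ρhi : ℝ)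
    (hβlo : 0 < βlo) (hβlo_one : βlo ≤ 1) (hβ : βlo ≤ βhi) (hb : 0 < b) (hL : 0 < L)
    (hρlo : 0 < ρlo) (hρ : ρlo ≤ ρhi) :
    ∃ c₁ c₂ c₃ c₄ c₆ : ℝ, 0 < c₁ ∧ 0 < c₂ ∧ 0 < c₃ ∧ 0 < c₄ ∧ 0 < c₆ ∧
      ∀ q : ℕ, 2 ≤ q → ∃ c₅ : ℝ, 0 < c₅ ∧
        ∀ γ : ℝ, 0 < γ → ∀ l₀ : ℝ, 0 ≤ l₀ → ∃ T₀ : ℕ, 0 < T₀ ∧ ∀ T : ℕ, T₀ ≤ T →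
          ∀ β ∈ Set.Icc βlo βhi,
          ∀ (Ω : Type*) [MeasurableSpace Ω] (P : Measure Ω) [IsProbabilityMeasure P]
            (pX : (Fin d → ℝ) → ℝ) (f : Fin 2 → (Fin d → ℝ) → ℝ)
            (X : ℕ → Ω → Fin d → ℝ) (Y : ℕ → Ω → Fin 2 → ℝ),
            SACB.BoundedDensity ρlo ρhi pX →
            SACB.IsModel P pX f X Y →
            (∀ k, SACB.IsHolder β L (f k)) →
            SACB.SelfSimilar βhi pX β b l₀ f →
            let a : SACB.Params :=
              { q := q, T := T, βlo := βlo, βhi := βhi, γ := γ, υ := (d : ℝ) / βlo + 4 }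
            1 - 2 * (T : ℝ) ^ c₁ * Real.exp (-(c₂ * (T : ℝ) ^ c₃)) ≤
                P.real {ω | ∃ t : ℕ, a.StopsAt (fun s => X s ω) (fun s => Y s ω) t ∧
                  t ≤ ⌈4 / ρlo * Real.log T ^ (2 * (d : ℝ) / βlo + 4) *
                    (T : ℝ) ^ ((βlo + d - 1) / (2 * βhi + d))⌉₊} ∧
              1 - c₄ * Real.log T ^ ((d : ℝ) / βlo) * (T : ℝ) ^ (-(γ ^ 2 * c₅) + c₆) ≤
                P.real {ω | ∃ t : ℕ, a.StopsAt (fun s => X s ω) (fun s => Y s ω) t ∧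
                  a.estimate (a.run (fun s => X s ω) (fun s => Y s ω) t) ∈
                    Set.Icc (β - 3 * (2 * βhi + d) ^ 2 * Real.logb q (Real.log T) /
                      ((βlo + d - 1) * Real.logb q T)) β} := by
  classical
  have hdr : (1 : ℝ) ≤ d := by exact_mod_cast hd
  have hβhi : 0 < βhi := hβlo.trans_le hβ
  set p := SACB.floorLt βhi with hp
  obtain ⟨C₁, e₁, hC₁, he₁, hpay⟩ := SACB.exists_measure_lpr_sub_payoff_le d p hL hρlo hρ
  obtain ⟨C₂, e₂, hC₂, he₂, hproj⟩ := SACB.exists_measure_lpr_sub_projection_le d p hL hρlo hρ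
  obtain ⟨c', τ, H₀, hc', hτ, hH₀, hgap⟩ :=
    SACB.exists_truncated_gap d p hL (half_pos hb) hρlo hρ hβlo
  set A := SACB.levelRate d βlo βhi with hA
  have hApos : 0 < A := by
    rw [hA, SACB.levelRate]
    have : 0 < βlo + d - 1 := by linarith
    positivity
  set C : ℝ := max 1 (max C₁ C₂) with hC
  set c : ℝ := min e₁ e₂ with hc
  have hC1 : 1 ≤ C := le_max_left _ _
  have hCC₁ : C₁ ≤ C := (le_max_left _ _).trans (le_max_right _ _)
  have hCC₂ : C₂ ≤ C := (le_max_right _ _).trans (le_max_right _ _)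
  have hCpos : 0 < C := zero_lt_one.trans_le hC1
  have hcpos : 0 < c := lt_min he₁ he₂
  have hcount : 0 < SACB.countRate d βlo βhi (d / βlo + 4) := by
    rw [SACB.countRate, ← hA]
    positivity
  refine ⟨(A + 1) * d, 1, 2 * A * βhi, 5 * C + 1, SACB.countRate d βlo βhi (d / βlo + 4),
    by positivity, one_pos, by positivity, by positivity, hcount, fun q hq =>
    ⟨c / (16 * C ^ 2 * (q : ℝ) ^ d), by positivity, fun γ hγ l₀ hl₀ => ?_⟩⟩
  have hq2 : (2 : ℝ) ≤ q := by exact_mod_cast hq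
  have hlogq : 0 < Real.log q := Real.log_pos (by linarith)
  set c₅ : ℝ := c / (16 * C ^ 2 * (q : ℝ) ^ d) with hc₅
  have hc₅pos : 0 < c₅ := by positivity
  -- each summand is one of the lower bounds on `log T` that are needed
  obtain ⟨T₀, hT₀, hT⟩ := SACB.eventually_horizon
    (K := 1 + (q : ℝ) ^ (3 + 2 * βhi + d) + 4 * C / γ + 4 * γ * q / c' + 4 * C / c' + γ * q +
      l₀ * Real.log q / A + |Real.log H₀| / A + τ⁻¹)
    (K' := (A + 1) * d + γ ^ 2 * c₅) (c₃ := 2 * A * βhi) (by positivity)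
  refine ⟨T₀, hT₀, fun T hTT β hβmem Ω _ P _ pX f X Y hpX hM hf hss => ?_⟩
  obtain ⟨hK, hK'⟩ := hT T hTT
  have k1 : 0 < (q : ℝ) ^ (3 + 2 * βhi + d) := by positivity
  have k2 : 0 < 4 * C / γ := by positivity
  have k3 : 0 < 4 * γ * q / c' := by positivity
  have k4 : 0 < 4 * C / c' := by positivity
  have k5 : 0 < γ * q := by positivity
  have k6 : 0 ≤ l₀ * Real.log q / A := by positivity
  have k7 : 0 ≤ |Real.log H₀| / A := by positivity
  have k8 : 0 < τ⁻¹ := by positivity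
  intro a
  have hG : 1 ≤ Real.log a.T := by change 1 ≤ Real.log T; linarith
  have hGpos : 0 < Real.log T := zero_lt_one.trans_le hG
  have hTpos : (0 : ℝ) < T := by exact_mod_cast hT₀.trans_le hTT
  have hG1 : 4 * C ≤ a.γ * Real.log a.T := by
    change 4 * C ≤ γ * Real.log T
    rw [← div_le_iff₀' hγ]; linarith
  have hG2 : 4 * a.γ * a.q ≤ c' * Real.log a.T := by
    change 4 * γ * q ≤ c' * Real.log T
    rw [← div_le_iff₀' hc']; linarith
  have hG3 : 4 * C ≤ c' * Real.log a.T := by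
    change 4 * C ≤ c' * Real.log T
    rw [← div_le_iff₀' hc']; linarith
  have hG4 : a.γ * a.q ≤ Real.log a.T := by
    change γ * q ≤ Real.log T; linarith
  have hlglg : 3 + 2 * a.βhi + d ≤ a.lglg := by
    change 3 + 2 * βhi + d ≤ Real.logb q (Real.log T)
    rw [Real.le_logb_iff_rpow_le (by linarith) hGpos]
    linarith
  have haq : 2 ≤ a.q := hq
  have haβlo : 0 < a.βlo := hβlo
  have haβhi : 0 < a.βhi := hβhi
  have hlg : 1 ≤ a.lg := le_trans (by linarith) (hlglg.trans (a.lglg_le_lg haq hG))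
  have hlev : A * (Real.log T / Real.log q) ≤ a.level d := a.le_level
  have hl₀l : l₀ ≤ a.level d := by
    refine le_trans ?_ hlev
    rw [← mul_div_assoc, le_div_iff₀ hlogq, ← div_le_iff₀' hApos]
    linarith
  have hQ : (0 : ℝ) < (q : ℝ) ^ a.level d := by positivity
  have hH : ((q : ℝ) ^ a.level d)⁻¹ ≤ H₀ := by
    rw [← Real.log_le_log_iff (by positivity) hH₀, Real.log_inv, Real.log_pow]
    have h1 : A * Real.log T ≤ a.level d * Real.log q := by
      have := mul_le_mul_of_nonneg_right hlev hlogq.le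
      rwa [mul_assoc, div_mul_cancel₀ _ hlogq.ne'] at this
    have h2 : |Real.log H₀| ≤ A * Real.log T := by
      rw [← div_le_iff₀' hApos]; linarith
    linarith [neg_abs_le (Real.log H₀)]
  have hmesh : ((q : ℝ) ^ a.meshLevel d)⁻¹ ≤ τ * ((q : ℝ) ^ a.level d)⁻¹ := by
    have h1 : (q : ℝ) ^ a.level d * Real.log T ≤ (q : ℝ) ^ a.meshLevel d :=
      a.level_mul_log_le_mesh haq hG haβhi.le
    have h2 : τ⁻¹ ≤ Real.log T := by linarith
    rw [← inv_inv τ, ← mul_inv]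
    refine inv_anti₀ (by positivity) (le_trans ?_ h1)
    rw [mul_comm]
    gcongr
  set n : ℕ := ⌈4 / ρlo * Real.log T ^ (2 * (d : ℝ) / βlo + 4) *
    (T : ℝ) ^ ((βlo + d - 1) / (2 * βhi + d))⌉₊ with hn
  have hn' : 4 / ρlo * Real.log a.T ^ (2 * (d : ℝ) / a.βlo + 4) *
      (a.T : ℝ) ^ ((a.βlo + d - 1) / (2 * a.βhi + d)) ≤ n := Nat.le_ceil _
  have hn1 : 1 ≤ n := Nat.one_le_iff_ne_zero.2 (Nat.ceil_pos.2 (by positivity)).ne'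
  set R : ℝ := (T : ℝ) ^ ((A + 1) * d) * Real.exp (-(T : ℝ) ^ (2 * A * βhi)) with hR
  have hR0 : 0 < R := by positivity
  have hvis : P _ ≤ ENNReal.ofReal R := SACB.measure_exists_visits_lt_le haq hG haβlo hβlo_one hβ
    rfl hd hlg hlglg hpX hρlo hM hn'
  constructor
  · have h1 : 1 - R ≤ P.real {ω | ∃ t : ℕ, a.StopsAt (fun s => X s ω) (fun s => Y s ω) t ∧
        t ≤ n} := by
      refine SACB.one_sub_le_measureReal ?_ hR0.le hvis
      rw [Set.compl_subset_comm]
      intro ω hω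
      refine SACB.exists_stopsAt a _ _ (one_le_two.trans haq) hn1 fun m hm => ?_
      by_contra! h
      exact hω ⟨m, hm, h⟩
    refine le_trans ?_ h1
    rw [one_mul, mul_assoc]
    linarith
  · have hβ0 : 0 < β := hβlo.trans_le hβmem.1
    have hβp : SACB.floorLt β ≤ p := SACB.floorLt_mono hβmem.2
    have haq1 : 1 ≤ a.q := one_le_two.trans haq
    obtain ⟨m', hm', k', g, hg, hy⟩ := hss.exists_gap hb hβmem.2 hpX hρlo hl₀l
      (lt_of_lt_of_le one_lt_two hq)
    have hf01 := SACB.payoff_mem_Icc hpX hρlo hM k' (hf k').continuousOn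
    obtain ⟨z, hz, hzbin, hzgap⟩ := hgap β (f k') pX q (a.level d) m' g (a.mesh m') hβmem.1 hβp
      (hf k') hf01 hpX haq1 hm' hH hg (fun y hy => by
        obtain ⟨z, hz, hzy⟩ := SACB.exists_mem_mesh a haq1 hm'
          (a.level_le_meshLevel haq hG haβhi.le) hy
        exact ⟨z, hz, hz.1, hzy.trans hmesh⟩) hy
    have main := SACB.one_sub_le_measure_estimate (P := P) (a := a) (f := f) (β := β) (C := C)
      (c := c) (c' := c')
      (n := n) (m' := m') (k' := k') (v := fun z => SACB.trunc (MvPolynomial.eval z g))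
      haq hG hγ haβlo hβlo_one hβmem.1 hβmem.2 rfl hd hlg hlglg hC1 hcpos hc' hG1 hG2 hG3 hG4
      hpX hρlo hM hn1 hn' ?_ hm' ⟨z, hz, hzgap⟩ ?_
    · refine le_trans ?_ main
      change _ ≤ 1 - (R + 5 * (T : ℝ) ^ SACB.countRate d βlo βhi (d / βlo + 4) *
        (C * (T : ℝ) ^ (-(γ ^ 2 * c₅))))
      set κ := SACB.countRate d βlo βhi (d / βlo + 4)
      have hT1 : (1 : ℝ) ≤ T := by exact_mod_cast hT₀.trans_le hTT
      -- the probability of slow hypercubes is smaller than any power of `T`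
      have hR1 : R ≤ (T : ℝ) ^ (-(γ ^ 2 * c₅)) := by
        rw [hR, Real.rpow_def_of_pos hTpos, ← Real.exp_add, Real.rpow_def_of_pos hTpos (-_)]
        refine Real.exp_le_exp.2 ?_
        linarith
      have hR2 : (T : ℝ) ^ (-(γ ^ 2 * c₅)) ≤ (T : ℝ) ^ (-(γ ^ 2 * c₅) + κ) :=
        Real.rpow_le_rpow_of_exponent_le hT1 (by linarith)
      have hlogpow : 1 ≤ Real.log T ^ ((d : ℝ) / βlo) := Real.one_le_rpow hG (by positivity)
      have h1 : 5 * (T : ℝ) ^ κ * (C * (T : ℝ) ^ (-(γ ^ 2 * c₅))) =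
          5 * C * (T : ℝ) ^ (-(γ ^ 2 * c₅) + κ) := by
        rw [Real.rpow_add hTpos]; ring
      rw [h1]
      set W := (T : ℝ) ^ (-(γ ^ 2 * c₅) + κ)
      have hW : 0 < (5 * C + 1) * W := by positivity
      have h2 := mul_le_mul_of_nonneg_left hlogpow hW.le
      linarith
    · intro m hm r hr k z hz h hh hhl s hs hs1
      refine (MeasureTheory.measure_mono ?_).trans ((hpay a haq1 hpX hM hβ0 hβp k (hf k) hm hr z hz
        hh hhl hs hs1 n).trans (ENNReal.ofReal_le_ofReal ?_))
      · rintro ω ⟨h1, h2⟩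
        exact ⟨h1, lt_of_le_of_lt (mul_le_mul_of_nonneg_right hCC₁ (by positivity)) h2⟩
      · refine mul_le_mul hCC₁ (Real.exp_le_exp.2 (neg_le_neg ?_)) (Real.exp_pos _).le hCpos.le
        exact mul_le_mul_of_nonneg_right (min_le_left _ _) (by positivity)
    · intro r hr z hz s hs hs1
      refine (MeasureTheory.measure_mono ?_).trans ((hproj a haq1 hpX hM hβ0 hβp k' (hf k') hm' hr
        hg z hz hs hs1 n).trans (ENNReal.ofReal_le_ofReal ?_))
      · rintro ω ⟨h1, h2⟩
        exact ⟨h1, lt_of_le_of_lt (mul_le_mul_of_nonneg_right hCC₂ hs) h2⟩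
      · refine mul_le_mul hCC₂ (Real.exp_le_exp.2 (neg_le_neg ?_)) (Real.exp_pos _).le hCpos.le
        exact mul_le_mul_of_nonneg_right (min_le_right _ _) (by positivity)
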